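/- **Setup.** Fix integers $n,d\ge 0$, a partition $\lambda=(\lambda_1\ge\cdots\ge\lambda_n\ge 0)$ of $d$ and a composition $\mu=(\mu_1,\dots,\mu_n)$ of $d$ (the $\mu_i\ge 0$ are integers with sum $d$). Put $d_\mu:=\frac12\sum_{i=1}^n\mu_i(\mu_i-1)$ and $d_\lambda:=\frac12\sum_{i=1}^n\lambda_i(\lambda_i-1)$. Identify a basis of $\mathbb C^d$ with the boxes of the Young diagram of $\lambda$ (English convention), and let $f_1,\dots,f_d$ be this basis listed along the rows, starting with the top row. Let $x^\lambda$ be the nilpotent endomorphism sending a box to the box immediately below it, or to $0$ if it is at the bottom of its column; it has Jordan type the transpose $\lambda^T$. Let $(\cdot,\cdot)$ be the symmetric bilinear form with $(f_i,f_j)=\delta_{i,j}$, and let $g^T$ denote the transpose of $g$ with respect to it. Let $X_\mu$ be the complex projective variety of flags $0=V_0\le V_1\le\cdots\le V_n=\mathbb C^d$ with $\dim V_i/V_{i-1}=\mu_i$, and let $$X^\lambda_\mu=\{(V_0,\dots,V_n)\in X_\mu : x^\lambda V_i\subseteq V_{i-1}\text{ for } i=1,\dots,n\}$$ be the Spaltenstein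 variety, with its Zariski topology. Let $\operatorname{Std}^\lambda_\mu$ be the set of semistandard $\lambda$-tableaux (entries strictly increasing down columns and weakly increasing along rows) with exactly $\mu_i$ entries equal to $i$ for $i=1,\dots,n$. For $\mathtt S\in\operatorname{Std}^\lambda_\mu$ and $0\le j\le n$ let $\lambda^{(j)}$ be the partition whose diagram consists of the boxes of $\mathtt S$ with entries $\le j$, and let $$J^{-1}(\mathtt S)=\{(V_0,\dots,V_n)\in X^\lambda_\mu : x^\lambda|_{V_j}\text{ has Jordan type }(\lambda^{(j)})^T\text{ for } j=0,\dots,n\}.$$ **Paving cells.** For $\mathtt S\in\operatorname{Std}^\lambda_\mu$ a subset $Y^\circ_{\mathtt S}\subseteq X^\lambda_\mu$ is defined by recursion on $n$. If $n=0$, then $Y_{\mathtt S}^\circ=X^\lambda_\mu$ (a point). If $n\ge1$, let $k=\mu_n$, let $c_1<\dots<c_k$ be the columns of $\mathtt S$ containing the entry $n$, let $\overline{\mathtt S}$ be obtained from $\mathtt S$ by removing all boxes with entry $n$, let $\overline\lambda$ be its shape, and let $\overline\mu=(\mu_1,\dots,\mu_{n-1})$. Let $Y_\gamma^\circ$ be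 the Schubert cell of all $k$-dimensional subspaces $U\subseteq\mathbb C^d$ spanned by vectors $$f_{c_i}+\sum_{j<c_i,\ j\notin\{c_1,\dots,c_k\}}a_{i,j}f_j\qquad(i=1,\dots,k),$$ where the $a_{i,j}\in\mathbb C$ are then uniquely determined by $U$. For $U\in Y_\gamma^\circ$ let $g(U)\in GL_d(\mathbb C)$ be the unique matrix that maps each $f_{c_i}$ to the vector above, fixes $f_j$ for $1\le j\le\lambda_1$ with $j\notin\{c_1,\dots,c_k\}$, and satisfies $g(U)(x^\lambda f_j)=x^\lambda(g(U)f_j)$ whenever $x^\lambda f_j\neq0$. Choose a linear isomorphism $\theta:\langle f_{c_1},\dots,f_{c_k}\rangle^\perp\to\mathbb C^{d-k}$ with $\theta\circ x^\lambda=x^{\overline\lambda}\circ\theta$. Then $Y^\circ_{\mathtt S}$ consists of all $(V_0,\dots,V_n)\in X^\lambda_\mu$ such that $U:=V_{n-1}^\perp\in Y_\gamma^\circ$ and $$\bigl(\theta(g(U)^TV_0),\dots,\theta(g(U)^TV_{n-1})\bigr)\in Y^\circ_{\overline{\mathtt S}}\subseteq X^{\overline\lambda}_{\overline\mu}.$$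 **Theorem.** Let $\mathtt S\in\operatorname{Std}^\lambda_\mu$. Then $J^{-1}(\mathtt S)$ is a locally closed, smooth, irreducible subvariety of $X^\lambda_\mu$ of dimension $d_\lambda-d_\mu$. Moreover the choices of $\theta$ needed in the construction of $Y^\circ_{\mathtt S}$ can be made, and for every such choice $Y^\circ_{\mathtt S}$ is a dense open subset of $J^{-1}(\mathtt S)$. -/

import Mathlib

open Topology

namespace Spaltenstein

noncomputable section

/-! ### Partial flag varieties as classical complex varieties -/

/-- A partial flag `0 = V_0 ≤ V_1 ≤ ⋯ ≤ V_n = ℂ^ι` of type `μ`,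
that is, with `dim V_i / V_{i-1} = μ_i`. -/
@[ext]
structure PartialFlag {n : ℕ} (μ : Fin n → ℕ) (ι : Type) [Fintype ι] where
  space : Fin (n + 1) → Submodule ℂ (ι → ℂ)
  space_zero : space 0 = ⊥
  space_last : space (Fin.last n) = ⊤
  mono : Monotone space
  finrank_succ : ∀ i : Fin n, Module.finrank ℂ (space i.succ) =
    Module.finrank ℂ (space i.castSucc) + μ i

/-- An ordered basis of `ℂ^ι`, divided into consecutive blocks of sizes `μ_1, …, μ_n`. The frames
are the points of the variety of invertible matrices `GL_d(ℂ)`. -/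
structure Frame {n : ℕ} (μ : Fin n → ℕ) (ι : Type) [Fintype ι] where
  vec : (Σ i : Fin n, Fin (μ i)) → ι → ℂ
  linearIndependent : LinearIndependent ℂ vec
  span_eq_top : Submodule.span ℂ (Set.range vec) = ⊤

variable {n : ℕ} {μ : Fin n → ℕ} {ι : Type} [Fintype ι]

/-- The matrix entries of a frame. -/
def Frame.coord (v : Frame μ ι) : (Σ i : Fin n, Fin (μ i)) × ι → ℂ :=
  fun p => v.vec p.1 p.2

/-- The orbit map `GL_d(ℂ) → X_μ`: the `j`-th space of the flag is spanned by the first `j` blocks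
of the basis. -/
def Frame.flag (v : Frame μ ι) : PartialFlag μ ι where
  space j := Submodule.span ℂ (v.vec '' {p | p.1.castSucc < j})
  space_zero := by
    have : {p : Σ i : Fin n, Fin (μ i) | p.1.castSucc < (0 : Fin (n + 1))} = ∅ := by
      ext p; simp
    rw [this]; simp
  space_last := by
    have : {p : Σ i : Fin n, Fin (μ i) | p.1.castSucc < Fin.last n} = Set.univ := by
      ext p; simp [Fin.castSucc_lt_last]
    rw [this, Set.image_univ, v.span_eq_top]
  mono := fun _ _ hij => Submodule.span_mono (Set.image_mono fun _ hp => lt_of_lt_of_le hp hij)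
  finrank_succ := fun i => by
    classical
    have key : ∀ s : Finset (Σ i : Fin n, Fin (μ i)),
        Module.finrank ℂ (Submodule.span ℂ (v.vec '' (s : Set (Σ i : Fin n, Fin (μ i)))))
          = s.card := by
      intro s
      have h := finrank_span_eq_card (R := ℂ)
        (v.linearIndependent.comp (fun x : s => (x : Σ i : Fin n, Fin (μ i)))
          Subtype.val_injective)
      rw [Set.range_comp] at h
      rw [Subtype.range_coe_subtype] at h
      simpa using h
    have e1 : {p : Σ i : Fin n, Fin (μ i) | p.1.castSucc < i.succ} =
        ((Finset.univ.filter fun p : Σ i : Fin n, Fin (μ i) => p.1.castSucc < i.castSucc) ∪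
          (Finset.univ.map ⟨fun a : Fin (μ i) => (⟨i, a⟩ : Σ i : Fin n, Fin (μ i)),
            fun _ _ h => by simpa using h⟩) : Finset (Σ i : Fin n, Fin (μ i))) := by
      ext ⟨j, a⟩
      have hd : (j.castSucc < i.succ) ↔ (j < i ∨ j = i) := by
        rw [Fin.castSucc_lt_succ_iff, le_iff_lt_or_eq]
      simp only [Set.mem_ofPred_eq, hd, Finset.coe_union, Set.mem_union, Finset.mem_coe,
        Finset.mem_filter, Finset.mem_univ, true_and, Finset.mem_map, Fin.castSucc_lt_castSucc_iff]
      refine or_congr Iff.rfl ⟨?_, ?_⟩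
      · rintro rfl; exact ⟨a, rfl⟩
      · rintro ⟨b, hb⟩; exact (congrArg Sigma.fst hb).symm
    have e0 : {p : Σ i : Fin n, Fin (μ i) | p.1.castSucc < i.castSucc} =
        ((Finset.univ.filter fun p : Σ i : Fin n, Fin (μ i) => p.1.castSucc < i.castSucc) :
          Finset (Σ i : Fin n, Fin (μ i))) := by
      ext p; simp
    rw [e1, e0, key, key, Finset.card_union_of_disjoint]
    · simp
    · rw [Finset.disjoint_left]
      rintro ⟨j, a⟩ h1 h2
      simp only [Finset.mem_filter, Finset.mem_univ, true_and, Finset.mem_map] at h1 h2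
      obtain ⟨b, hb⟩ := h2
      have : i = j := congrArg Sigma.fst hb
      subst this
      exact lt_irrefl _ h1

/-- The Zariski topology on `GL_d(ℂ)`: the closed sets are the zero loci of
polynomials in the matrix entries. -/
instance : TopologicalSpace (Frame μ ι) :=
  TopologicalSpace.induced
    (fun v => (MvPolynomial.pointToPoint v.coord :
      PrimeSpectrum (MvPolynomial ((Σ i : Fin n, Fin (μ i)) × ι) ℂ)))
    inferInstance

/-- The Zariski topology on the partial flag variety `X_μ`, viewed as the homogeneous
space `GL_d(ℂ) / P_μ`. -/
instance : TopologicalSpace (PartialFlag μ ι) :=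
  TopologicalSpace.coinduced Frame.flag inferInstance

/-- A complex valued function `f` on a subset `Z` of `X_μ` is regular at `z` if its pull-back to
the inverse image of `Z` in `GL_d(ℂ)` is given, near every point above `z`, by a quotient of two
polynomials in the matrix entries. -/
def IsRegularAt (Z : Set (PartialFlag μ ι)) (z : Z) (f : Z → ℂ) : Prop :=
  ∀ v : Frame μ ι, v.flag = z →
    ∃ P Q : MvPolynomial ((Σ i : Fin n, Fin (μ i)) × ι) ℂ,
      MvPolynomial.eval v.coord Q ≠ 0 ∧
      ∀ (w : Frame μ ι) (hw : w.flag ∈ Z), MvPolynomial.eval w.coord Q ≠ 0 →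
        f ⟨w.flag, hw⟩ = MvPolynomial.eval w.coord P / MvPolynomial.eval w.coord Q

/-- The local ring at `z` of a (locally closed) subvariety `Z` of `X_μ`: the ring of germs at `z`
of functions on `Z` that are regular at `z`. -/
def localRing (Z : Set (PartialFlag μ ι)) (z : Z) : Subring ((𝓝 z).Germ ℂ) where
  carrier := {γ | ∃ f : Z → ℂ, IsRegularAt Z z f ∧ γ = (f : (𝓝 z).Germ ℂ)}
  zero_mem' := ⟨0, fun _ _ => ⟨0, 1, by simp, by simp⟩, rfl⟩
  one_mem' := ⟨1, fun _ _ => ⟨1, 1, by simp, by simp⟩, rfl⟩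
  add_mem' := by
    rintro _ _ ⟨f, hf, rfl⟩ ⟨g, hg, rfl⟩
    refine ⟨f + g, fun v hv => ?_, rfl⟩
    obtain ⟨P, Q, hQ, h⟩ := hf v hv
    obtain ⟨P', Q', hQ', h'⟩ := hg v hv
    refine ⟨P * Q' + P' * Q, Q * Q', by simp [hQ, hQ'], fun w hw hne => ?_⟩
    rw [map_mul] at hne
    have h1 := left_ne_zero_of_mul hne
    have h2 := right_ne_zero_of_mul hne
    simp only [Pi.add_apply, h w hw h1, h' w hw h2, map_add, map_mul]
    field_simp
  mul_mem' := by
    rintro _ _ ⟨f, hf, rfl⟩ ⟨g, hg, rfl⟩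
    refine ⟨f * g, fun v hv => ?_, rfl⟩
    obtain ⟨P, Q, hQ, h⟩ := hf v hv
    obtain ⟨P', Q', hQ', h'⟩ := hg v hv
    refine ⟨P * P', Q * Q', by simp [hQ, hQ'], fun w hw hne => ?_⟩
    rw [map_mul] at hne
    have h1 := left_ne_zero_of_mul hne
    have h2 := right_ne_zero_of_mul hne
    simp only [Pi.mul_apply, h w hw h1, h' w hw h2, map_mul]
    field_simp
  neg_mem' := by
    rintro _ ⟨f, hf, rfl⟩
    refine ⟨-f, fun v hv => ?_, rfl⟩
    obtain ⟨P, Q, hQ, h⟩ := hf v hv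
    refine ⟨-P, Q, hQ, fun w hw hne => ?_⟩
    simp only [Pi.neg_apply, h w hw hne, map_neg, neg_div]

/-- A (locally closed) subvariety of `X_μ` is smooth if all its local rings are regular. -/
def IsSmooth (Z : Set (PartialFlag μ ι)) : Prop :=
  ∀ z : Z, IsRegularLocalRing (localRing Z z)

/-! ### The nilpotent matrix `x^λ` and the Spaltenstein variety -/

/-- The space `ℂ^d` with its basis identified with the boxes of the Young diagram of `λ`. -/
abbrev BoxSpace (lam : YoungDiagram) : Type := lam.cells → ℂ

/-- The basis vectors `f_b`; reading the boxes `b` along rows starting from the top one gives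
`f_1, …, f_d`. -/
def basisVec {lam : YoungDiagram} (b : lam.cells) : BoxSpace lam := Pi.single b 1

/-- The matrix of the endomorphism `x^λ`, which sends the basis vector of a box to that of the box
immediately below it, or to zero if it is at the bottom of its column. -/
def nilMatrix (lam : YoungDiagram) : Matrix lam.cells lam.cells ℂ :=
  Matrix.of fun b b' => if b.1 = (b'.1.1 + 1, b'.1.2) then 1 else 0

/-- The nilpotent endomorphism `x^λ`, of Jordan type `λ^T`. -/
def nil (lam : YoungDiagram) : BoxSpace lam →ₗ[ℂ] BoxSpace lam :=
  Matrix.toLin' (nilMatrix lam)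

/-- The Spaltenstein variety `X^λ_μ`. -/
def spaltenstein (lam : YoungDiagram) {n : ℕ} (μ : Fin n → ℕ) :
    Set (PartialFlag μ lam.cells) :=
  {V | ∀ i : Fin n, (V.space i.succ).map (nil lam) ≤ V.space i.castSucc}

/-- The subspace `W` is invariant under `N` and the restriction of `N` to it is nilpotent of Jordan
type `ν^T`, i.e. conjugate to `x^ν`. -/
def HasJordanTypeTranspose {E : Type} [AddCommGroup E] [Module ℂ E] (N : E →ₗ[ℂ] E)
    (W : Submodule ℂ E) (nu : YoungDiagram) : Prop :=
  ∃ e : BoxSpace nu ≃ₗ[ℂ] W, ∀ v, (e (nil nu v) : E) = N (e v)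

/-! ### Tableaux -/

/-- `Std^λ_μ`: the semistandard `λ`-tableaux with exactly `μ_i` entries equal to `i` for
`i = 1, …, n` (the component `μ_i` is `μ (i - 1)` as a function on `Fin n`). -/
def Std (lam : YoungDiagram) {n : ℕ} (μ : Fin n → ℕ) : Set (SemistandardYoungTableau lam) :=
  {S | ∀ i : Fin n, (lam.cells.filter fun c => S c.1 c.2 = (i : ℕ) + 1).card = μ i}

/-- The Young diagram `λ^{(j)}` of the boxes of a semistandard tableau with entries `≤ j`. -/
def subshape {lam : YoungDiagram} (S : SemistandardYoungTableau lam) (j : ℕ) : YoungDiagram where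
  cells := lam.cells.filter fun c => S c.1 c.2 ≤ j
  isLowerSet := by
    rintro ⟨a, b⟩ ⟨a', b'⟩ ⟨h1, h2⟩ h
    simp only [Finset.mem_coe, Finset.mem_filter, YoungDiagram.mem_cells] at h ⊢
    change a' ≤ a at h1
    change b' ≤ b at h2
    have hc : (a', b) ∈ lam := lam.up_left_mem h1 le_rfl h.1
    refine ⟨lam.up_left_mem h1 h2 h.1, ?_⟩
    exact (S.row_weak_of_le h2 hc).trans ((S.col_weak h1 h.1).trans h.2)

/-- The tableau of shape `λ^{(j)}` obtained by forgetting the boxes with entries `> j`. -/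
def restrict {lam : YoungDiagram} (S : SemistandardYoungTableau lam) (j : ℕ) :
    SemistandardYoungTableau (subshape S j) where
  entry a b := if (a, b) ∈ subshape S j then S a b else 0
  row_weak' := by
    intro i j1 j2 h hc
    have hc' : (i, j1) ∈ subshape S j := (subshape S j).up_left_mem le_rfl h.le hc
    rw [if_pos hc, if_pos hc']
    exact S.row_weak h (Finset.mem_filter.mp hc).1
  col_strict' := by
    intro i1 i2 j' h hc
    have hc' : (i1, j') ∈ subshape S j := (subshape S j).up_left_mem h.le le_rfl hc
    rw [if_pos hc, if_pos hc']
    exact S.col_strict h (Finset.mem_filter.mp hc).1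
  zeros' := fun h => if_neg h

/-- The fiber `J⁻¹(S)`: the points `(V_0, …, V_n)` of `X^λ_μ` such that, for each `j`, the
restriction of `x^λ` to `V_j` is of Jordan type `(λ^{(j)})^T`, where `λ^{(j)}` is formed by
the boxes of `S` with entries `≤ j`. -/
def jordanFiber {lam : YoungDiagram} {n : ℕ} (μ : Fin n → ℕ) (S : SemistandardYoungTableau lam) :
    Set (PartialFlag μ lam.cells) :=
  {V | V ∈ spaltenstein lam μ ∧
    ∀ j : Fin (n + 1), HasJordanTypeTranspose (nil lam) (V.space j) (subshape S j)}

/-! ### The paving cells -/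

/-- The orthogonal complement for the symmetric bilinear form with `(f_b, f_{b'}) = δ_{b,b'}`. -/
def perp {lam : YoungDiagram} (U : Submodule ℂ (BoxSpace lam)) : Submodule ℂ (BoxSpace lam) where
  carrier := {v | ∀ u ∈ U, u ⬝ᵥ v = 0}
  zero_mem' := by simp
  add_mem' := fun ha hb u hu => by rw [dotProduct_add, ha u hu, hb u hu, add_zero]
  smul_mem' := fun c v hv u hu => by rw [dotProduct_smul, hv u hu, smul_zero]

/-- The (indices `c_1 < ⋯ < c_k` of the) columns of `S` containing the entry `m`. Columns are
numbered from zero. -/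
def columnsWith {lam : YoungDiagram} (S : SemistandardYoungTableau lam) (m : ℕ) : Set ℕ :=
  {c | ∃ i, (i, c) ∈ lam ∧ S i c = m}

/-- The span of the vectors `f_c`, `c ∈ C`, of the top row. -/
def coordSpan (lam : YoungDiagram) (C : Set ℕ) : Submodule ℂ (BoxSpace lam) :=
  Submodule.span ℂ (basisVec '' {b : lam.cells | b.1.1 = 0 ∧ b.1.2 ∈ C})

/-- The coordinates `a_{c,l}` on the Schubert cell `Y_γ°` whose column sequence enumerates `C`: they
may be non-zero only for `c ∈ C`, `l ∉ C` and `l < c`. -/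
def IsSchubertCoord (C : Set ℕ) (a : ℕ → ℕ → ℂ) : Prop :=
  ∀ c l, ¬ (c ∈ C ∧ l ∉ C ∧ l < c) → a c l = 0

/-- The matrix `g(U)` of the point `U` of the Schubert cell with coordinates `a`. For the boxes of
the top row it sends `f_c` to `f_c + ∑_{l < c} a_{c,l} f_l` for `c ∈ C` and fixes `f_c` for
`c ∉ C`; the images of the boxes further down are determined by `g (x^λ f_b) = x^λ (g f_b)`
whenever `x^λ f_b ≠ 0`. -/
def schubertMatrix (lam : YoungDiagram) (a : ℕ → ℕ → ℂ) : Matrix lam.cells lam.cells ℂ :=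
  Matrix.of fun b' b =>
    if b'.1.1 = b.1.1 then (if b'.1.2 = b.1.2 then 1 else a b.1.2 b'.1.2) else 0

/-- `Y` is a paving cell `Y_S°` of the semistandard tableau `S`, for some choice of the
identifications `θ` that enter the recursive construction.

For `n = 0` the cell is the whole of `X^λ_μ`. For `n ≥ 1` let `C = {c_1, …, c_k}` be the columns of
`S` containing `n`, and let `S̄`, of shape `λ̄`, be obtained from `S` by removing all entries `n`
(as `S` is semistandard, the remaining columns already form a partition shape). Choose an
isomorphism `θ` from `⟨f_{c_1}, …, f_{c_k}⟩^⊥` to `ℂ^{d-k}` that intertwines `x^λ` and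
`x^λ̄`, and a paving cell `Ȳ` of `S̄`. Then `(V_0, …, V_n) ∈ X^λ_μ` lies in `Y` if and only if
`U = V_{n-1}^⊥` lies in the Schubert cell of `C`, that is `U = g(⟨f_{c_1}, …, f_{c_k}⟩)` with
`g = g(U)` given by Schubert coordinates `a`, and the flag `θ(g^T V_0) ≤ ⋯ ≤ θ(g^T V_{n-1})` lies
in `Ȳ`. -/
def IsPavingCell : {n : ℕ} → (μ : Fin n → ℕ) → {lam : YoungDiagram} →
    SemistandardYoungTableau lam → Set (PartialFlag μ lam.cells) → Prop
  | 0, μ, lam, _, Y => Y = spaltenstein lam μ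
  | n + 1, μ, lam, S, Y =>
    ∃ (θ : perp (coordSpan lam (columnsWith S (n + 1))) ≃ₗ[ℂ] BoxSpace (subshape S n))
      (Ybar : Set (PartialFlag (fun i : Fin n => μ i.castSucc) (subshape S n).cells)),
      (∀ w w' : perp (coordSpan lam (columnsWith S (n + 1))),
        (w' : BoxSpace lam) = nil lam w → θ w' = nil (subshape S n) (θ w)) ∧
      IsPavingCell (fun i : Fin n => μ i.castSucc) (restrict S n) Ybar ∧
      Y = {V | V ∈ spaltenstein lam μ ∧ ∃ a : ℕ → ℕ → ℂ,
        IsSchubertCoord (columnsWith S (n + 1)) a ∧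
        perp (V.space (Fin.last n).castSucc) =
          (coordSpan lam (columnsWith S (n + 1))).map (Matrix.toLin' (schubertMatrix lam a)) ∧
        ∃ Vbar ∈ Ybar, ∀ i : Fin (n + 1), Vbar.space i =
          (((V.space i.castSucc).map (Matrix.toLin' (schubertMatrix lam a).transpose)).comap
            (perp (coordSpan lam (columnsWith S (n + 1)))).subtype).map θ.toLinearMap}

/-- The number `d_μ = ½ ∑ μ_i (μ_i - 1)`. -/
def dNum {n : ℕ} (μ : Fin n → ℕ) : ℕ := ∑ i, (μ i).choose 2

end

end Spaltenstein

/-!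
The fibers of `J` and the paving cells are built up one step of the flag at a time.

Let `V` be a flag in `J⁻¹(S)`, let `C` be the set of columns of `S` that contain the largest entry,
and let `e` be an embedding of the space of the smaller shape `λ̄` onto `⟨f_c : c ∈ C⟩^⊥` which
intertwines `x^λ̄` and `x^λ`. The Jordan types prescribed by `S` amount to ranks of the powers of
`x^λ` on the spaces of the flag (`rankFiber_eq_jordanFiber`), and the centralizer of `x^λ` acts
transitively on the subspaces `W` that contain the image of `x^λ` and on which these powers have the
same ranks as on `⟨f_c : c ∈ C⟩^⊥` (`SameRanks.exists_equiv`). So `V_{n-1}` is the image of `z ∘ e`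
for some `z` in the centralizer, and `V` extends a flag of the fiber of the smaller tableau
(`IsExt`, `IsExt.mem_jordanFiber_iff`). In the same language the paving cells consist of the
extensions by `g(U)⁻ᵀ ∘ e` of the flags in a paving cell of the smaller tableau (`cellOver`).

The key point is that the Schubert cell of `C` gives an open condition on the fiber: if `W` has the
ranks above and is a complement of `⟨f_c : c ∈ C⟩`, then the coordinates of `W` with respect to this
complement vanish unless `l < c`, as among columns of equal length `C` contains the rightmost ones
(`SameRanks.isSchubertCoord`). The coordinates are rational functions on frames by Cramer's rule.
By induction every paving cell is an affine space, embedded as an open subset of the fiber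
(`Chart.cellOver`, `IsPavingCell.exists_chart`), whose dimension is found by counting boxes. The
translates of the paving cells by the centralizer cover the fiber (`exists_isPavingCell_map`), which
therefore is smooth of the same dimension (`isSmooth_of_charts`, `topologicalKrullDim_of_charts`).

The fiber is irreducible as any two of its points lie on a rational curve in it: the centralizer is
the complement of the zeros of the determinant in a linear space, and a line in this space moves a
curve found by induction (`joinedByCurve_jordanFiber`). Hence the open set `Y_S°` is dense. The
fiber is locally closed as it is given by rank conditions, and ranks are lower semicontinuous
(`isOpen_le_finrank_map`).
-/

namespace Spaltenstein

noncomputable section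

/-! ### The Zariski topology in terms of polynomial functions -/

theorem mem_nhds_zariski {X τ : Type} (c : X → τ → ℂ) (x : X) (s : Set X) :
    s ∈ @nhds X (TopologicalSpace.induced (fun y => (MvPolynomial.pointToPoint (c y) :
      PrimeSpectrum (MvPolynomial τ ℂ))) inferInstance) x ↔
    ∃ Q : MvPolynomial τ ℂ, MvPolynomial.eval (c x) Q ≠ 0 ∧
      ∀ y, MvPolynomial.eval (c y) Q ≠ 0 → y ∈ s := by
  have hmem : ∀ (y : τ → ℂ) (Q : MvPolynomial τ ℂ),
      (MvPolynomial.pointToPoint y : PrimeSpectrum (MvPolynomial τ ℂ)) ∈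
        PrimeSpectrum.basicOpen Q ↔ MvPolynomial.eval y Q ≠ 0 := by
    intro y Q
    rw [PrimeSpectrum.mem_basicOpen]
    refine not_congr ?_
    rw [← MvPolynomial.coe_aeval_eq_eval]
    exact MvPolynomial.mem_vanishingIdeal_singleton_iff y Q
  rw [nhds_induced, Filter.mem_comap]
  constructor
  · rintro ⟨t, ht, hts⟩
    obtain ⟨_, ⟨Q, rfl⟩, hxQ, hQt⟩ :=
      PrimeSpectrum.isTopologicalBasis_basic_opens.mem_nhds_iff.1 ht
    exact ⟨Q, (hmem _ _).1 hxQ, fun y hy => hts (hQt ((hmem _ _).2 hy))⟩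
  · rintro ⟨Q, hQ, h⟩
    exact ⟨PrimeSpectrum.basicOpen Q,
      (PrimeSpectrum.basicOpen Q).isOpen.mem_nhds ((hmem _ _).2 hQ),
      fun y hy => h y ((hmem _ _).1 hy)⟩

/-- Affine space `𝔸^σ`, as the set of its complex points with the Zariski topology. -/
structure Aff (σ : Type) where
  /-- The coordinates of a point. -/
  coord : σ → ℂ

instance (σ : Type) : TopologicalSpace (Aff σ) :=
  TopologicalSpace.induced
    (fun y => (MvPolynomial.pointToPoint y.coord : PrimeSpectrum (MvPolynomial σ ℂ)))
    inferInstance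

theorem Aff.mem_nhds_iff {σ : Type} (x : Aff σ) (s : Set (Aff σ)) :
    s ∈ 𝓝 x ↔ ∃ Q : MvPolynomial σ ℂ, MvPolynomial.eval x.coord Q ≠ 0 ∧
      ∀ y : Aff σ, MvPolynomial.eval y.coord Q ≠ 0 → y ∈ s :=
  mem_nhds_zariski Aff.coord x s

variable {n : ℕ} {μ : Fin n → ℕ} {ι : Type} [Fintype ι]
variable {n' : ℕ} {μ' : Fin n' → ℕ} {ι' : Type} [Fintype ι']

theorem Frame.mem_nhds_iff (v : Frame μ ι) (s : Set (Frame μ ι)) :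
    s ∈ 𝓝 v ↔ ∃ Q : MvPolynomial ((Σ i : Fin n, Fin (μ i)) × ι) ℂ,
      MvPolynomial.eval v.coord Q ≠ 0 ∧ ∀ w : Frame μ ι, MvPolynomial.eval w.coord Q ≠ 0 → w ∈ s :=
  mem_nhds_zariski Frame.coord v s

theorem Frame.eventually_eval_ne_zero (v : Frame μ ι)
    {Q : MvPolynomial ((Σ i : Fin n, Fin (μ i)) × ι) ℂ} (hQ : MvPolynomial.eval v.coord Q ≠ 0)
    (D : Set (Frame μ ι)) : ∀ᶠ w in 𝓝[D] v, MvPolynomial.eval w.coord Q ≠ 0 :=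
  mem_nhdsWithin_of_mem_nhds ((v.mem_nhds_iff _).2 ⟨Q, hQ, fun _ h => h⟩)

theorem const_mem_subalgebra {X : Type} (A : Subalgebra ℂ (X → ℂ)) (r : ℂ) :
    (fun _ => r) ∈ A :=
  A.algebraMap_mem r

/-- Substituting elements of an algebra of functions into a polynomial gives an element of that
algebra. -/
theorem eval_mem_subalgebra {X τ : Type} (A : Subalgebra ℂ (X → ℂ)) {F : X → τ → ℂ}
    (hF : ∀ i, (fun x => F x i) ∈ A) (P : MvPolynomial τ ℂ) :
    (fun x => MvPolynomial.eval (F x) P) ∈ A := by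
  induction P using MvPolynomial.induction_on with
  | C a => simpa using const_mem_subalgebra A a
  | add p q hp hq => simpa using! A.add_mem hp hq
  | mul_X p i hp => simpa using! A.mul_mem hp (hF i)

/-- The algebra of functions on the frames that agree with a quotient of two polynomials near `v`
within `D`. -/
def ratAt (D : Set (Frame μ ι)) (v : Frame μ ι) : Subalgebra ℂ (Frame μ ι → ℂ) where
  carrier := {F | ∃ P Q : MvPolynomial ((Σ i : Fin n, Fin (μ i)) × ι) ℂ,
    MvPolynomial.eval v.coord Q ≠ 0 ∧
    ∀ᶠ w in 𝓝[D] v, F w = MvPolynomial.eval w.coord P / MvPolynomial.eval w.coord Q}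
  algebraMap_mem' r := ⟨MvPolynomial.C r, 1, by simp, by simp⟩
  add_mem' := by
    rintro F G ⟨P, Q, hQ, h⟩ ⟨P', Q', hQ', h'⟩
    refine ⟨P * Q' + P' * Q, Q * Q', by simp [hQ, hQ'], ?_⟩
    filter_upwards [h, h', v.eventually_eval_ne_zero hQ D, v.eventually_eval_ne_zero hQ' D]
      with w e e' hw hw'
    simp only [Pi.add_apply, e, e', map_add, map_mul]
    field_simp
  mul_mem' := by
    rintro F G ⟨P, Q, hQ, h⟩ ⟨P', Q', hQ', h'⟩
    refine ⟨P * P', Q * Q', by simp [hQ, hQ'], ?_⟩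
    filter_upwards [h, h', v.eventually_eval_ne_zero hQ D, v.eventually_eval_ne_zero hQ' D]
      with w e e' hw hw'
    simp only [Pi.mul_apply, e, e', map_mul]
    field_simp

section ratAt
variable {D : Set (Frame μ ι)} {v : Frame μ ι} {F G : Frame μ ι → ℂ}

theorem coord_mem_ratAt (i : (Σ i : Fin n, Fin (μ i)) × ι) :
    (fun w : Frame μ ι => w.coord i) ∈ ratAt D v :=
  ⟨MvPolynomial.X i, 1, by simp, by simp⟩

theorem ratAt_congr (hF : F ∈ ratAt D v) (h : ∀ᶠ w in 𝓝[D] v, G w = F w) : G ∈ ratAt D v := by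
  obtain ⟨P, Q, hQ, h'⟩ := hF
  exact ⟨P, Q, hQ, by filter_upwards [h, h'] with w e e'; rw [e, e']⟩

theorem eventually_ne_zero_of_mem_ratAt (hF : F ∈ ratAt D v) (hv : v ∈ D) (h0 : F v ≠ 0) :
    ∀ᶠ w in 𝓝[D] v, F w ≠ 0 := by
  obtain ⟨P, Q, hQ, h⟩ := hF
  have hP : MvPolynomial.eval v.coord P ≠ 0 := fun h' => h0 (by
    rw [h.self_of_nhdsWithin hv, h', zero_div])
  filter_upwards [h, v.eventually_eval_ne_zero hQ D, v.eventually_eval_ne_zero hP D] with w e h1 h2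
  rw [e]
  exact div_ne_zero h2 h1

theorem inv_mem_ratAt (hF : F ∈ ratAt D v) (hv : v ∈ D) (h0 : F v ≠ 0) : F⁻¹ ∈ ratAt D v := by
  obtain ⟨P, Q, hQ, h⟩ := hF
  have hP : MvPolynomial.eval v.coord P ≠ 0 := fun h' => h0 (by
    rw [h.self_of_nhdsWithin hv, h', zero_div])
  refine ⟨Q, P, hP, ?_⟩
  filter_upwards [h] with w e
  rw [Pi.inv_apply, e, inv_div]

theorem mem_ratAt_iff : F ∈ ratAt D v ↔ ∃ P Q : MvPolynomial ((Σ i : Fin n, Fin (μ i)) × ι) ℂ,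
    MvPolynomial.eval v.coord Q ≠ 0 ∧ ∀ w ∈ D, MvPolynomial.eval w.coord Q ≠ 0 →
      F w = MvPolynomial.eval w.coord P / MvPolynomial.eval w.coord Q := by
  constructor
  · rintro ⟨P, Q, hQ, h⟩
    obtain ⟨R, hR, h'⟩ := (v.mem_nhds_iff _).1 (eventually_nhdsWithin_iff.1 h)
    refine ⟨P * R, Q * R, by simp [hQ, hR], fun w hw hne => ?_⟩
    rw [map_mul] at hne
    rw [h' w (right_ne_zero_of_mul hne) hw, map_mul, map_mul,
      mul_div_mul_right _ _ (right_ne_zero_of_mul hne)]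
  · rintro ⟨P, Q, hQ, h⟩
    refine ⟨P, Q, hQ, ?_⟩
    filter_upwards [v.eventually_eval_ne_zero hQ D, self_mem_nhdsWithin] with w h1 h2
    exact h w h2 h1

/-- A map between frames with rational coordinates is continuous. -/
theorem tendsto_of_coord_mem_ratAt {D' : Set (Frame μ' ι')} {m : Frame μ ι → Frame μ' ι'}
    (hv : v ∈ D) (hm : ∀ i, (fun w => (m w).coord i) ∈ ratAt D v)
    (hD : ∀ᶠ w in 𝓝[D] v, m w ∈ D') : Filter.Tendsto m (𝓝[D] v) (𝓝[D'] (m v)) := by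
  refine tendsto_nhdsWithin_iff.2 ⟨fun s hs => ?_, hD⟩
  obtain ⟨Q, hQ, h⟩ := ((m v).mem_nhds_iff _).1 hs
  exact (eventually_ne_zero_of_mem_ratAt (eval_mem_subalgebra (ratAt D v) hm Q) hv hQ).mono
    fun w hw => h _ hw

theorem comp_mem_ratAt {D' : Set (Frame μ' ι')} {m : Frame μ ι → Frame μ' ι'}
    {H : Frame μ' ι' → ℂ} (hv : v ∈ D) (hm : ∀ i, (fun w => (m w).coord i) ∈ ratAt D v)
    (hD : ∀ᶠ w in 𝓝[D] v, m w ∈ D') (hH : H ∈ ratAt D' (m v)) :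
    (fun w => H (m w)) ∈ ratAt D v := by
  obtain ⟨P, Q, hQ, h⟩ := hH
  have hP' := eval_mem_subalgebra (ratAt D v) hm P
  have hQ' := eval_mem_subalgebra (ratAt D v) hm Q
  refine ratAt_congr (mul_mem hP' (inv_mem_ratAt hQ' hv hQ)) ?_
  filter_upwards [(tendsto_of_coord_mem_ratAt hv hm hD).eventually h] with w hw
  rw [hw, Pi.mul_apply, Pi.inv_apply, div_eq_mul_inv]

end ratAt

/-- The determinant of a matrix with entries in an algebra of functions. -/
theorem det_mem_subalgebra {X κ : Type} [Fintype κ] [DecidableEq κ] (A : Subalgebra ℂ (X → ℂ))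
    {M : X → Matrix κ κ ℂ} (hM : ∀ i j, (fun x => M x i j) ∈ A) : (fun x => (M x).det) ∈ A := by
  have : (fun x => (M x).det) = ∑ p : Equiv.Perm κ,
      (algebraMap ℂ (X → ℂ) (Equiv.Perm.sign p : ℤ)) * ∏ i, fun x => M x (p i) i := by
    funext x
    simp [Matrix.det_apply', Finset.prod_apply]
  rw [this]
  exact sum_mem fun p _ => mul_mem (A.algebraMap_mem _) (prod_mem fun i _ => hM _ _)

theorem inv_entry_mem_ratAt {κ : Type} [Fintype κ] [DecidableEq κ] {D : Set (Frame μ ι)}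
    {v : Frame μ ι} {M : Frame μ ι → Matrix κ κ ℂ} (hv : v ∈ D)
    (hM : ∀ i j, (fun w => M w i j) ∈ ratAt D v) (hdet : (M v).det ≠ 0) (i j : κ) :
    (fun w => (M w)⁻¹ i j) ∈ ratAt D v := by
  have h1 := inv_mem_ratAt (det_mem_subalgebra _ hM) hv hdet
  have h2 : (fun w => (M w).adjugate i j) ∈ ratAt D v := by
    simp only [Matrix.adjugate_apply]
    refine det_mem_subalgebra _ fun a b => ?_
    by_cases hb : a = j
    · subst hb
      simpa using const_mem_subalgebra (ratAt D v) ((Pi.single i 1 : κ → ℂ) b)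
    · simpa [Matrix.updateRow_ne hb] using hM a b
  refine ratAt_congr (mul_mem h1 h2) (Filter.Eventually.of_forall fun w => ?_)
  simp [Matrix.inv_def, Ring.inverse_eq_inv']

end

noncomputable section

/-! ### Frames and the quotient topology on flags -/

variable {n : ℕ} {μ : Fin n → ℕ} {ι : Type} [Fintype ι]
variable {ι' : Type} [Fintype ι']

theorem Frame.ext_vec {v w : Frame μ ι} (h : v.vec = w.vec) : v = w := by
  cases v
  cases w
  cases h
  rfl

/-- A spanning family of the right cardinality, as a frame. -/
def Frame.ofSpan (vec : (Σ i : Fin n, Fin (μ i)) → ι → ℂ)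
    (hspan : Submodule.span ℂ (Set.range vec) = ⊤) (hcard : ∑ i, μ i = Fintype.card ι) :
    Frame μ ι where
  vec := vec
  linearIndependent :=
    linearIndependent_of_top_le_span_of_card_eq_finrank hspan.ge (by simp [hcard])
  span_eq_top := hspan

/-- The basis of `ℂ^ι` given by a frame. -/
def Frame.basis (v : Frame μ ι) : Module.Basis (Σ i : Fin n, Fin (μ i)) ℂ (ι → ℂ) :=
  Module.Basis.mk v.linearIndependent v.span_eq_top.ge

@[simp]
theorem Frame.basis_apply (v : Frame μ ι) (p : Σ i : Fin n, Fin (μ i)) : v.basis p = v.vec p := by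
  simp [Frame.basis]

/-- The image of a frame under a linear isomorphism. -/
def Frame.map (T : (ι → ℂ) ≃ₗ[ℂ] (ι' → ℂ)) (v : Frame μ ι) : Frame μ ι' where
  vec p := T (v.vec p)
  linearIndependent := v.linearIndependent.map' T.toLinearMap T.ker
  span_eq_top := by
    rw [show (fun p => T (v.vec p)) = T.toLinearMap ∘ v.vec from rfl, Set.range_comp,
      Submodule.span_image, v.span_eq_top, Submodule.map_top, LinearEquiv.range]

theorem Frame.map_flag_space (T : (ι → ℂ) ≃ₗ[ℂ] (ι' → ℂ)) (v : Frame μ ι) (j : Fin (n + 1)) :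
    (v.map T).flag.space j = (v.flag.space j).map T.toLinearMap := by
  change Submodule.span ℂ ((fun p => T (v.vec p)) '' _) = (Submodule.span ℂ _).map _
  rw [← Submodule.span_image, Set.image_image]
  rfl

theorem Frame.vec_mem_flag (v : Frame μ ι) {p : Σ i : Fin n, Fin (μ i)} {j : Fin (n + 1)}
    (h : p.1.castSucc < j) : v.vec p ∈ v.flag.space j :=
  Submodule.subset_span ⟨p, h, rfl⟩

theorem setOf_castSucc_lt_succ (i : Fin n) :
    {p : Σ i : Fin n, Fin (μ i) | p.1.castSucc < i.succ} =
      {p | p.1.castSucc < i.castSucc} ∪ Set.range (fun a : Fin (μ i) => ⟨i, a⟩) := by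
  ext ⟨j, a⟩
  simp only [Set.mem_ofPred_eq, Set.mem_union, Set.mem_range, Fin.castSucc_lt_castSucc_iff,
    Fin.castSucc_lt_succ_iff, le_iff_lt_or_eq]
  refine or_congr Iff.rfl ⟨?_, ?_⟩
  · rintro rfl; exact ⟨a, rfl⟩
  · rintro ⟨b, hb⟩; exact (congrArg Sigma.fst hb).symm

/-- Every partial flag has an adapted basis. -/
theorem exists_frame (V : PartialFlag μ ι) : ∃ v : Frame μ ι, v.flag = V := by
  have hW : ∀ i : Fin n, ∃ W : Submodule ℂ (ι → ℂ),
      V.space i.castSucc ⊔ W = V.space i.succ ∧ Module.finrank ℂ W = μ i := by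
    intro i
    have hle : V.space i.castSucc ≤ V.space i.succ := V.mono Fin.castSucc_lt_succ.le
    obtain ⟨W, hW⟩ := (V.space i.castSucc).exists_isCompl
    have hsup : V.space i.castSucc ⊔ W ⊓ V.space i.succ = V.space i.succ := by
      rw [← sup_inf_assoc_of_le _ hle, hW.sup_eq_top, top_inf_eq]
    refine ⟨W ⊓ V.space i.succ, hsup, ?_⟩
    have h1 := Submodule.finrank_sup_add_finrank_inf_eq (V.space i.castSucc)
      (W ⊓ V.space i.succ)
    rw [hsup, ← inf_assoc, hW.inf_eq_bot, bot_inf_eq, finrank_bot, V.finrank_succ i] at h1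
    omega
  choose W hsup hrank using hW
  let b : ∀ i : Fin n, Module.Basis (Fin (μ i)) ℂ (W i) := fun i =>
    Module.finBasisOfFinrankEq ℂ (W i) (hrank i)
  let vec : (Σ i : Fin n, Fin (μ i)) → ι → ℂ := fun p => b p.1 p.2
  have hspan : ∀ j : Fin (n + 1),
      Submodule.span ℂ (vec '' {p | p.1.castSucc < j}) = V.space j := by
    intro j
    induction j using Fin.induction with
    | zero =>
      have : {p : Σ i : Fin n, Fin (μ i) | p.1.castSucc < (0 : Fin (n + 1))} = ∅ := by
        ext p; simp
      rw [this, Set.image_empty, Submodule.span_empty, V.space_zero]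
    | succ i ih =>
      rw [setOf_castSucc_lt_succ, Set.image_union, Submodule.span_union, ih, ← hsup i]
      congr 1
      have h1 := (b i).span_eq
      have h2 := congrArg (Submodule.map (W i).subtype) h1
      rw [← Submodule.span_image, Submodule.map_subtype_top, ← Set.range_comp] at h2
      rw [← Set.range_comp]
      exact h2
  have htop : Submodule.span ℂ (Set.range vec) = ⊤ := by
    rw [← V.space_last, ← hspan (Fin.last n)]
    congr 1
    have : {p : Σ i : Fin n, Fin (μ i) | p.1.castSucc < Fin.last n} = Set.univ := by
      ext p; simp [Fin.castSucc_lt_last]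
    rw [this, Set.image_univ]
  have hfin : ∀ j : Fin (n + 1), Module.finrank ℂ (V.space j) =
      ∑ i : Fin n, if i.castSucc < j then μ i else 0 := by
    intro j
    induction j using Fin.induction with
    | zero => simp [V.space_zero]
    | succ i ih =>
      rw [V.finrank_succ i, ih, ← Finset.sum_filter, ← Finset.sum_filter]
      have : (Finset.univ.filter fun k : Fin n => k.castSucc < i.succ) =
          insert i (Finset.univ.filter fun k : Fin n => k.castSucc < i.castSucc) := by
        ext k
        simp only [Finset.mem_filter, Finset.mem_univ, true_and, Finset.mem_insert,
          Fin.castSucc_lt_castSucc_iff, Fin.castSucc_lt_succ_iff, le_iff_lt_or_eq]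
        tauto
      rw [this, Finset.sum_insert (by simp), add_comm]
  have hcard : ∑ i, μ i = Fintype.card ι := by
    have := hfin (Fin.last n)
    rw [V.space_last, finrank_top, Module.finrank_fintype_fun_eq_card] at this
    rw [this]
    exact Finset.sum_congr rfl fun i _ => by rw [if_pos (Fin.castSucc_lt_last i)]
  exact ⟨Frame.ofSpan vec htop hcard, PartialFlag.ext (funext hspan)⟩

theorem continuous_flag : Continuous (Frame.flag : Frame μ ι → PartialFlag μ ι) :=
  continuous_coinduced_rng

/-- The map from frames to flags is open: a frame `w` of the flag of `v` is carried to `v` by a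
change of basis which preserves the flags of all frames, and which is polynomial in the frame. -/
theorem preimage_image_flag_mem_nhds {v w : Frame μ ι} (h : w.flag = v.flag)
    {O : Set (Frame μ ι)} (hO : O ∈ 𝓝 v) : Frame.flag ⁻¹' (Frame.flag '' O) ∈ 𝓝 w := by
  -- `m x` is the image of `v` under the isomorphism carrying `w` to `x`
  let m : Frame μ ι → Frame μ ι := fun x => v.map (w.basis.equiv x.basis (Equiv.refl _))
  have hmw : m w = v := by
    have : w.basis.equiv w.basis (Equiv.refl _) = LinearEquiv.refl ℂ (ι → ℂ) :=
      w.basis.ext' fun i => by simp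
    simp only [m, this]
    rfl
  have hflag : ∀ x, (m x).flag = x.flag := by
    intro x
    refine PartialFlag.ext (funext fun j => ?_)
    rw [Frame.map_flag_space, ← h, ← Frame.map_flag_space]
    congr 2
    have : (w.map (w.basis.equiv x.basis (Equiv.refl _))).vec = x.vec := by
      funext p
      change w.basis.equiv x.basis (Equiv.refl _) (w.vec p) = _
      rw [← w.basis_apply, Module.Basis.equiv_apply, Equiv.refl_apply, x.basis_apply]
    exact Frame.ext_vec this
  have hcoord : ∀ i, (fun x => (m x).coord i) ∈ ratAt Set.univ w := by
    rintro ⟨p, b⟩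
    have : (fun x : Frame μ ι => (m x).coord (p, b)) =
        ∑ q, fun x : Frame μ ι => w.basis.repr (v.vec p) q * x.coord (q, b) := by
      funext x
      change (w.basis.equiv x.basis (Equiv.refl _) (v.vec p)) b = _
      rw [← w.basis.sum_repr (v.vec p), map_sum]
      simp only [map_smul, Finset.sum_apply, Pi.smul_apply, smul_eq_mul, Frame.coord]
      simp [← Frame.basis_apply]
    rw [this]
    exact sum_mem fun q _ => mul_mem (const_mem_subalgebra _ _) (coord_mem_ratAt (q, b))
  have ht := tendsto_of_coord_mem_ratAt (D' := Set.univ) (Set.mem_univ w) hcoord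
    (Filter.Eventually.of_forall fun _ => Set.mem_univ _)
  rw [nhdsWithin_univ, nhdsWithin_univ, hmw] at ht
  filter_upwards [ht hO] with x hx using ⟨m x, hx, hflag x⟩

theorem isOpenMap_flag : IsOpenMap (Frame.flag : Frame μ ι → PartialFlag μ ι) := by
  intro O hO
  rw [isOpen_coinduced, isOpen_iff_mem_nhds]
  rintro w ⟨v, hv, hvw⟩
  exact preimage_image_flag_mem_nhds hvw.symm (hO.mem_nhds hv)

theorem map_flag_nhdsWithin (J : Set (PartialFlag μ ι)) (v : Frame μ ι) :
    Filter.map Frame.flag (𝓝[Frame.flag ⁻¹' J] v) = 𝓝[J] v.flag := by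
  rw [nhdsWithin, nhdsWithin, ← Filter.comap_principal, Filter.push_pull,
    isOpenMap_flag.map_nhds_eq continuous_flag.continuousAt]

/-- Openness in a subset of the flag variety can be tested on frames. -/
theorem isOpen_preimage_coe_iff {J A : Set (PartialFlag μ ι)} :
    IsOpen (((↑) : J → PartialFlag μ ι) ⁻¹' A) ↔
      ∀ v : Frame μ ι, v.flag ∈ J → v.flag ∈ A → ∀ᶠ w in 𝓝[Frame.flag ⁻¹' J] v, w.flag ∈ A := by
  rw [isOpen_iff_mem_nhds]
  constructor
  · intro h v hJ hA
    have := h ⟨v.flag, hJ⟩ hA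
    rw [preimage_coe_mem_nhds_subtype, ← map_flag_nhdsWithin] at this
    exact this
  · rintro h ⟨V, hJ⟩ hA
    obtain ⟨v, rfl⟩ := exists_frame V
    rw [preimage_coe_mem_nhds_subtype, ← map_flag_nhdsWithin]
    exact h v hJ hA

end

noncomputable section

/-! ### Subvarieties covered by affine spaces -/

/-- The algebra of polynomial functions on affine space. -/
def polyFun (σ : Type) : Subalgebra ℂ ((σ → ℂ) → ℂ) :=
  (MvPolynomial.aeval fun (i : σ) (s : σ → ℂ) => s i).range

theorem mem_polyFun_iff {σ : Type} {F : (σ → ℂ) → ℂ} :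
    F ∈ polyFun σ ↔ ∃ P : MvPolynomial σ ℂ, ∀ s, F s = MvPolynomial.eval s P := by
  have h : ∀ (P : MvPolynomial σ ℂ) (s : σ → ℂ),
      MvPolynomial.aeval (fun (i : σ) (s : σ → ℂ) => s i) P s = MvPolynomial.eval s P := by
    intro P s
    induction P using MvPolynomial.induction_on with
    | C a => simp
    | add p q hp hq => simp [hp, hq]
    | mul_X p i hp => simp [hp]
  constructor
  · rintro ⟨P, rfl⟩
    exact ⟨P, h P⟩
  · rintro ⟨P, hP⟩
    exact ⟨P, funext fun s => (h P s).trans (hP s).symm⟩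

theorem apply_mem_polyFun {σ : Type} (i : σ) : (fun s : σ → ℂ => s i) ∈ polyFun σ :=
  mem_polyFun_iff.2 ⟨MvPolynomial.X i, by simp⟩

variable {n : ℕ} {μ : Fin n → ℕ} {ι : Type} [Fintype ι]

/-- A chart of a subset `J` of the flag variety: an isomorphism of the affine space `𝔸^σ` with the
open subset `Y` of `J`. It is given by a polynomial lift to the variety of frames, and its inverse
is required to be rational on frames, locally within `J`. -/
structure Chart (J Y : Set (PartialFlag μ ι)) (σ : Type) where
  /-- The lift of the chart to the variety of frames. -/
  frame : (σ → ℂ) → Frame μ ι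
  coord_mem : ∀ i, (fun s => (frame s).coord i) ∈ polyFun σ
  range_flag : Set.range (fun s => (frame s).flag) = Y
  injective : Function.Injective fun s => (frame s).flag
  subset : Y ⊆ J
  exists_coord : ∀ v : Frame μ ι, v.flag ∈ Y → ∃ κ : Frame μ ι → σ → ℂ,
    (∀ i, (fun w => κ w i) ∈ ratAt (Frame.flag ⁻¹' J) v) ∧
      ∀ᶠ w in 𝓝[Frame.flag ⁻¹' J] v, (frame (κ w)).flag = w.flag

namespace Chart
variable {J Y : Set (PartialFlag μ ι)} {σ : Type} (φ : Chart J Y σ)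

/-- The coordinates on the image of a chart. -/
def coord : PartialFlag μ ι → σ → ℂ := Function.invFun fun s => (φ.frame s).flag

include φ in
theorem eventually_mem {v : Frame μ ι} (hv : v.flag ∈ Y) :
    ∀ᶠ w in 𝓝[Frame.flag ⁻¹' J] v, w.flag ∈ Y := by
  obtain ⟨κ, -, h⟩ := φ.exists_coord v hv
  filter_upwards [h] with w hw
  exact φ.range_flag.subset ⟨_, hw⟩

theorem flag_frame_mem (s : σ → ℂ) : (φ.frame s).flag ∈ Y := by
  exact φ.range_flag.subset ⟨s, rfl⟩

theorem coord_flag_frame (s : σ → ℂ) : φ.coord (φ.frame s).flag = s :=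
  Function.leftInverse_invFun φ.injective s

theorem flag_frame_coord {V : PartialFlag μ ι} (hV : V ∈ Y) : (φ.frame (φ.coord V)).flag = V := by
  rw [← φ.range_flag] at hV
  obtain ⟨s, rfl⟩ := hV
  exact congrArg (fun t => (φ.frame t).flag) (φ.coord_flag_frame s)

theorem coord_mem_ratAt {v : Frame μ ι} (hv : v.flag ∈ Y) (i : σ) :
    (fun w : Frame μ ι => φ.coord w.flag i) ∈ ratAt (Frame.flag ⁻¹' J) v := by
  obtain ⟨κ, h, h'⟩ := φ.exists_coord v hv
  refine ratAt_congr (h i) ?_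
  filter_upwards [h'] with w hw
  rw [← hw, φ.coord_flag_frame]

theorem exists_pullback (P : MvPolynomial ((Σ i : Fin n, Fin (μ i)) × ι) ℂ) :
    ∃ P' : MvPolynomial σ ℂ, ∀ s,
      MvPolynomial.eval s P' = MvPolynomial.eval (φ.frame s).coord P := by
  obtain ⟨P', h⟩ := mem_polyFun_iff.1
    (eval_mem_subalgebra (F := fun s => (φ.frame s).coord) (polyFun σ) φ.coord_mem P)
  exact ⟨P', fun s => (h s).symm⟩

theorem continuous_frame : Continuous fun s : Aff σ => φ.frame s.coord := by
  rw [continuous_iff_continuousAt]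
  intro s t ht
  obtain ⟨Q, hQ, h⟩ := ((φ.frame s.coord).mem_nhds_iff t).1 ht
  obtain ⟨Q', h'⟩ := φ.exists_pullback Q
  exact (Aff.mem_nhds_iff s _).2 ⟨Q', by rwa [h'], fun y hy => h _ (by rwa [← h'])⟩

/-- A chart as a map to the subspace `J`. -/
def toSubtype (s : Aff σ) : J := ⟨(φ.frame s.coord).flag, φ.subset (φ.flag_frame_mem s.coord)⟩

theorem isOpenEmbedding_toSubtype : IsOpenEmbedding φ.toSubtype := by
  refine .of_continuous_injective_isOpenMap
    ((continuous_flag.comp φ.continuous_frame).subtype_mk _)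
    (fun s t h => congrArg Aff.mk (φ.injective (congrArg Subtype.val h))) fun U hU => ?_
  have himage : φ.toSubtype '' U =
      ((↑) : J → PartialFlag μ ι) ⁻¹' {V | V ∈ Y ∧ Aff.mk (φ.coord V) ∈ U} := by
    ext V
    constructor
    · rintro ⟨s, hs, rfl⟩
      refine ⟨φ.flag_frame_mem s.coord, ?_⟩
      change Aff.mk (φ.coord (φ.frame s.coord).flag) ∈ U
      rwa [φ.coord_flag_frame]
    · rintro ⟨h1, h2⟩
      exact ⟨_, h2, Subtype.ext (φ.flag_frame_coord h1)⟩
  rw [himage, isOpen_preimage_coe_iff]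
  rintro v hJ ⟨hY, hv⟩
  obtain ⟨Q, hQ, h⟩ := (Aff.mem_nhds_iff _ _).1 (hU.mem_nhds hv)
  filter_upwards [φ.eventually_mem hY, eventually_ne_zero_of_mem_ratAt
    (eval_mem_subalgebra _ (φ.coord_mem_ratAt hY) Q) hJ hQ] with w h1 h2
  exact ⟨h1, h ⟨φ.coord w.flag⟩ h2⟩

theorem eventually_nhds {p : PartialFlag μ ι → Prop} {v : Frame μ ι} (hv : v.flag ∈ J)
    (h : ∀ᶠ w in 𝓝[Frame.flag ⁻¹' J] v, p w.flag) : ∀ᶠ y : J in 𝓝 (⟨v.flag, hv⟩ : J), p y := by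
  change ((↑) : J → PartialFlag μ ι) ⁻¹' {y | p y} ∈ 𝓝 (⟨v.flag, hv⟩ : J)
  rw [preimage_coe_mem_nhds_subtype, ← map_flag_nhdsWithin]
  exact h

theorem isRegularAt_of_mem_ratAt {f : J → ℂ} {z : J}
    {F : Frame μ ι → ℂ} (hF : ∀ v : Frame μ ι, v.flag = z → F ∈ ratAt (Frame.flag ⁻¹' J) v)
    (h : ∀ (w : Frame μ ι) (hw : w.flag ∈ J), f ⟨w.flag, hw⟩ = F w) : IsRegularAt J z f := by
  intro v hv
  obtain ⟨P, Q, hQ, hPQ⟩ := mem_ratAt_iff.1 (hF v hv)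
  exact ⟨P, Q, hQ, fun w hw hne => (h w hw).trans (hPQ w hw hne)⟩

theorem eval_coord_isRegularAt {z : J} (hz : (z : PartialFlag μ ι) ∈ Y) (P : MvPolynomial σ ℂ) :
    IsRegularAt J z fun y => MvPolynomial.eval (φ.coord y) P :=
  isRegularAt_of_mem_ratAt (F := fun w => MvPolynomial.eval (φ.coord w.flag) P)
    (fun _ hv => eval_mem_subalgebra _ (φ.coord_mem_ratAt (hv ▸ hz)) P) fun _ _ => rfl

/-- The germs of the polynomials in the coordinates of a chart. -/
def germHom {z : J} (hz : (z : PartialFlag μ ι) ∈ Y) : MvPolynomial σ ℂ →+* localRing J z where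
  toFun P := ⟨((fun y : J => MvPolynomial.eval (φ.coord y) P : J → ℂ) : (𝓝 z).Germ ℂ),
    _, φ.eval_coord_isRegularAt hz P, rfl⟩
  map_one' := Subtype.ext (by simp; rfl)
  map_zero' := Subtype.ext (by simp; rfl)
  map_add' P Q := Subtype.ext (by simp; rfl)
  map_mul' P Q := Subtype.ext (by simp; rfl)

include φ in
/-- The local ring at a point of a chart is the localization of the polynomial ring at the maximal
ideal of a point. -/
theorem isRegularLocalRing_localRing [Finite σ] {z : J} (hz : (z : PartialFlag μ ι) ∈ Y) :
    IsRegularLocalRing (localRing J z) := by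
  let p := φ.coord z
  have hv : (φ.frame p).flag = z := φ.flag_frame_coord hz
  have hz' : z = ⟨(φ.frame p).flag, hv ▸ z.2⟩ := Subtype.ext hv.symm
  let I : Ideal (MvPolynomial σ ℂ) := MvPolynomial.vanishingIdeal ℂ {p}
  have hI : ∀ P, P ∈ I ↔ MvPolynomial.eval p P = 0 := fun P => by
    rw [← MvPolynomial.coe_aeval_eq_eval]
    exact MvPolynomial.mem_vanishingIdeal_singleton_iff p P
  have hne : ∀ P : MvPolynomial σ ℂ, MvPolynomial.eval p P ≠ 0 →
      ∀ᶠ y : J in 𝓝 z, MvPolynomial.eval (φ.coord y) P ≠ 0 := by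
    intro P hP
    rw [hz']
    refine eventually_nhds (p := fun y => MvPolynomial.eval (φ.coord y) P ≠ 0) _ ?_
    exact eventually_ne_zero_of_mem_ratAt (F := fun w => MvPolynomial.eval (φ.coord w.flag) P)
      (eval_mem_subalgebra _ (φ.coord_mem_ratAt (hv ▸ hz)) P)
      (show (φ.frame p).flag ∈ J from hv ▸ z.2) (by rwa [hv])
  let : Algebra (MvPolynomial σ ℂ) (localRing J z) := (φ.germHom hz).toAlgebra
  have hloc : IsLocalization.AtPrime (localRing J z) I := by
    refine (isLocalization_iff _ _).2 ⟨?_, ?_, ?_⟩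
    · rintro ⟨P, hP⟩
      have hP' : MvPolynomial.eval p P ≠ 0 := fun h => hP ((hI P).2 h)
      refine IsUnit.of_mul_eq_one ⟨((fun y : J => (MvPolynomial.eval (φ.coord y) P)⁻¹ : J → ℂ) :
        (𝓝 z).Germ ℂ), _, isRegularAt_of_mem_ratAt
          (F := (fun w => MvPolynomial.eval (φ.coord w.flag) P)⁻¹) (fun v hv => ?_)
          fun _ _ => rfl, rfl⟩ (Subtype.ext ?_)
      · exact inv_mem_ratAt (eval_mem_subalgebra _ (φ.coord_mem_ratAt (hv ▸ hz)) P)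
          (show v.flag ∈ J from hv ▸ z.2) (by rwa [hv])
      · refine Filter.Germ.coe_eq.2 ?_
        filter_upwards [hne P hP'] with y hy using mul_inv_cancel₀ hy
    · rintro ⟨_, f, hf, rfl⟩
      obtain ⟨P, Q, hQ, h⟩ := hf (φ.frame p) hv
      -- substituting the chart into the quotient `P / Q` expresses `f` by the coordinates
      obtain ⟨P', hP'⟩ := φ.exists_pullback P
      obtain ⟨Q', hQ'⟩ := φ.exists_pullback Q
      have hQp : MvPolynomial.eval p Q' ≠ 0 := by rwa [hQ']
      refine ⟨⟨P', ⟨Q', fun h => hQp ((hI Q').1 h)⟩⟩, Subtype.ext (Filter.Germ.coe_eq.2 ?_)⟩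
      have hY : ∀ᶠ y : J in 𝓝 z, (y : PartialFlag μ ι) ∈ Y := by
        rw [hz']
        exact eventually_nhds (p := fun y => y ∈ Y) _ (φ.eventually_mem (hv ▸ hz))
      filter_upwards [hne Q' hQp, hY] with y hy hyY
      have e : y = ⟨(φ.frame (φ.coord y)).flag, φ.subset (φ.flag_frame_mem _)⟩ :=
        Subtype.ext (φ.flag_frame_coord hyY).symm
      have h1 := h (φ.frame (φ.coord y)) (φ.subset (φ.flag_frame_mem _)) (by rwa [← hQ'])
      rw [← e, ← hQ', ← hP'] at h1
      change f y * MvPolynomial.eval (φ.coord y) Q' = MvPolynomial.eval (φ.coord y) P'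
      rw [h1, div_mul_cancel₀ _ hy]
    · intro P P' h
      refine ⟨1, ?_⟩
      have h1 : ∀ᶠ y : J in 𝓝 z,
          MvPolynomial.eval (φ.coord y) P = MvPolynomial.eval (φ.coord y) P' :=
        Filter.Germ.coe_eq.1 (congrArg Subtype.val h)
      have h2 : Filter.Tendsto φ.toSubtype (𝓝 ⟨p⟩) (𝓝 z) := by
        have := φ.isOpenEmbedding_toSubtype.continuous.tendsto ⟨p⟩
        rwa [show φ.toSubtype ⟨p⟩ = z from Subtype.ext hv] at this
      obtain ⟨R, hR, hR'⟩ := (Aff.mem_nhds_iff _ _).1 (h2.eventually h1)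
      -- `P` and `P'` agree at the complex points outside the zeros of `R`
      have h3 : R * (P - P') = 0 := by
        refine MvPolynomial.funext fun s => ?_
        rw [map_mul, map_sub, map_zero]
        by_cases hs : MvPolynomial.eval s R = 0
        · rw [hs, zero_mul]
        · have h4 : MvPolynomial.eval (φ.coord (φ.frame s).flag) P =
              MvPolynomial.eval (φ.coord (φ.frame s).flag) P' := hR' ⟨s⟩ hs
          rw [φ.coord_flag_frame] at h4
          rw [h4, sub_self, mul_zero]
      have hR0 : R ≠ 0 := by
        rintro rfl
        simp at hR
      rw [sub_eq_zero.1 ((mul_eq_zero.1 h3).resolve_left hR0)]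
  exact IsRegularLocalRing.of_ringEquiv
    (IsLocalization.algEquiv I.primeCompl (Localization.AtPrime I) (localRing J z)).toRingEquiv

end Chart

/-! ### Dimension -/

theorem Aff.isInducing (σ : Type) : IsInducing fun y : Aff σ =>
    (MvPolynomial.pointToPoint y.coord : PrimeSpectrum (MvPolynomial σ ℂ)) :=
  ⟨rfl⟩

theorem isIrreducible_of_image {X Y : Type*} [TopologicalSpace X] [TopologicalSpace Y] {f : X → Y}
    (hf : IsInducing f) {s : Set X} (h : IsIrreducible (f '' s)) : IsIrreducible s := by
  refine ⟨h.nonempty.of_image, ?_⟩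
  rintro U V hU hV ⟨x, hx, hxU⟩ ⟨y, hy, hyV⟩
  obtain ⟨U', hU', rfl⟩ := hf.isOpen_iff.1 hU
  obtain ⟨V', hV', rfl⟩ := hf.isOpen_iff.1 hV
  obtain ⟨_, ⟨z, hz, rfl⟩, hz'⟩ :=
    h.2 U' V' hU' hV' ⟨f x, ⟨x, hx, rfl⟩, hxU⟩ ⟨f y, ⟨y, hy, rfl⟩, hyV⟩
  exact ⟨z, hz, hz'⟩

/-- The closed irreducible subset of affine space defined by a prime ideal. -/
def Aff.zeroLocus {σ : Type} [Finite σ] (p : PrimeSpectrum (MvPolynomial σ ℂ)) :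
    TopologicalSpace.IrreducibleCloseds (Aff σ) where
  carrier := Aff.coord ⁻¹' MvPolynomial.zeroLocus ℂ p.asIdeal
  isIrreducible' := by
    have := p.2
    refine isIrreducible_of_image (Aff.isInducing σ) ?_
    rw [PrimeSpectrum.isIrreducible_iff_vanishingIdeal_isPrime,
      ← Set.image_image (g := MvPolynomial.pointToPoint) (f := Aff.coord),
      Set.image_preimage_eq _ fun x => ⟨⟨x⟩, rfl⟩,
      MvPolynomial.vanishingIdeal_pointToPoint, MvPolynomial.IsPrime.vanishingIdeal_zeroLocus]
    exact this
  isClosed' := by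
    rw [← isOpen_compl_iff, isOpen_iff_mem_nhds]
    intro x hx
    simp only [Set.mem_compl_iff, Set.mem_preimage, MvPolynomial.mem_zeroLocus_iff,
      not_forall] at hx
    obtain ⟨P, hP, hx⟩ := hx
    refine (Aff.mem_nhds_iff _ _).2 ⟨P, hx, fun y hy h => hy ?_⟩
    simpa using h P hP

theorem Aff.topologicalKrullDim (σ : Type) [Finite σ] :
    topologicalKrullDim (Aff σ) = (Nat.card σ : WithBot ℕ∞) := by
  have hdim : ringKrullDim (MvPolynomial σ ℂ) = Nat.card σ := by
    rw [MvPolynomial.ringKrullDim_of_isNoetherianRing, ringKrullDim_eq_zero_of_field, zero_add]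
  refine le_antisymm ?_ ?_
  · rw [← hdim, ← PrimeSpectrum.topologicalKrullDim_eq_ringKrullDim]
    exact (Aff.isInducing σ).topologicalKrullDim_le
  · rw [← hdim, ringKrullDim, ← Order.krullDim_orderDual]
    have hle : ∀ p q : PrimeSpectrum (MvPolynomial σ ℂ),
        Aff.zeroLocus p ≤ Aff.zeroLocus q → q ≤ p := by
      intro p q h
      have hp := p.2
      have hq := q.2
      have h' : MvPolynomial.zeroLocus ℂ p.asIdeal ⊆ MvPolynomial.zeroLocus ℂ q.asIdeal :=
        fun x hx => h (show (⟨x⟩ : Aff σ) ∈ Aff.zeroLocus p from hx)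
      have := MvPolynomial.vanishingIdeal_anti_mono (k := ℂ) h'
      rwa [MvPolynomial.IsPrime.vanishingIdeal_zeroLocus,
        MvPolynomial.IsPrime.vanishingIdeal_zeroLocus] at this
    have hmono : ∀ p q : PrimeSpectrum (MvPolynomial σ ℂ), p ≤ q →
        Aff.zeroLocus q ≤ Aff.zeroLocus p :=
      fun p q h x hx => MvPolynomial.zeroLocus_anti_mono h hx
    refine Order.krullDim_le_of_strictMono (fun p => Aff.zeroLocus (OrderDual.ofDual p)) ?_
    intro p q h
    exact lt_of_le_not_ge (hmono _ _ h.le) fun h' => h.not_ge (hle _ _ h')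

variable {J : Set (PartialFlag μ ι)}

/-- The codimension of an irreducible closed subset can be computed in a chart that meets it, so no
finiteness of the covering is needed. -/
theorem topologicalKrullDim_of_charts {N : ℕ} (hne : J.Nonempty)
    (h : ∀ V ∈ J, ∃ (Y : Set (PartialFlag μ ι)) (σ : Type) (_ : Finite σ) (_ : Chart J Y σ),
      V ∈ Y ∧ Nat.card σ = N) : topologicalKrullDim J = N := by
  refine le_antisymm ?_ ?_
  · rw [_root_.topologicalKrullDim, Order.krullDim_eq_iSup_coheight]
    refine iSup_le fun Z => ?_
    obtain ⟨V, hV⟩ := Z.isIrreducible.nonempty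
    obtain ⟨Y, σ, _, φ, hY, hN⟩ := h V V.2
    have hmem : (φ.toSubtype ⁻¹' (Z : Set J)).Nonempty := by
      refine ⟨⟨φ.coord V⟩, ?_⟩
      rwa [Set.mem_preimage, show φ.toSubtype ⟨φ.coord V⟩ = V from
        Subtype.ext (φ.flag_frame_coord hY)]
    let e := TopologicalSpace.IrreducibleCloseds.orderIsoOfIsOpenEmbedding _
      φ.isOpenEmbedding_toSubtype
    have h1 := φ.isOpenEmbedding_toSubtype.coheight_map (e.symm ⟨Z, hmem⟩)
    have h2 : TopologicalSpace.IrreducibleCloseds.map φ.toSubtype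
        φ.isOpenEmbedding_toSubtype.continuous (e.symm ⟨Z, hmem⟩) = Z :=
      congrArg Subtype.val (e.apply_symm_apply ⟨Z, hmem⟩)
    rw [← h2, h1, ← hN, ← Aff.topologicalKrullDim σ]
    exact Order.coheight_le_krullDim _
  · obtain ⟨V, hV⟩ := hne
    obtain ⟨Y, σ, _, φ, hY, hN⟩ := h V hV
    rw [← hN, ← Aff.topologicalKrullDim σ]
    exact φ.isOpenEmbedding_toSubtype.isInducing.topologicalKrullDim_le

theorem isSmooth_of_charts
    (h : ∀ V ∈ J, ∃ (Y : Set (PartialFlag μ ι)) (σ : Type) (_ : Finite σ) (_ : Chart J Y σ),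
      V ∈ Y) : IsSmooth J := by
  intro z
  obtain ⟨Y, σ, _, φ, hY⟩ := h z z.2
  exact φ.isRegularLocalRing_localRing hY

/-! ### Irreducibility -/

/-- The flags `V` and `V'` lie on a rational curve in `J`. The curve is given by polynomials `c` in
one variable; these are the coordinates of a frame of a flag in `J` away from the zeros of `Q`. -/
def JoinedByCurve (J : Set (PartialFlag μ ι)) (V V' : PartialFlag μ ι) : Prop :=
  ∃ (γ : (Unit → ℂ) → Frame μ ι) (c : (Unit → ℂ) → (Σ i : Fin n, Fin (μ i)) × ι → ℂ)
    (Q : (Unit → ℂ) → ℂ), (∀ i, (fun t => c t i) ∈ polyFun Unit) ∧ Q ∈ polyFun Unit ∧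
    (∀ t, Q t ≠ 0 → (γ t).coord = c t ∧ (γ t).flag ∈ J) ∧
    (Q (fun _ => 0) ≠ 0 ∧ (γ fun _ => 0).flag = V) ∧ Q (fun _ => 1) ≠ 0 ∧ (γ fun _ => 1).flag = V'

/-- Two non-empty open subsets of `J` meet a common curve, and non-empty open subsets of the affine
line intersect. -/
theorem isIrreducible_of_joinedByCurve (hne : J.Nonempty)
    (h : ∀ V ∈ J, ∀ V' ∈ J, JoinedByCurve J V V') : IsIrreducible J := by
  refine ⟨hne, ?_⟩
  rintro O O' hO hO' ⟨V, hV, hVO⟩ ⟨V', hV', hVO'⟩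
  obtain ⟨γ, c, Q, hc, hQ, hγ, ⟨hQ0, h0⟩, hQ1, h1⟩ := h V hV V' hV'
  have key : ∀ (O : Set (PartialFlag μ ι)) (t : Unit → ℂ), IsOpen O → Q t ≠ 0 → (γ t).flag ∈ O →
      ∃ R : MvPolynomial Unit ℂ, R ≠ 0 ∧
        ∀ t, Q t ≠ 0 → MvPolynomial.eval t R ≠ 0 → (γ t).flag ∈ O := by
    intro O t hO hQt ht
    obtain ⟨R, hR, hR'⟩ := ((γ t).mem_nhds_iff _).1
      (continuous_flag.continuousAt.preimage_mem_nhds (hO.mem_nhds ht))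
    obtain ⟨R', hR''⟩ := mem_polyFun_iff.1 (eval_mem_subalgebra (polyFun Unit) hc R)
    refine ⟨R', ?_, fun s hs hne => hR' _ ?_⟩
    · rintro rfl
      rw [(hγ t hQt).1, hR'' t, map_zero] at hR
      exact hR rfl
    · rwa [(hγ s hs).1, hR'']
  obtain ⟨R, hR, hRO⟩ := key O _ hO hQ0 (h0 ▸ hVO)
  obtain ⟨R', hR', hRO'⟩ := key O' _ hO' hQ1 (h1 ▸ hVO')
  obtain ⟨Q', hQ'⟩ := mem_polyFun_iff.1 hQ
  have hQ'0 : Q' ≠ 0 := by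
    rintro rfl
    rw [hQ', map_zero] at hQ0
    exact hQ0 rfl
  have hprod : Q' * (R * R') ≠ 0 := mul_ne_zero hQ'0 (mul_ne_zero hR hR')
  obtain ⟨t, ht⟩ : ∃ t, MvPolynomial.eval t (Q' * (R * R')) ≠ 0 := by
    by_contra! hall
    exact hprod (MvPolynomial.funext fun t => by rw [hall, map_zero])
  rw [map_mul, map_mul, ← hQ', mul_ne_zero_iff, mul_ne_zero_iff] at ht
  exact ⟨_, (hγ t ht.1).2, hRO t ht.1 ht.2.1, hRO' t ht.1 ht.2.2⟩

end

noncomputable section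

/-! ### Linear algebra on the space of a Young diagram -/

section BoxSpace
variable {lam : YoungDiagram} {E : Type} [AddCommGroup E] [Module ℂ E]

/-- The basis vector of the box `(i, c)`, with value `0` when this is not a box of `lam`. -/
def boxVec (lam : YoungDiagram) (i c : ℕ) : BoxSpace lam := fun b => if b.1 = (i, c) then 1 else 0

theorem boxVec_eq_zero {i c : ℕ} (h : (i, c) ∉ lam) : boxVec lam i c = 0 := by
  funext b
  refine if_neg fun hb => h ?_
  rw [← hb]
  exact b.2

theorem boxVec_eq_basisVec {i c : ℕ} (h : (i, c) ∈ lam) :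
    boxVec lam i c = basisVec ⟨(i, c), h⟩ := by
  funext b
  simp [boxVec, basisVec, Pi.single_apply, Subtype.ext_iff]

theorem sum_smul_boxVec (y : BoxSpace lam) : ∑ b, y b • boxVec lam b.1.1 b.1.2 = y := by
  funext b
  simp only [Finset.sum_apply, Pi.smul_apply, boxVec, smul_eq_mul, mul_ite, mul_one, mul_zero,
    Prod.mk.eta]
  simp

theorem boxSpace_hom_ext {f g : BoxSpace lam →ₗ[ℂ] E}
    (h : ∀ i c, (i, c) ∈ lam → f (boxVec lam i c) = g (boxVec lam i c)) : f = g := by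
  refine LinearMap.ext fun y => ?_
  rw [← sum_smul_boxVec y, map_sum, map_sum]
  refine Finset.sum_congr rfl fun b _ => ?_
  rw [map_smul, map_smul, h _ _ b.2]

/-- The linear map with prescribed values on the basis vectors of the boxes. -/
def ofBox (lam : YoungDiagram) (f : ℕ → ℕ → E) : BoxSpace lam →ₗ[ℂ] E :=
  ∑ b : lam.cells, (LinearMap.proj b).smulRight (f b.1.1 b.1.2)

theorem ofBox_boxVec {f : ℕ → ℕ → E} {i c : ℕ} (h : (i, c) ∈ lam) :
    ofBox lam f (boxVec lam i c) = f i c := by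
  have h1 : ∀ b : lam.cells,
      (LinearMap.proj b : BoxSpace lam →ₗ[ℂ] ℂ).smulRight (f b.1.1 b.1.2) (boxVec lam i c) =
      if b = ⟨(i, c), h⟩ then f i c else 0 := by
    intro b
    by_cases hb : b = ⟨(i, c), h⟩
    · simp [hb, boxVec]
    · have : b.1 ≠ (i, c) := fun h' => hb (Subtype.ext h')
      simp [hb, boxVec, this]
  simp [ofBox, LinearMap.sum_apply, h1]

theorem nil_boxVec (i c : ℕ) : nil lam (boxVec lam i c) = boxVec lam (i + 1) c := by
  by_cases h : (i, c) ∈ lam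
  · funext b
    rw [boxVec_eq_basisVec h]
    simp [nil, basisVec, nilMatrix, boxVec]
  · have h' : (i + 1, c) ∉ lam := fun h' => h (lam.up_left_mem (Nat.le_succ i) le_rfl h')
    rw [boxVec_eq_zero h, boxVec_eq_zero h', map_zero]

theorem nil_pow_boxVec (k i c : ℕ) :
    (nil lam ^ k) (boxVec lam i c) = boxVec lam (i + k) c := by
  induction k with
  | zero => simp
  | succ k ih => rw [pow_succ', Module.End.mul_apply, ih, nil_boxVec, add_assoc]

theorem mem_span_basisVec_iff {T : Set lam.cells} {y : BoxSpace lam} :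
    y ∈ Submodule.span ℂ (basisVec '' T) ↔ ∀ b ∉ T, y b = 0 := by
  constructor
  · intro h b hb
    have : Submodule.span ℂ (basisVec '' T) ≤ LinearMap.ker (LinearMap.proj (R := ℂ) b) := by
      rw [Submodule.span_le]
      rintro _ ⟨b', hb', rfl⟩
      have : b ≠ b' := fun h => hb (h ▸ hb')
      simp [basisVec, this]
    exact this h
  · intro h
    rw [← sum_smul_boxVec y]
    refine Submodule.sum_mem _ fun b _ => ?_
    by_cases hb : b ∈ T
    · rw [boxVec_eq_basisVec b.2]
      exact Submodule.smul_mem _ _ (Submodule.subset_span ⟨b, hb, rfl⟩)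
    · rw [h b hb, zero_smul]
      exact Submodule.zero_mem _

theorem mem_coordSpan_iff {C : Set ℕ} {y : BoxSpace lam} :
    y ∈ coordSpan lam C ↔ ∀ b : lam.cells, ¬ (b.1.1 = 0 ∧ b.1.2 ∈ C) → y b = 0 :=
  mem_span_basisVec_iff

theorem boxVec_mem_coordSpan {C : Set ℕ} {c : ℕ} (hc : c ∈ C) :
    boxVec lam 0 c ∈ coordSpan lam C := by
  rw [mem_coordSpan_iff]
  intro b hb
  refine if_neg fun h => hb ?_
  rw [h]
  exact ⟨rfl, hc⟩

theorem coordSpan_le_iff {C : Set ℕ} {W : Submodule ℂ (BoxSpace lam)} :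
    coordSpan lam C ≤ W ↔ ∀ c ∈ C, boxVec lam 0 c ∈ W := by
  refine ⟨fun h c hc => h (boxVec_mem_coordSpan hc), fun h => ?_⟩
  rw [coordSpan, Submodule.span_le]
  rintro _ ⟨⟨⟨i, c⟩, hb⟩, ⟨h0, hc⟩, rfl⟩
  obtain rfl : i = 0 := h0
  rw [← boxVec_eq_basisVec hb]
  exact h c hc

theorem coordSpan_mono {C C' : Set ℕ} (h : C ⊆ C') : coordSpan lam C ≤ coordSpan lam C' :=
  coordSpan_le_iff.2 fun _ hc => boxVec_mem_coordSpan (h hc)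

theorem coordSpan_insert (C : Set ℕ) (m : ℕ) :
    coordSpan lam (insert m C) = coordSpan lam C ⊔ Submodule.span ℂ {boxVec lam 0 m} := by
  refine le_antisymm (coordSpan_le_iff.2 ?_) (sup_le (coordSpan_mono (Set.subset_insert _ _)) ?_)
  · rintro c (rfl | hc)
    · exact Submodule.mem_sup_right (Submodule.mem_span_singleton_self _)
    · exact Submodule.mem_sup_left (boxVec_mem_coordSpan hc)
  · rw [Submodule.span_singleton_le_iff_mem]
    exact boxVec_mem_coordSpan (Set.mem_insert _ _)

theorem mem_perp_coordSpan_iff {C : Set ℕ} {y : BoxSpace lam} :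
    y ∈ perp (coordSpan lam C) ↔ ∀ b : lam.cells, b.1.1 = 0 → b.1.2 ∈ C → y b = 0 := by
  constructor
  · intro h b h0 hC
    have := h (basisVec b) (Submodule.subset_span ⟨b, ⟨h0, hC⟩, rfl⟩)
    simpa [basisVec] using this
  · intro h u hu
    rw [mem_coordSpan_iff] at hu
    refine Finset.sum_eq_zero fun b _ => ?_
    by_cases hb : b.1.1 = 0 ∧ b.1.2 ∈ C
    · rw [h b hb.1 hb.2, mul_zero]
    · rw [hu b hb, zero_mul]

theorem perp_perp_coordSpan (C : Set ℕ) : perp (perp (coordSpan lam C)) = coordSpan lam C := by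
  refine le_antisymm (fun y hy => ?_) fun y hy u hu => ?_
  · rw [mem_coordSpan_iff]
    intro b hb
    have := hy (basisVec b) (by
      rw [mem_perp_coordSpan_iff]
      intro b' h0 hC
      have : b' ≠ b := fun h => hb (h ▸ ⟨h0, hC⟩)
      simp [basisVec, this])
    simpa [basisVec] using this
  · rw [dotProduct_comm]
    exact hu y hy

theorem range_nil_le_perp_coordSpan (C : Set ℕ) :
    LinearMap.range (nil lam) ≤ perp (coordSpan lam C) := by
  rintro _ ⟨y, rfl⟩
  rw [mem_perp_coordSpan_iff]
  intro b h0 _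
  rw [← sum_smul_boxVec y, map_sum]
  simp only [map_smul, nil_boxVec, Finset.sum_apply, Pi.smul_apply, boxVec]
  refine Finset.sum_eq_zero fun b' _ => ?_
  rw [if_neg, smul_zero]
  intro h
  rw [h] at h0
  exact Nat.succ_ne_zero _ h0

theorem boxVec_succ_mem_range_nil (i c : ℕ) :
    boxVec lam (i + 1) c ∈ LinearMap.range (nil lam) :=
  ⟨boxVec lam i c, nil_boxVec i c⟩

theorem boxVec_mem_perp_coordSpan {C : Set ℕ} {c : ℕ} (hc : c ∉ C) :
    boxVec lam 0 c ∈ perp (coordSpan lam C) := by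
  rw [mem_perp_coordSpan_iff]
  intro b _ hC
  refine if_neg fun h => hc ?_
  rwa [h] at hC

/-- The complement of `⟨f_c : c ∈ C⟩` is spanned by the image of `x^λ` and by the other vectors of
the top row. -/
theorem perp_coordSpan_le {C : Set ℕ} {W : Submodule ℂ (BoxSpace lam)}
    (h : LinearMap.range (nil lam) ≤ W) (hW : ∀ c ∉ C, boxVec lam 0 c ∈ W) :
    perp (coordSpan lam C) ≤ W := by
  intro y hy
  rw [mem_perp_coordSpan_iff] at hy
  rw [← sum_smul_boxVec y]
  refine Submodule.sum_mem _ fun b _ => ?_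
  by_cases hb : b.1.1 = 0
  · by_cases hC : b.1.2 ∈ C
    · rw [hy b hb hC, zero_smul]
      exact W.zero_mem
    · rw [hb]
      exact W.smul_mem _ (hW _ hC)
  · obtain ⟨i, hi⟩ := Nat.exists_eq_succ_of_ne_zero hb
    rw [hi]
    exact W.smul_mem _ (h (boxVec_succ_mem_range_nil i _))

theorem isCompl_perp_coordSpan (C : Set ℕ) :
    IsCompl (perp (coordSpan lam C)) (coordSpan lam C) := by
  refine ⟨Submodule.disjoint_def.2 fun y h1 h2 => ?_, codisjoint_iff.2 (eq_top_iff.2 ?_)⟩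
  · rw [mem_perp_coordSpan_iff] at h1
    rw [mem_coordSpan_iff] at h2
    funext b
    by_cases hb : b.1.1 = 0 ∧ b.1.2 ∈ C
    · exact h1 b hb.1 hb.2
    · exact h2 b hb
  · intro y _
    rw [← sum_smul_boxVec y]
    refine Submodule.sum_mem _ fun b _ => Submodule.smul_mem _ _ ?_
    by_cases hb : b.1.1 = 0
    · rw [hb]
      by_cases hC : b.1.2 ∈ C
      · exact Submodule.mem_sup_right (boxVec_mem_coordSpan hC)
      · exact Submodule.mem_sup_left (boxVec_mem_perp_coordSpan hC)
    · obtain ⟨i, hi⟩ := Nat.exists_eq_succ_of_ne_zero hb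
      rw [hi]
      exact Submodule.mem_sup_left
        (range_nil_le_perp_coordSpan C (boxVec_succ_mem_range_nil i _))

theorem boxVec_zero_eq_zero {c : ℕ} (h : lam.rowLen 0 ≤ c) : boxVec lam 0 c = 0 :=
  boxVec_eq_zero fun h' => (YoungDiagram.mem_iff_lt_rowLen.1 h').not_ge h

theorem exists_coeff_of_mem_coordSpan {C : Set ℕ} {y : BoxSpace lam}
    (hy : y ∈ coordSpan lam C) : ∃ b : ℕ → ℂ, (∀ c ∉ C, b c = 0) ∧
      y = ∑ c ∈ Finset.range (lam.rowLen 0), b c • boxVec lam 0 c := by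
  classical
  refine ⟨fun c => if h : (0, c) ∈ lam then if c ∈ C then y ⟨(0, c), h⟩ else 0 else 0,
    fun c hc => by simp [hc], ?_⟩
  rw [mem_coordSpan_iff] at hy
  funext b
  obtain ⟨⟨i, c⟩, hb⟩ := b
  have hb' : (i, c) ∈ lam := hb
  simp only [Finset.sum_apply, Pi.smul_apply, boxVec, smul_eq_mul, Prod.mk.injEq, mul_ite, mul_one,
    mul_zero]
  by_cases h0 : i = 0
  · subst h0
    rw [Finset.sum_eq_single c]
    · by_cases hc : c ∈ C
      · simp [hc, hb']
      · simp [hc, hy ⟨(0, c), hb⟩ (fun h => hc h.2)]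
    · intro d _ hd
      simp [Ne.symm hd]
    · intro hc
      exact absurd (YoungDiagram.mem_iff_lt_rowLen.1 hb') (by simpa using hc)
  · simp [h0, hy ⟨(i, c), hb⟩ (fun h => h0 h.1)]

/-- The vectors of the top row are linearly independent. -/
theorem coeff_eq_of_sum_eq {b b' : ℕ → ℂ}
    (h : ∑ c ∈ Finset.range (lam.rowLen 0), b c • boxVec lam 0 c =
      ∑ c ∈ Finset.range (lam.rowLen 0), b' c • boxVec lam 0 c) {c : ℕ} (hc : c < lam.rowLen 0) :
    b c = b' c := by
  have := congrFun h ⟨(0, c), YoungDiagram.mem_iff_lt_rowLen.2 hc⟩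
  simpa [Finset.sum_apply, boxVec, hc] using this

end BoxSpace

end

noncomputable section

/-! ### Subspaces containing the image of `x^λ` -/

section
variable {lam : YoungDiagram}

theorem sup_ker_nil_pow {W : Submodule ℂ (BoxSpace lam)} (h : LinearMap.range (nil lam) ≤ W)
    (k : ℕ) : W ⊔ LinearMap.ker (nil lam ^ k) = W ⊔ coordSpan lam (Set.Ici (lam.rowLen k)) := by
  refine le_antisymm (sup_le le_sup_left fun y hy => ?_) (sup_le le_sup_left ?_)
  · rw [← sum_smul_boxVec y]
    refine Submodule.sum_mem _ fun b _ => ?_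
    by_cases hb : b.1.1 = 0
    · rw [hb]
      by_cases hk : lam.rowLen k ≤ b.1.2
      · exact Submodule.smul_mem _ _ (Submodule.mem_sup_right (boxVec_mem_coordSpan hk))
      · have hmem : (k, b.1.2) ∈ lam := YoungDiagram.mem_iff_lt_rowLen.2 (not_le.1 hk)
        have hy' : (nil lam ^ k) y ⟨(k, b.1.2), hmem⟩ = y b := by
          rw [← sum_smul_boxVec y, map_sum]
          simp only [map_smul, nil_pow_boxVec, Finset.sum_apply, Pi.smul_apply, boxVec,
            smul_eq_mul, mul_ite, mul_one, mul_zero]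
          refine Finset.sum_congr rfl fun b' _ => if_congr ?_ rfl rfl
          rw [Prod.ext_iff, Prod.ext_iff, hb]
          simp only
          omega
        rw [LinearMap.mem_ker] at hy
        rw [← hy', hy]
        simp
    · obtain ⟨i, hi⟩ := Nat.exists_eq_succ_of_ne_zero hb
      rw [hi]
      exact Submodule.smul_mem _ _ (Submodule.mem_sup_left (h (boxVec_succ_mem_range_nil i _)))
  · refine coordSpan_le_iff.2 fun c hc => Submodule.mem_sup_right ?_
    rw [LinearMap.mem_ker, nil_pow_boxVec]
    refine boxVec_eq_zero fun h' => ?_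
    rw [zero_add] at h'
    exact (YoungDiagram.mem_iff_lt_rowLen.1 h').not_ge hc

theorem finrank_sup_ker {V : Type} [AddCommGroup V] [Module ℂ V] [FiniteDimensional ℂ V]
    (f : V →ₗ[ℂ] V) (W : Submodule ℂ V) :
    Module.finrank ℂ ↥(W ⊔ LinearMap.ker f) =
      Module.finrank ℂ (W.map f) + Module.finrank ℂ (LinearMap.ker f) := by
  have h1 := Submodule.finrank_sup_add_finrank_inf_eq W (LinearMap.ker f)
  have h2 := LinearMap.finrank_range_add_finrank_ker (f.domRestrict W)
  rw [LinearMap.range_domRestrict, LinearMap.ker_domRestrict] at h2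
  have h3 : Module.finrank ℂ (Submodule.comap W.subtype (LinearMap.ker f)) =
      Module.finrank ℂ ↥(W ⊓ LinearMap.ker f) := by
    rw [← Submodule.map_comap_subtype, Submodule.finrank_map_subtype_eq]
  omega

/-- The columns `c` for which `f_c` is not in the span of `W` and the `f_l` with `l > c`. -/
def jumps (W : Submodule ℂ (BoxSpace lam)) : Set ℕ :=
  {c | boxVec lam 0 c ∉ W ⊔ coordSpan lam (Set.Ici (c + 1))}

theorem lt_rowLen_of_mem_jumps {W : Submodule ℂ (BoxSpace lam)} {c : ℕ} (h : c ∈ jumps W) :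
    c < lam.rowLen 0 := by
  by_contra hc
  refine h ?_
  rw [boxVec_zero_eq_zero (not_lt.1 hc)]
  exact Submodule.zero_mem _

theorem finite_jumps (W : Submodule ℂ (BoxSpace lam)) : (jumps W).Finite :=
  (Set.finite_Iio (lam.rowLen 0)).subset fun _ => lt_rowLen_of_mem_jumps

theorem coordSpan_eq_bot {C : Set ℕ} (h : ∀ c ∈ C, lam.rowLen 0 ≤ c) : coordSpan lam C = ⊥ :=
  eq_bot_iff.2 (coordSpan_le_iff.2 fun c hc => by
    rw [boxVec_zero_eq_zero (h c hc)]; exact Submodule.zero_mem _)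

/-- The jumps beyond `m` index a basis of `(W + ⟨f_l : l ≥ m⟩) / W`. -/
theorem sup_coordSpan_Ici (W : Submodule ℂ (BoxSpace lam)) (m : ℕ) :
    W ⊔ coordSpan lam (Set.Ici m) = W ⊔ coordSpan lam (jumps W ∩ Set.Ici m) ∧
      Module.finrank ℂ ↥(W ⊔ coordSpan lam (Set.Ici m)) =
        Module.finrank ℂ W + (jumps W ∩ Set.Ici m).ncard := by
  induction h : lam.rowLen 0 - m generalizing m with
  | zero =>
    have hm : lam.rowLen 0 ≤ m := Nat.sub_eq_zero_iff_le.1 h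
    have h2 : jumps W ∩ Set.Ici m = ∅ := by
      ext c
      simp only [Set.mem_inter_iff, Set.mem_Ici, Set.mem_empty_iff_false, iff_false, not_and]
      intro hc hmc
      exact absurd (lt_rowLen_of_mem_jumps hc) (hm.trans hmc).not_gt
    rw [h2, coordSpan_eq_bot (C := Set.Ici m) fun c hc => hm.trans hc,
      coordSpan_eq_bot (C := ∅) fun c hc => absurd hc id,
      sup_bot_eq, Set.ncard_empty]
    exact ⟨rfl, rfl⟩
  | succ j ih =>
    obtain ⟨ih1, ih2⟩ := ih (m + 1) (by omega)
    have hIci : Set.Ici m = insert m (Set.Ici (m + 1)) := by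
      ext c
      simp only [Set.mem_Ici, Set.mem_insert_iff]
      omega
    by_cases hm : m ∈ jumps W
    · have hins : jumps W ∩ Set.Ici m = insert m (jumps W ∩ Set.Ici (m + 1)) := by
        rw [hIci, Set.inter_insert_of_mem hm]
      rw [hins, Set.ncard_insert_of_notMem (by simp)
        ((finite_jumps W).subset Set.inter_subset_left), hIci, coordSpan_insert,
        coordSpan_insert, ← sup_assoc, ← sup_assoc, ← ih1,
        Submodule.finrank_sup_span_singleton hm, ih2]
      exact ⟨rfl, add_assoc _ _ _⟩
    · have hins : jumps W ∩ Set.Ici m = jumps W ∩ Set.Ici (m + 1) := by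
        rw [hIci, Set.inter_insert_of_notMem hm]
      have hsup : W ⊔ coordSpan lam (Set.Ici m) = W ⊔ coordSpan lam (Set.Ici (m + 1)) := by
        rw [hIci, coordSpan_insert, ← sup_assoc]
        exact sup_of_le_left ((Submodule.span_singleton_le_iff_mem _ _).2 (not_not.1 hm))
      rw [hins, hsup]
      exact ⟨ih1, ih2⟩

theorem jumps_perp_coordSpan {C : Set ℕ} (hC : ∀ c ∈ C, c < lam.rowLen 0) :
    jumps (perp (coordSpan lam C)) = C := by
  ext c
  constructor
  · intro h
    by_contra hc
    exact h (Submodule.mem_sup_left (boxVec_mem_perp_coordSpan hc))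
  · intro hc hmem
    have hb : (0, c) ∈ lam := YoungDiagram.mem_iff_lt_rowLen.2 (hC c hc)
    have hle : perp (coordSpan lam C) ⊔ coordSpan lam (Set.Ici (c + 1)) ≤
        LinearMap.ker (LinearMap.proj (R := ℂ) (φ := fun _ => ℂ)
          (⟨(0, c), hb⟩ : lam.cells)) := by
      refine sup_le (fun y hy => mem_perp_coordSpan_iff.1 hy _ rfl hc)
        (coordSpan_le_iff.2 fun l hl => ?_)
      rw [LinearMap.mem_ker, LinearMap.proj_apply]
      refine if_neg fun h => ?_
      have : c = l := congrArg Prod.snd h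
      rw [Set.mem_Ici] at hl
      omega
    have := hle hmem
    rw [LinearMap.mem_ker, LinearMap.proj_apply] at this
    simp [boxVec] at this

/-- Two finite sets of natural numbers with the same number of elements in each fiber of `f` are
exchanged by a permutation preserving `f`. -/
theorem exists_perm_image_eq (f : ℕ → ℕ) (A B : Finset ℕ)
    (h : ∀ y, (A.filter fun c => f c = y).card = (B.filter fun c => f c = y).card) :
    ∃ σ : Equiv.Perm ℕ, (∀ c, f (σ c) = f c) ∧ A.image σ = B := by
  induction hj : (A \ B).card generalizing A with
  | zero =>
    have hAB : A ⊆ B := by rwa [Finset.card_eq_zero, Finset.sdiff_eq_empty_iff_subset] at hj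
    refine ⟨1, fun _ => rfl, ?_⟩
    rw [Equiv.Perm.coe_one, Finset.image_id]
    refine Finset.Subset.antisymm hAB fun b hb => ?_
    have hsub : (A.filter fun c => f c = f b) ⊆ B.filter fun c => f c = f b :=
      Finset.filter_subset_filter _ hAB
    have := Finset.eq_of_subset_of_card_le hsub (h (f b)).ge
    exact (Finset.mem_filter.1 (this.ge (Finset.mem_filter.2 ⟨hb, rfl⟩))).1
  | succ j ih =>
    obtain ⟨a, ha⟩ : (A \ B).Nonempty := Finset.card_pos.1 (by omega)
    rw [Finset.mem_sdiff] at ha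
    obtain ⟨b, hb, hbA, hfb⟩ : ∃ b ∈ B, b ∉ A ∧ f b = f a := by
      by_contra! hall
      have hsub : (B.filter fun c => f c = f a) ⊆ (A.filter fun c => f c = f a).erase a := by
        intro c hc
        obtain ⟨hcB, hca⟩ := Finset.mem_filter.1 hc
        have hcA : c ∈ A := by
          by_contra hcA
          exact hall c hcB hcA hca
        refine Finset.mem_erase.2 ⟨?_, Finset.mem_filter.2 ⟨hcA, hca⟩⟩
        rintro rfl
        exact ha.2 hcB
      have h1 := Finset.card_le_card hsub
      have ha' : a ∈ A.filter fun c => f c = f a := Finset.mem_filter.2 ⟨ha.1, rfl⟩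
      rw [Finset.card_erase_of_mem ha', ← h] at h1
      have := Finset.card_pos.2 ⟨a, ha'⟩
      omega
    have hab : a ≠ b := fun h => hbA (h ▸ ha.1)
    have hf : ∀ c, f (Equiv.swap a b c) = f c := by
      intro c
      by_cases hca : c = a
      · rw [hca, Equiv.swap_apply_left, hfb]
      · by_cases hcb : c = b
        · rw [hcb, Equiv.swap_apply_right, hfb]
        · rw [Equiv.swap_apply_of_ne_of_ne hca hcb]
    have hmem : ∀ c, c ∈ A.image (Equiv.swap a b) ↔ Equiv.swap a b c ∈ A := by
      intro c
      rw [Finset.mem_image]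
      constructor
      · rintro ⟨x, hx, rfl⟩
        rwa [Equiv.swap_apply_self]
      · intro hc
        exact ⟨_, hc, Equiv.swap_apply_self _ _ _⟩
    obtain ⟨σ, hσ, hσB⟩ := ih (A.image (Equiv.swap a b)) (fun y => by
      rw [← h y, Finset.filter_image,
        Finset.card_image_of_injective _ (Equiv.swap a b).injective]
      simp only [hf]) (by
      have : A.image (Equiv.swap a b) \ B = (A \ B).erase a := by
        ext c
        rw [Finset.mem_sdiff, hmem, Finset.mem_erase, Finset.mem_sdiff]
        by_cases hca : c = a
        · subst hca
          simp [hbA]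
        · by_cases hcb : c = b
          · subst hcb
            simp [hb]
          · rw [Equiv.swap_apply_of_ne_of_ne hca hcb]
            simp [hca]
      rw [this, Finset.card_erase_of_mem (Finset.mem_sdiff.2 ha), hj]
      rfl)
    refine ⟨(Equiv.swap a b).trans σ, fun c => by rw [Equiv.trans_apply, hσ, hf], ?_⟩
    rw [← hσB, Finset.image_image]
    rfl

/-- Permuting columns of equal length. -/
def colPerm (σ : Equiv.Perm ℕ) (hσ : ∀ i c, (i, σ c) ∈ lam ↔ (i, c) ∈ lam) :
    BoxSpace lam ≃ₗ[ℂ] BoxSpace lam :=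
  LinearEquiv.funCongrLeft ℂ ℂ
    { toFun := fun b => ⟨(b.1.1, σ.symm b.1.2), (hσ _ _).1 (by
        rw [Equiv.apply_symm_apply]; exact b.2)⟩
      invFun := fun b => ⟨(b.1.1, σ b.1.2), (hσ _ _).2 b.2⟩
      left_inv := fun b => by simp
      right_inv := fun b => by simp }

theorem colPerm_boxVec (σ : Equiv.Perm ℕ) (hσ : ∀ i c, (i, σ c) ∈ lam ↔ (i, c) ∈ lam) (i c : ℕ) :
    colPerm σ hσ (boxVec lam i c) = boxVec lam i (σ c) := by
  funext b
  simp only [colPerm, LinearEquiv.funCongrLeft_apply, LinearMap.funLeft_apply, boxVec]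
  refine if_congr ?_ rfl rfl
  rw [Prod.ext_iff, Prod.ext_iff]
  change b.1.1 = i ∧ σ.symm b.1.2 = c ↔ b.1.1 = i ∧ b.1.2 = σ c
  rw [Equiv.symm_apply_eq]

theorem colPerm_nil (σ : Equiv.Perm ℕ) (hσ : ∀ i c, (i, σ c) ∈ lam ↔ (i, c) ∈ lam)
    (y : BoxSpace lam) : colPerm σ hσ (nil lam y) = nil lam (colPerm σ hσ y) := by
  have : (colPerm σ hσ).toLinearMap ∘ₗ nil lam = nil lam ∘ₗ (colPerm σ hσ).toLinearMap :=
    boxSpace_hom_ext fun i c _ => by simp [nil_boxVec, colPerm_boxVec]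
  exact LinearMap.congr_fun this y

end

end

noncomputable section

/-! ### Horizontal strips and Schubert cells -/

section
variable {lam nu : YoungDiagram} {C : Set ℕ}

/-- `nu` is obtained from `lam` by removing the bottom boxes of the columns in `C`. -/
structure IsHorizontalStrip (lam nu : YoungDiagram) (C : Set ℕ) : Prop where
  top_mem : ∀ c ∈ C, (0, c) ∈ lam
  mem_iff : ∀ i, ∀ c ∈ C, (i, c) ∈ nu ↔ (i + 1, c) ∈ lam
  mem_iff_of_notMem : ∀ i, ∀ c ∉ C, (i, c) ∈ nu ↔ (i, c) ∈ lam

/-- Among columns of the same length, `C` contains the rightmost ones. -/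
theorem IsHorizontalStrip.exists_row (h : IsHorizontalStrip lam nu C) {c l : ℕ} (hc : c ∈ C)
    (hl : l ∉ C) (hcl : c < l) : ∃ k, c < lam.rowLen k ∧ lam.rowLen k ≤ l := by
  have h0 : 0 < lam.colLen c := YoungDiagram.mem_iff_lt_colLen.1 (h.top_mem c hc)
  obtain ⟨k, hk⟩ := Nat.exists_eq_succ_of_ne_zero h0.ne'
  have h1 : (k, c) ∈ lam := YoungDiagram.mem_iff_lt_colLen.2 (by omega)
  have h2 : (k + 1, c) ∉ lam := fun h' => by
    have := YoungDiagram.mem_iff_lt_colLen.1 h'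
    omega
  refine ⟨k, YoungDiagram.mem_iff_lt_rowLen.1 h1, not_lt.1 fun h' => h2 ?_⟩
  rw [← h.mem_iff k c hc]
  refine nu.up_left_mem le_rfl hcl.le ?_
  rw [h.mem_iff_of_notMem k l hl]
  exact YoungDiagram.mem_iff_lt_rowLen.2 h'

theorem IsHorizontalStrip.lt_rowLen (h : IsHorizontalStrip lam nu C) {c : ℕ} (hc : c ∈ C) :
    c < lam.rowLen 0 :=
  YoungDiagram.mem_iff_lt_rowLen.1 (h.top_mem c hc)

/-- The standard embedding of the space of `nu`, which shifts the columns in `C` down by one. -/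
theorem IsHorizontalStrip.exists_embedding (h : IsHorizontalStrip lam nu C) :
    ∃ e : BoxSpace nu →ₗ[ℂ] BoxSpace lam, Function.Injective e ∧
      LinearMap.range e = perp (coordSpan lam C) ∧ ∀ y, e (nil nu y) = nil lam (e y) := by
  classical
  let s : ℕ → ℕ → ℕ := fun i c => if c ∈ C then i + 1 else i
  have hs : ∀ i c, (i, c) ∈ nu ↔ (s i c, c) ∈ lam := by
    intro i c
    by_cases hc : c ∈ C
    · simp only [s, if_pos hc, h.mem_iff i c hc]
    · simp only [s, if_neg hc, h.mem_iff_of_notMem i c hc]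
  let e : BoxSpace nu →ₗ[ℂ] BoxSpace lam := ofBox nu fun i c => boxVec lam (s i c) c
  have he : ∀ i c, e (boxVec nu i c) = boxVec lam (s i c) c := by
    intro i c
    by_cases hic : (i, c) ∈ nu
    · exact ofBox_boxVec hic
    · rw [boxVec_eq_zero hic, map_zero, boxVec_eq_zero fun h' => hic ((hs i c).2 h')]
  have hcomm : e ∘ₗ nil nu = nil lam ∘ₗ e := by
    refine boxSpace_hom_ext fun i c _ => ?_
    simp only [LinearMap.comp_apply, nil_boxVec, he]
    congr 1
    simp only [s]
    split_ifs <;> rfl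
  refine ⟨e, ?_, le_antisymm ?_ ?_, LinearMap.congr_fun hcomm⟩
  · let r : BoxSpace lam →ₗ[ℂ] BoxSpace nu :=
      LinearMap.funLeft ℂ ℂ fun b : nu.cells => ⟨(s b.1.1 b.1.2, b.1.2), (hs _ _).1 b.2⟩
    have hr : r ∘ₗ e = LinearMap.id := by
      refine boxSpace_hom_ext fun i c _ => ?_
      rw [LinearMap.comp_apply, he]
      funext b
      simp only [r, LinearMap.funLeft_apply, boxVec, LinearMap.id_apply]
      refine if_congr ?_ rfl rfl
      rw [Prod.ext_iff, Prod.ext_iff]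
      refine and_congr_left fun hbc => ?_
      have hbc' : b.1.2 = c := hbc
      simp only [s, hbc']
      split_ifs <;> simp
    exact Function.LeftInverse.injective (g := r) fun y => LinearMap.congr_fun hr y
  · rintro _ ⟨y, rfl⟩
    rw [← sum_smul_boxVec y, map_sum]
    refine Submodule.sum_mem _ fun b _ => ?_
    rw [map_smul, he]
    refine Submodule.smul_mem _ _ ?_
    by_cases hc : b.1.2 ∈ C
    · simp only [s, if_pos hc]
      exact range_nil_le_perp_coordSpan C (boxVec_succ_mem_range_nil _ _)
    · simp only [s, if_neg hc]
      by_cases hi : b.1.1 = 0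
      · rw [hi]
        exact boxVec_mem_perp_coordSpan hc
      · obtain ⟨i, hi⟩ := Nat.exists_eq_succ_of_ne_zero hi
        rw [hi]
        exact range_nil_le_perp_coordSpan C (boxVec_succ_mem_range_nil _ _)
  · refine perp_coordSpan_le ?_ fun c hc => ⟨boxVec nu 0 c, by rw [he]; simp only [s, if_neg hc]⟩
    rintro _ ⟨y, rfl⟩
    rw [← sum_smul_boxVec y, map_sum]
    refine Submodule.sum_mem _ fun b _ => ?_
    rw [map_smul, nil_boxVec]
    refine Submodule.smul_mem _ _ ?_
    by_cases hc : b.1.2 ∈ C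
    · exact ⟨boxVec nu b.1.1 b.1.2, by rw [he]; simp only [s, if_pos hc]⟩
    · exact ⟨boxVec nu (b.1.1 + 1) b.1.2, by rw [he]; simp only [s, if_neg hc]⟩

/-! #### The unipotent matrices `g(U)ᵀ` -/

theorem IsSchubertCoord.neg {a : ℕ → ℕ → ℂ} (ha : IsSchubertCoord C a) : IsSchubertCoord C (-a) :=
  fun c l h => by simp [ha c l h]

/-- The operator `g(U)ᵀ` on the space of `lam`. -/
def rowOp (lam : YoungDiagram) (a : ℕ → ℕ → ℂ) : BoxSpace lam →ₗ[ℂ] BoxSpace lam :=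
  Matrix.toLin' (schubertMatrix lam a).transpose

theorem rowOp_boxVec {a : ℕ → ℕ → ℂ} (ha : IsSchubertCoord C a) (i l : ℕ) :
    rowOp lam a (boxVec lam i l) =
      boxVec lam i l + ∑ c ∈ Finset.range (lam.rowLen 0), a c l • boxVec lam i c := by
  by_cases h : (i, l) ∈ lam
  · funext b
    have hall : a l l = 0 := ha l l fun h' => lt_irrefl l h'.2.2
    have hlt : b.1.2 < lam.rowLen 0 :=
      YoungDiagram.mem_iff_lt_rowLen.1 (lam.up_left_mem (Nat.zero_le _) le_rfl
        (show (b.1.1, b.1.2) ∈ lam from b.2))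
    rw [boxVec_eq_basisVec h, rowOp, Matrix.toLin'_apply, basisVec, Matrix.mulVec_single_one]
    simp only [Matrix.col_apply, Matrix.transpose_apply, schubertMatrix, Matrix.of_apply,
      Pi.add_apply, Pi.single_apply, Finset.sum_apply, Pi.smul_apply, boxVec, Subtype.ext_iff,
      Prod.ext_iff, smul_eq_mul, mul_ite, mul_one, mul_zero]
    by_cases hi : i = b.1.1
    · have hs : ∑ c ∈ Finset.range (lam.rowLen 0), (if b.1.1 = i ∧ b.1.2 = c then a c l else 0) =
          a b.1.2 l := by
        rw [Finset.sum_eq_single b.1.2]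
        · simp [hi]
        · intro c _ hc
          simp [Ne.symm hc]
        · intro hc
          exact absurd hlt (by simpa using hc)
      rw [hs, if_pos hi]
      by_cases hl : l = b.1.2
      · rw [if_pos hl, if_pos ⟨hi.symm, hl.symm⟩, ← hl, hall, add_zero]
      · simp [hl, Ne.symm hl]
    · simp [hi, Ne.symm hi]
  · rw [boxVec_eq_zero h, map_zero, zero_add, Finset.sum_eq_zero]
    intro c _
    by_cases hcl : c ∈ C ∧ l ∉ C ∧ l < c
    · rw [boxVec_eq_zero fun h' => h (lam.up_left_mem le_rfl hcl.2.2.le h'), smul_zero]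
    · rw [ha c l hcl, zero_smul]

theorem rowOp_boxVec_of_mem {a : ℕ → ℕ → ℂ} (ha : IsSchubertCoord C a) (i : ℕ) {c : ℕ}
    (hc : c ∈ C) : rowOp lam a (boxVec lam i c) = boxVec lam i c := by
  rw [rowOp_boxVec ha, Finset.sum_eq_zero, add_zero]
  intro d _
  rw [ha d c fun h => h.2.1 hc, zero_smul]

theorem rowOp_nil {a : ℕ → ℕ → ℂ} (ha : IsSchubertCoord C a) (y : BoxSpace lam) :
    rowOp lam a (nil lam y) = nil lam (rowOp lam a y) := by
  have : rowOp lam a ∘ₗ nil lam = nil lam ∘ₗ rowOp lam a :=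
    boxSpace_hom_ext fun i c _ => by
      simp [nil_boxVec, rowOp_boxVec ha]
  exact LinearMap.congr_fun this y

theorem rowOp_neg_rowOp {a : ℕ → ℕ → ℂ} (ha : IsSchubertCoord C a) :
    rowOp lam (-a) ∘ₗ rowOp lam a = LinearMap.id := by
  refine boxSpace_hom_ext fun i l _ => ?_
  have h1 : ∀ c, a c l • rowOp lam (-a) (boxVec lam i c) = a c l • boxVec lam i c := by
    intro c
    by_cases hcl : c ∈ C ∧ l ∉ C ∧ l < c
    · rw [rowOp_boxVec_of_mem ha.neg i hcl.1]
    · rw [ha c l hcl, zero_smul, zero_smul]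
  rw [LinearMap.comp_apply, rowOp_boxVec ha, map_add, map_sum]
  simp only [map_smul, h1]
  rw [rowOp_boxVec ha.neg, add_assoc, ← Finset.sum_add_distrib]
  simp

/-- The inverse of `g(U)ᵀ`, as an isomorphism. It is obtained by changing the sign of the
coordinates. -/
def shear (lam : YoungDiagram) {a : ℕ → ℕ → ℂ} (ha : IsSchubertCoord C a) :
    BoxSpace lam ≃ₗ[ℂ] BoxSpace lam :=
  LinearEquiv.ofLinearMap (rowOp lam (-a)) (rowOp lam a) (rowOp_neg_rowOp ha)
    (by simpa using rowOp_neg_rowOp (lam := lam) ha.neg)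

theorem shear_apply {a : ℕ → ℕ → ℂ} (ha : IsSchubertCoord C a) (y : BoxSpace lam) :
    shear lam ha y = rowOp lam (-a) y := rfl

theorem shear_symm_apply {a : ℕ → ℕ → ℂ} (ha : IsSchubertCoord C a) (y : BoxSpace lam) :
    (shear lam ha).symm y = rowOp lam a y := rfl

theorem shear_nil {a : ℕ → ℕ → ℂ} (ha : IsSchubertCoord C a) (y : BoxSpace lam) :
    shear lam ha (nil lam y) = nil lam (shear lam ha y) :=
  rowOp_nil ha.neg y

theorem shear_boxVec {a : ℕ → ℕ → ℂ} (ha : IsSchubertCoord C a) (i l : ℕ) :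
    shear lam ha (boxVec lam i l) =
      boxVec lam i l - ∑ c ∈ Finset.range (lam.rowLen 0), a c l • boxVec lam i c := by
  rw [shear_apply, rowOp_boxVec ha.neg]
  simp [sub_eq_add_neg]

theorem shear_boxVec_of_mem {a : ℕ → ℕ → ℂ} (ha : IsSchubertCoord C a) (i : ℕ) {c : ℕ}
    (hc : c ∈ C) : shear lam ha (boxVec lam i c) = boxVec lam i c :=
  rowOp_boxVec_of_mem ha.neg i hc

/-! #### Subspaces in the orbit of `⟨f_c : c ∈ C⟩^⊥` -/

/-- `W` contains the image of `x^λ`, and the powers of `x^λ` have the same ranks on `W` as on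
`⟨f_c : c ∈ C⟩^⊥`. -/
structure SameRanks (C : Set ℕ) (W : Submodule ℂ (BoxSpace lam)) : Prop where
  range_le : LinearMap.range (nil lam) ≤ W
  finrank_eq : ∀ k, Module.finrank ℂ (W.map (nil lam ^ k)) =
    Module.finrank ℂ ((perp (coordSpan lam C)).map (nil lam ^ k))

theorem SameRanks.finrank_eq_self {W : Submodule ℂ (BoxSpace lam)} (h : SameRanks C W) :
    Module.finrank ℂ W = Module.finrank ℂ (perp (coordSpan lam C)) := by
  have := h.finrank_eq 0
  rwa [pow_zero, Module.End.one_eq_id, Submodule.map_id, Submodule.map_id] at this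

theorem SameRanks.finrank_sup {W : Submodule ℂ (BoxSpace lam)} (h : SameRanks C W)
    (hC : ∀ c ∈ C, c < lam.rowLen 0) (k : ℕ) :
    Module.finrank ℂ ↥(W ⊔ coordSpan lam (Set.Ici (lam.rowLen k))) =
      Module.finrank ℂ W + (C ∩ Set.Ici (lam.rowLen k)).ncard := by
  rw [← sup_ker_nil_pow h.range_le, finrank_sup_ker, h.finrank_eq, ← finrank_sup_ker,
    sup_ker_nil_pow (range_nil_le_perp_coordSpan C), (sup_coordSpan_Ici _ _).2,
    jumps_perp_coordSpan hC, h.finrank_eq_self]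

theorem finrank_coordSpan {A : Set ℕ} (hA : ∀ c ∈ A, c < lam.rowLen 0) :
    Module.finrank ℂ (coordSpan lam A) = A.ncard := by
  have h1 := (sup_coordSpan_Ici (perp (coordSpan lam A)) 0)
  rw [jumps_perp_coordSpan hA, show Set.Ici 0 = (Set.univ : Set ℕ) by ext; simp,
    Set.inter_univ] at h1
  have h2 := Submodule.finrank_add_eq_of_isCompl (isCompl_perp_coordSpan (lam := lam) A)
  rw [h1.1, (isCompl_perp_coordSpan A).sup_eq_top, finrank_top] at h1
  omega

theorem SameRanks.disjoint {W : Submodule ℂ (BoxSpace lam)} (h : SameRanks C W)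
    (htop : W ⊔ coordSpan lam C = ⊤) : Disjoint W (coordSpan lam C) := by
  rw [disjoint_iff, ← Submodule.finrank_eq_zero (R := ℂ)]
  have h1 := Submodule.finrank_sup_add_finrank_inf_eq W (coordSpan lam C)
  have h2 := Submodule.finrank_add_eq_of_isCompl (isCompl_perp_coordSpan (lam := lam) C)
  rw [htop, finrank_top, h.finrank_eq_self] at h1
  omega

/-- A complement `W` of `⟨f_c : c ∈ C⟩` with the right ranks has Schubert coordinates: for `c < l`
there is a row with more than `c` and at most `l` boxes, and the rank of the corresponding power of
`x^λ` forces `f_l` to lie in the sum of `W` and the `f_{c'}` with `c' ∈ C` beyond the end of that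
row. -/
theorem SameRanks.isSchubertCoord {W : Submodule ℂ (BoxSpace lam)} (h : SameRanks C W)
    (hs : IsHorizontalStrip lam nu C) (hdisj : Disjoint W (coordSpan lam C)) {a : ℕ → ℕ → ℂ}
    (ha : ∀ c l, ¬ (c ∈ C ∧ l ∉ C ∧ l < lam.rowLen 0) → a c l = 0)
    (haW : ∀ l ∉ C, boxVec lam 0 l -
      ∑ c ∈ Finset.range (lam.rowLen 0), a c l • boxVec lam 0 c ∈ W) :
    IsSchubertCoord C a := by
  intro c l hcl
  by_cases hcl' : c ∈ C ∧ l ∉ C ∧ l < lam.rowLen 0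
  swap
  · exact ha c l hcl'
  obtain ⟨hc, hl, -⟩ := hcl'
  have hlt : c < l := lt_of_le_of_ne (not_lt.1 fun h' => hcl ⟨hc, hl, h'⟩) fun h' => hl (h' ▸ hc)
  obtain ⟨k, hck, hkl⟩ := hs.exists_row hc hl hlt
  have hC : ∀ c ∈ C, c < lam.rowLen 0 := fun c hc => hs.lt_rowLen hc
  -- both sums have dimension `dim W + #{c' ∈ C : c' ≥ rowLen k}`
  have heq : W ⊔ coordSpan lam (C ∩ Set.Ici (lam.rowLen k)) =
      W ⊔ coordSpan lam (Set.Ici (lam.rowLen k)) := by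
    refine Submodule.eq_of_le_of_finrank_eq
      (sup_le_sup_left (coordSpan_mono Set.inter_subset_right) _) ?_
    have h1 := Submodule.finrank_sup_add_finrank_inf_eq W
      (coordSpan lam (C ∩ Set.Ici (lam.rowLen k)))
    have h2 : W ⊓ coordSpan lam (C ∩ Set.Ici (lam.rowLen k)) = ⊥ :=
      (hdisj.mono_right (coordSpan_mono Set.inter_subset_left)).eq_bot
    rw [h2, finrank_bot, finrank_coordSpan fun c hc => hC c hc.1] at h1
    rw [h.finrank_sup hC]
    omega
  have hmem : boxVec lam 0 l ∈ W ⊔ coordSpan lam (C ∩ Set.Ici (lam.rowLen k)) := by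
    rw [heq]
    exact Submodule.mem_sup_right (boxVec_mem_coordSpan hkl)
  obtain ⟨w, hw, z, hz, hwz⟩ := Submodule.mem_sup.1 hmem
  obtain ⟨b, hb, rfl⟩ := exists_coeff_of_mem_coordSpan hz
  have hsum : ∑ c ∈ Finset.range (lam.rowLen 0), a c l • boxVec lam 0 c ∈ coordSpan lam C := by
    refine Submodule.sum_mem _ fun c' _ => ?_
    by_cases hc' : c' ∈ C
    · exact Submodule.smul_mem _ _ (boxVec_mem_coordSpan hc')
    · rw [ha c' l fun h => hc' h.1, zero_smul]
      exact Submodule.zero_mem _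
  have hdiff : ∑ c ∈ Finset.range (lam.rowLen 0), b c • boxVec lam 0 c =
      ∑ c ∈ Finset.range (lam.rowLen 0), a c l • boxVec lam 0 c := by
    refine sub_eq_zero.1 (Submodule.disjoint_def.1 hdisj _ ?_
      (Submodule.sub_mem _ (coordSpan_mono Set.inter_subset_left hz) hsum))
    have := Submodule.sub_mem _ (haW l hl) hw
    rwa [← hwz, add_sub_assoc, add_sub_cancel_left] at this
  have := coeff_eq_of_sum_eq hdiff (hC c hc)
  rw [← this]
  exact hb c fun h => hck.not_ge h.2

/-- A complement of `⟨f_c : c ∈ C⟩` of the right dimension with Schubert coordinates `a` is a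
translate of `⟨f_c : c ∈ C⟩^⊥`. -/
theorem eq_map_shear {W : Submodule ℂ (BoxSpace lam)} (hle : LinearMap.range (nil lam) ≤ W)
    (hfin : Module.finrank ℂ W = Module.finrank ℂ (perp (coordSpan lam C)))
    {a : ℕ → ℕ → ℂ} (ha : IsSchubertCoord C a) (haW : ∀ l ∉ C, boxVec lam 0 l -
      ∑ c ∈ Finset.range (lam.rowLen 0), a c l • boxVec lam 0 c ∈ W) :
    W = (perp (coordSpan lam C)).map (shear lam ha).toLinearMap := by
  refine (Submodule.eq_of_le_of_finrank_eq ?_ ?_).symm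
  · rw [Submodule.map_le_iff_le_comap]
    refine perp_coordSpan_le ?_ fun l hl => ?_
    · rintro _ ⟨y, rfl⟩
      rw [Submodule.mem_comap, LinearEquiv.coe_coe, shear_nil]
      exact hle ⟨_, rfl⟩
    · rw [Submodule.mem_comap, LinearEquiv.coe_coe, shear_boxVec]
      exact haW l hl
  · rw [hfin]
    exact LinearEquiv.finrank_map_eq (shear lam ha) _

/-- The centralizer of `x^λ` acts transitively on the subspaces with given ranks: a permutation of
columns of equal length makes `W` a complement of `⟨f_c : c ∈ C⟩`, and such a complement is the
image of `⟨f_c : c ∈ C⟩^⊥` under a matrix `g(U)⁻ᵀ`. -/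
theorem SameRanks.exists_equiv {W : Submodule ℂ (BoxSpace lam)} (h : SameRanks C W)
    (hs : IsHorizontalStrip lam nu C) : ∃ z : BoxSpace lam ≃ₗ[ℂ] BoxSpace lam,
      (∀ y, z (nil lam y) = nil lam (z y)) ∧ W = (perp (coordSpan lam C)).map z.toLinearMap := by
  classical
  have hC : ∀ c ∈ C, c < lam.rowLen 0 := fun c hc => hs.lt_rowLen hc
  have hCfin : C.Finite := (Set.finite_Iio (lam.rowLen 0)).subset hC
  -- the sets `jumps W` and `C` contain equally many columns of each length
  have hcount : ∀ k, (jumps W ∩ Set.Ici (lam.rowLen k)).ncard =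
      (C ∩ Set.Ici (lam.rowLen k)).ncard := by
    intro k
    have h1 := (sup_coordSpan_Ici W (lam.rowLen k)).2
    rw [h.finrank_sup hC] at h1
    omega
  have hle : ∀ k c, lam.rowLen k ≤ c ↔ lam.colLen c ≤ k := fun k c => by
    rw [← not_lt, ← not_lt, ← YoungDiagram.mem_iff_lt_rowLen, ← YoungDiagram.mem_iff_lt_colLen]
  have hcard : ∀ (A : Set ℕ) (hA : A.Finite) (k : ℕ), (A ∩ Set.Ici (lam.rowLen k)).ncard =
      (hA.toFinset.filter fun c => lam.colLen c ≤ k).card := by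
    intro A hA k
    rw [← Set.ncard_coe_finset]
    congr 1
    ext c
    simp [hle]
  obtain ⟨σ, hσ, hσC⟩ := exists_perm_image_eq lam.colLen hCfin.toFinset (finite_jumps W).toFinset
    (by
      have hk : ∀ k, (hCfin.toFinset.filter fun c => lam.colLen c ≤ k).card =
          ((finite_jumps W).toFinset.filter fun c => lam.colLen c ≤ k).card := fun k => by
        rw [← hcard, ← hcard, hcount]
      have hsplit : ∀ (A : Finset ℕ) (k : ℕ),
          (A.filter fun c => lam.colLen c ≤ k + 1).card =
          (A.filter fun c => lam.colLen c ≤ k).card +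
            (A.filter fun c => lam.colLen c = k + 1).card := by
        intro A k
        rw [← Finset.card_union_of_disjoint, ← Finset.filter_or]
        · congr 1
          exact Finset.filter_congr fun c _ => by omega
        · rw [Finset.disjoint_filter]
          intro c _ h1 h2
          omega
      intro y
      cases y with
      | zero => simpa using hk 0
      | succ k =>
        have h1 := hk (k + 1)
        rw [hsplit, hsplit, hk k] at h1
        omega)
  have hσ' : ∀ i c, (i, σ c) ∈ lam ↔ (i, c) ∈ lam := fun i c => by
    rw [YoungDiagram.mem_iff_lt_colLen, YoungDiagram.mem_iff_lt_colLen, hσ]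
  let p := colPerm σ hσ'
  have hpnil : ∀ y, p (nil lam y) = nil lam (p y) := colPerm_nil σ hσ'
  have hpnil' : ∀ y, p.symm (nil lam y) = nil lam (p.symm y) := fun y => by
    rw [LinearEquiv.symm_apply_eq, hpnil, LinearEquiv.apply_symm_apply]
  have hjump : coordSpan lam (jumps W) = (coordSpan lam C).map p.toLinearMap := by
    have hmem : ∀ c, c ∈ jumps W ↔ ∃ d ∈ C, σ d = c := fun c => by
      rw [← (finite_jumps W).mem_toFinset, ← hσC]
      simp
    refine le_antisymm (coordSpan_le_iff.2 fun c hc => ?_) ?_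
    · obtain ⟨d, hd, rfl⟩ := (hmem c).1 hc
      exact ⟨_, boxVec_mem_coordSpan hd, colPerm_boxVec σ hσ' 0 d⟩
    · rw [Submodule.map_le_iff_le_comap]
      refine coordSpan_le_iff.2 fun d hd => ?_
      rw [Submodule.mem_comap, LinearEquiv.coe_coe, colPerm_boxVec]
      exact boxVec_mem_coordSpan ((hmem _).2 ⟨d, hd, rfl⟩)
  let W' := W.map p.symm.toLinearMap
  have hW' : W'.map p.toLinearMap = W := by
    rw [← Submodule.map_comp]
    simp
  have h' : SameRanks C W' := by
    refine ⟨?_, fun k => ?_⟩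
    · rintro _ ⟨y, rfl⟩
      exact ⟨nil lam (p y), h.range_le ⟨_, rfl⟩, by
        rw [LinearEquiv.coe_coe, hpnil', LinearEquiv.symm_apply_apply]⟩
    · have hcomm : (nil lam ^ k) ∘ₗ p.symm.toLinearMap =
          p.symm.toLinearMap ∘ₗ (nil lam ^ k) := by
        refine LinearMap.ext fun y => ?_
        simp only [LinearMap.comp_apply, LinearEquiv.coe_coe]
        induction k with
        | zero => simp
        | succ k ih => rw [pow_succ', Module.End.mul_apply, Module.End.mul_apply, ih, hpnil']
      rw [← h.finrank_eq, ← Submodule.map_comp, hcomm, Submodule.map_comp]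
      exact LinearEquiv.finrank_map_eq p.symm _
  have htop : W' ⊔ coordSpan lam C = ⊤ := by
    have h1 := (sup_coordSpan_Ici W 0).1
    have h2 : W ⊔ coordSpan lam (Set.Ici 0) = ⊤ := by
      refine eq_top_iff.2 ((isCompl_perp_coordSpan (lam := lam) (Set.Ici 0)).sup_eq_top.ge.trans
        (sup_le ?_ le_sup_right))
      exact perp_coordSpan_le (h.range_le.trans le_sup_left) fun c hc => absurd (Nat.zero_le c) hc
    rw [h2, show Set.Ici 0 = (Set.univ : Set ℕ) by ext; simp, Set.inter_univ, hjump, ← hW',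
      ← Submodule.map_sup] at h1
    have h3 := congrArg (Submodule.comap p.toLinearMap) h1
    rw [Submodule.comap_map_eq_of_injective p.injective, Submodule.comap_top] at h3
    exact h3.symm
  have hdisj : Disjoint W' (coordSpan lam C) := h'.disjoint htop
  have hcoef : ∀ l, ∃ b : ℕ → ℂ, (∀ c ∉ C, b c = 0) ∧ boxVec lam 0 l -
      ∑ c ∈ Finset.range (lam.rowLen 0), b c • boxVec lam 0 c ∈ W' := by
    intro l
    obtain ⟨w, hw, z, hz, hwz⟩ := Submodule.mem_sup.1
      (htop.ge (Submodule.mem_top (x := boxVec lam 0 l)))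
    obtain ⟨b, hb, rfl⟩ := exists_coeff_of_mem_coordSpan hz
    exact ⟨b, hb, by rwa [← hwz, add_sub_cancel_right]⟩
  choose b hb hbW using hcoef
  let a : ℕ → ℕ → ℂ := fun c l => if l ∉ C ∧ l < lam.rowLen 0 then b l c else 0
  have haW : ∀ l ∉ C, boxVec lam 0 l -
      ∑ c ∈ Finset.range (lam.rowLen 0), a c l • boxVec lam 0 c ∈ W' := by
    intro l hl
    by_cases hlt : l < lam.rowLen 0
    · simp only [a, if_pos (And.intro hl hlt)]
      exact hbW l
    · have hneg : ¬ (l ∉ C ∧ l < lam.rowLen 0) := fun h => hlt h.2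
      simp only [a, if_neg hneg, zero_smul, Finset.sum_const_zero, sub_zero]
      rw [boxVec_zero_eq_zero (not_lt.1 hlt)]
      exact W'.zero_mem
  have ha : IsSchubertCoord C a := h'.isSchubertCoord hs hdisj (fun c l hcl => by
    by_cases hl : l ∉ C ∧ l < lam.rowLen 0
    · simp only [a, if_pos hl]
      exact hb l c fun hc => hcl ⟨hc, hl⟩
    · simp only [a, if_neg hl]) haW
  have hfinal := eq_map_shear h'.range_le h'.finrank_eq_self ha haW
  refine ⟨(shear lam ha).trans p, fun y => ?_, ?_⟩
  · rw [LinearEquiv.trans_apply, LinearEquiv.trans_apply, shear_nil, hpnil]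
  · rw [← hW', hfinal, ← Submodule.map_comp]
    rfl

/-- Schubert coordinates are determined by the subspace. -/
theorem schubertCoord_unique (hs : IsHorizontalStrip lam nu C) {a a' : ℕ → ℕ → ℂ}
    (ha : IsSchubertCoord C a) (ha' : IsSchubertCoord C a')
    (h : (perp (coordSpan lam C)).map (shear lam ha).toLinearMap =
      (perp (coordSpan lam C)).map (shear lam ha').toLinearMap) : a = a' := by
  funext c l
  by_cases hcl : c ∈ C ∧ l ∉ C ∧ l < c
  swap
  · rw [ha c l hcl, ha' c l hcl]
  have hdisj : Disjoint ((perp (coordSpan lam C)).map (shear lam ha).toLinearMap)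
      (coordSpan lam C) := by
    refine Submodule.disjoint_def.2 ?_
    rintro _ ⟨y, hy, rfl⟩ hz
    have hfix : ∀ z ∈ coordSpan lam C, rowOp lam a z = z := by
      intro z hz
      have : coordSpan lam C ≤ LinearMap.eqLocus (rowOp lam a) LinearMap.id :=
        coordSpan_le_iff.2 fun c hc => rowOp_boxVec_of_mem ha 0 hc
      exact this hz
    have h1 := hfix _ hz
    rw [LinearEquiv.coe_coe, ← shear_symm_apply ha, LinearEquiv.symm_apply_apply] at h1
    rw [LinearEquiv.coe_coe, ← h1] at hz
    have h2 := Submodule.disjoint_def.1 (isCompl_perp_coordSpan C).disjoint y hy hz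
    rw [h2, map_zero]
  have h1 : shear lam ha (boxVec lam 0 l) ∈
      (perp (coordSpan lam C)).map (shear lam ha).toLinearMap :=
    ⟨_, boxVec_mem_perp_coordSpan hcl.2.1, rfl⟩
  have h2 : shear lam ha' (boxVec lam 0 l) ∈
      (perp (coordSpan lam C)).map (shear lam ha).toLinearMap := by
    rw [h]
    exact ⟨_, boxVec_mem_perp_coordSpan hcl.2.1, rfl⟩
  have h3 := Submodule.sub_mem _ h2 h1
  rw [shear_boxVec, shear_boxVec, sub_sub_sub_cancel_left] at h3
  have hmem : ∀ {a : ℕ → ℕ → ℂ}, IsSchubertCoord C a →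
      ∑ c ∈ Finset.range (lam.rowLen 0), a c l • boxVec lam 0 c ∈ coordSpan lam C := by
    intro a ha
    refine Submodule.sum_mem _ fun c' _ => ?_
    by_cases hc' : c' ∈ C
    · exact Submodule.smul_mem _ _ (boxVec_mem_coordSpan hc')
    · rw [ha c' l fun h => hc' h.1, zero_smul]
      exact Submodule.zero_mem _
  have h4 := Submodule.disjoint_def.1 hdisj _ h3 (Submodule.sub_mem _ (hmem ha) (hmem ha'))
  exact coeff_eq_of_sum_eq (sub_eq_zero.1 h4) (hs.lt_rowLen hcl.1)

end

end

noncomputable section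

/-! ### Removing the largest entry of a tableau -/

section Tableaux
variable {lam : YoungDiagram} {n : ℕ}

/-- `S` is a semistandard tableau of content `μ`, with all entries among `1, …, n`. -/
structure IsStd (μ : Fin n → ℕ) (S : SemistandardYoungTableau lam) : Prop where
  mem : S ∈ Std lam μ
  entry : ∀ b ∈ lam.cells, 1 ≤ S b.1 b.2 ∧ S b.1 b.2 ≤ n

theorem sum_card_filter (S : SemistandardYoungTableau lam) {μ : Fin n → ℕ} (hS : S ∈ Std lam μ) :
    (lam.cells.filter fun b => 1 ≤ S b.1 b.2 ∧ S b.1 b.2 ≤ n).card = ∑ i, μ i := by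
  have h : (lam.cells.filter fun b => 1 ≤ S b.1 b.2 ∧ S b.1 b.2 ≤ n) =
      Finset.univ.biUnion fun i : Fin n => lam.cells.filter fun b => S b.1 b.2 = (i : ℕ) + 1 := by
    ext b
    simp only [Finset.mem_filter, Finset.mem_biUnion, Finset.mem_univ, true_and]
    constructor
    · rintro ⟨hb, h1, h2⟩
      exact ⟨⟨S b.1 b.2 - 1, by omega⟩, hb, by simp only; omega⟩
    · rintro ⟨i, hb, h⟩
      exact ⟨hb, by omega, by omega⟩
  rw [h, Finset.card_biUnion]
  · exact Finset.sum_congr rfl fun i _ => hS i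
  · intro i _ j _ hij
    rw [Function.onFun, Finset.disjoint_filter]
    intro b _ h1 h2
    exact hij (Fin.ext (by omega))

theorem isStd_of_mem_std {μ : Fin n → ℕ} {S : SemistandardYoungTableau lam} (hS : S ∈ Std lam μ)
    (hμ : ∑ i, μ i = lam.card) : IsStd μ S := by
  refine ⟨hS, fun b hb => ?_⟩
  have h := sum_card_filter S hS
  rw [hμ] at h
  have := Finset.eq_of_subset_of_card_le (Finset.filter_subset _ lam.cells) h.ge
  exact (Finset.mem_filter.1 (this.ge hb)).2

theorem IsStd.sum_eq {μ : Fin n → ℕ} {S : SemistandardYoungTableau lam} (hS : IsStd μ S) :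
    ∑ i, μ i = Fintype.card lam.cells := by
  rw [← sum_card_filter S hS.mem, Finset.filter_true_of_mem hS.entry, Fintype.card_coe]

theorem mem_subshape {S : SemistandardYoungTableau lam} {j i c : ℕ} :
    (i, c) ∈ subshape S j ↔ (i, c) ∈ lam ∧ S i c ≤ j :=
  Finset.mem_filter

theorem IsStd.subshape_eq {μ : Fin n → ℕ} {S : SemistandardYoungTableau lam} (hS : IsStd μ S) :
    subshape S n = lam := by
  ext ⟨i, c⟩
  exact mem_subshape.trans ⟨fun h => h.1, fun h => ⟨h, (hS.entry _ h).2⟩⟩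

theorem restrict_apply {S : SemistandardYoungTableau lam} {j i c : ℕ}
    (h : (i, c) ∈ subshape S j) : restrict S j i c = S i c :=
  if_pos h

theorem subshape_restrict (S : SemistandardYoungTableau lam) {j m : ℕ} (h : j ≤ m) :
    subshape (restrict S m) j = subshape S j := by
  ext ⟨i, c⟩
  refine mem_subshape.trans (Iff.trans ?_ mem_subshape.symm)
  constructor
  · rintro ⟨h1, h2⟩
    rw [restrict_apply h1] at h2
    exact ⟨(mem_subshape.1 h1).1, h2⟩
  · rintro ⟨h1, h2⟩
    have h3 : (i, c) ∈ subshape S m := mem_subshape.2 ⟨h1, h2.trans h⟩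
    exact ⟨h3, by rwa [restrict_apply h3]⟩

variable {μ : Fin (n + 1) → ℕ} {S : SemistandardYoungTableau lam}

theorem IsStd.restrict (hS : IsStd μ S) :
    IsStd (fun i : Fin n => μ i.castSucc) (restrict S n) := by
  refine ⟨fun i => ?_, ?_⟩
  · rw [← hS.mem i.castSucc]
    congr 1
    ext ⟨a, c⟩
    simp only [Finset.mem_filter, Fin.val_castSucc]
    constructor
    · rintro ⟨h1, h2⟩
      rw [restrict_apply h1] at h2
      exact ⟨(mem_subshape.1 h1).1, h2⟩
    · rintro ⟨h1, h2⟩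
      have h3 : (a, c) ∈ subshape S n := mem_subshape.2 ⟨h1, by omega⟩
      exact ⟨h3, by rwa [restrict_apply h3]⟩
  · rintro ⟨a, c⟩ hb
    rw [restrict_apply hb]
    exact ⟨(hS.entry _ (mem_subshape.1 hb).1).1, (mem_subshape.1 hb).2⟩

theorem IsStd.isHorizontalStrip (hS : IsStd μ S) :
    IsHorizontalStrip lam (subshape S n) (columnsWith S (n + 1)) := by
  refine ⟨?_, ?_, ?_⟩
  · rintro c ⟨i, hi, -⟩
    exact lam.up_left_mem (Nat.zero_le _) le_rfl hi
  · rintro i c ⟨i', hi', hS'⟩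
    rw [mem_subshape]
    constructor
    · rintro ⟨h1, h2⟩
      have : i < i' := by
        by_contra hlt
        have := S.col_weak (not_lt.1 hlt) h1
        omega
      exact lam.up_left_mem this le_rfl hi'
    · intro h
      have h1 := S.col_strict (Nat.lt_succ_self i) h
      have h2 := (hS.entry _ h).2
      simp only [Nat.succ_eq_add_one] at h1 h2
      exact ⟨lam.up_left_mem (Nat.le_succ i) le_rfl h, by omega⟩
  · intro i c hc
    rw [mem_subshape]
    refine ⟨fun h => h.1, fun h => ⟨h, ?_⟩⟩
    have h2 := (hS.entry _ h).2
    have h3 : S i c ≠ n + 1 := fun h3 => hc ⟨i, h, h3⟩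
    simp only at h2
    omega

/-- An enumeration of the columns that contain the largest entry. -/
theorem IsStd.exists_columns (hS : IsStd μ S) :
    ∃ col : Fin (μ (Fin.last n)) → ℕ, Set.range col = columnsWith S (n + 1) := by
  have hcard := hS.mem (Fin.last n)
  rw [Fin.val_last] at hcard
  refine ⟨fun a => ((lam.cells.filter fun b => S b.1 b.2 = n + 1).equivFinOfCardEq hcard).symm a
    |>.1.2, ?_⟩
  ext c
  constructor
  · rintro ⟨a, rfl⟩
    have := (((lam.cells.filter fun b => S b.1 b.2 = n + 1).equivFinOfCardEq hcard).symm a).2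
    rw [Finset.mem_filter] at this
    exact ⟨_, this.1, this.2⟩
  · rintro ⟨i, hi, hS'⟩
    refine ⟨(lam.cells.filter fun b => S b.1 b.2 = n + 1).equivFinOfCardEq hcard
      ⟨(i, c), Finset.mem_filter.2 ⟨hi, hS'⟩⟩, ?_⟩
    simp

end Tableaux

/-! ### Extending a flag by one step -/

theorem finrank_map_of_injective {V V' : Type} [AddCommGroup V] [Module ℂ V] [AddCommGroup V']
    [Module ℂ V'] {f : V →ₗ[ℂ] V'} (hf : Function.Injective f) (W : Submodule ℂ V) :
    Module.finrank ℂ (W.map f) = Module.finrank ℂ W :=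
  (W.equivMapOfInjective f hf).finrank_eq.symm

section Ext
variable {n : ℕ} {μ : Fin (n + 1) → ℕ} {ι ι' : Type}

section Vec

/-- A frame of an extension of a flag by one step: the image under `E` of a frame of the flag,
followed by the block `b`. -/
def extVec (E : (ι' → ℂ) →ₗ[ℂ] (ι → ℂ)) (b : Fin (μ (Fin.last n)) → ι → ℂ)
    (v : (Σ i : Fin n, Fin (μ i.castSucc)) → ι' → ℂ) (p : Σ i : Fin (n + 1), Fin (μ i)) : ι → ℂ :=
  Fin.lastCases (motive := fun i => Fin (μ i) → ι → ℂ) b (fun i a => E (v ⟨i, a⟩)) p.1 p.2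

variable {E : (ι' → ℂ) →ₗ[ℂ] (ι → ℂ)} (b : Fin (μ (Fin.last n)) → ι → ℂ)
  (v : (Σ i : Fin n, Fin (μ i.castSucc)) → ι' → ℂ)

theorem extVec_castSucc (i : Fin n) (a : Fin (μ i.castSucc)) :
    extVec E b v ⟨i.castSucc, a⟩ = E (v ⟨i, a⟩) := by
  simp [extVec]

theorem extVec_last (a : Fin (μ (Fin.last n))) : extVec E b v ⟨Fin.last n, a⟩ = b a := by
  simp [extVec]

variable {b v}

theorem span_range_extVec (hv : Submodule.span ℂ (Set.range v) = ⊤)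
    (htop : LinearMap.range E ⊔ Submodule.span ℂ (Set.range b) = ⊤) :
    Submodule.span ℂ (Set.range (extVec E b v)) = ⊤ := by
  rw [eq_top_iff, ← htop]
  refine sup_le ?_ ?_
  · rw [← Submodule.map_top, ← hv, ← Submodule.span_image, Submodule.span_le]
    rintro _ ⟨_, ⟨⟨i, a⟩, rfl⟩, rfl⟩
    exact Submodule.subset_span ⟨⟨i.castSucc, a⟩, extVec_castSucc b v i a⟩
  · rw [Submodule.span_le]
    rintro _ ⟨a, rfl⟩
    exact Submodule.subset_span ⟨⟨Fin.last n, a⟩, extVec_last b v a⟩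

end Vec

variable [Fintype ι] [Fintype ι']

/-- The flag `V`, without its last space, is the image of the flag `V'` under `E`. -/
def IsExt (E : (ι' → ℂ) →ₗ[ℂ] (ι → ℂ)) (V' : PartialFlag (fun i : Fin n => μ i.castSucc) ι')
    (V : PartialFlag μ ι) : Prop :=
  ∀ i : Fin (n + 1), V.space i.castSucc = (V'.space i).map E

variable {E : (ι' → ℂ) →ₗ[ℂ] (ι → ℂ)} {V' W' : PartialFlag (fun i : Fin n => μ i.castSucc) ι'}
  {V W : PartialFlag μ ι}

theorem IsExt.range_eq (h : IsExt E V' V) : V.space (Fin.last n).castSucc = LinearMap.range E := by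
  rw [h, V'.space_last, Submodule.map_top]

theorem IsExt.right_unique (h : IsExt E V' V) (h' : IsExt E V' W) : V = W := by
  refine PartialFlag.ext (funext fun j => ?_)
  induction j using Fin.lastCases with
  | last => rw [V.space_last, W.space_last]
  | cast i => rw [h, h']

theorem IsExt.left_unique (hE : Function.Injective E) (h : IsExt E V' V) (h' : IsExt E W' V) :
    V' = W' := by
  refine PartialFlag.ext (funext fun j => ?_)
  exact Submodule.map_injective_of_injective hE ((h j).symm.trans (h' j))

theorem exists_isExt (hE : Function.Injective E)
    (hV : V.space (Fin.last n).castSucc = LinearMap.range E) :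
    ∃ V' : PartialFlag (fun i : Fin n => μ i.castSucc) ι', IsExt E V' V := by
  have hmap : ∀ i : Fin (n + 1), ((V.space i.castSucc).comap E).map E = V.space i.castSucc := by
    intro i
    rw [Submodule.map_comap_eq, inf_eq_right, ← hV]
    exact V.mono (Fin.castSucc_le_castSucc_iff.2 (Fin.le_last i))
  refine ⟨⟨fun i => (V.space i.castSucc).comap E, ?_, ?_, ?_, ?_⟩, fun i => (hmap i).symm⟩
  · rw [Fin.castSucc_zero, V.space_zero, Submodule.comap_bot, LinearMap.ker_eq_bot.2 hE]
  · rw [hV, eq_top_iff]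
    exact fun x _ => ⟨x, rfl⟩
  · exact fun i j hij => Submodule.comap_mono (V.mono (Fin.castSucc_le_castSucc_iff.2 hij))
  · intro i
    have h : ∀ i : Fin (n + 1), Module.finrank ℂ ((V.space i.castSucc).comap E) =
        Module.finrank ℂ (V.space i.castSucc) := fun i => by
      rw [← finrank_map_of_injective hE, hmap]
    rw [h, h, ← Fin.succ_castSucc, V.finrank_succ]

theorem isExt_flag {v : Frame (fun i : Fin n => μ i.castSucc) ι'} {w : Frame μ ι}
    (hw : ∀ i a, w.vec ⟨Fin.castSucc i, a⟩ = E (v.vec ⟨i, a⟩)) : IsExt E v.flag w.flag := by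
  intro i
  change Submodule.span ℂ _ = (Submodule.span ℂ _).map E
  rw [← Submodule.span_image, Set.image_image]
  congr 1
  ext x
  constructor
  · rintro ⟨⟨j, a⟩, hj, rfl⟩
    have hj' : j < i := Fin.castSucc_lt_castSucc_iff.1 hj
    induction j using Fin.lastCases with
    | last => exact absurd (Fin.le_last i) hj'.not_ge
    | cast j => exact ⟨⟨j, a⟩, hj', (hw j a).symm⟩
  · rintro ⟨⟨j, a⟩, hj, rfl⟩
    exact ⟨⟨j.castSucc, a⟩, Fin.castSucc_lt_castSucc_iff.2 hj, hw j a⟩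

end Ext

/-! ### Spaltenstein varieties, Jordan types and ranks -/

section Fibers
variable {lam nu : YoungDiagram}

/-- `E` is injective, intertwines the nilpotent endomorphisms, and its image contains the image of
`x^λ`. -/
structure IsAdmissible (E : BoxSpace nu →ₗ[ℂ] BoxSpace lam) : Prop where
  injective : Function.Injective E
  nil : ∀ y, E (nil nu y) = nil lam (E y)
  range_le : LinearMap.range (Spaltenstein.nil lam) ≤ LinearMap.range E

theorem IsAdmissible.comp_equiv {E : BoxSpace nu →ₗ[ℂ] BoxSpace lam} (hE : IsAdmissible E)
    {z : BoxSpace lam ≃ₗ[ℂ] BoxSpace lam}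
    (hz : ∀ y, z (Spaltenstein.nil lam y) = Spaltenstein.nil lam (z y)) :
    IsAdmissible (z.toLinearMap ∘ₗ E) := by
  refine ⟨z.injective.comp hE.injective, fun y => by simp [hE.nil, hz], ?_⟩
  rintro _ ⟨y, rfl⟩
  obtain ⟨x, hx⟩ := hE.range_le ⟨z.symm y, rfl⟩
  exact ⟨x, by simp [hx, hz]⟩

theorem isAdmissible_of_range_eq {E : BoxSpace nu →ₗ[ℂ] BoxSpace lam} {C : Set ℕ}
    (h1 : Function.Injective E) (h2 : LinearMap.range E = perp (coordSpan lam C))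
    (h3 : ∀ y, E (Spaltenstein.nil nu y) = Spaltenstein.nil lam (E y)) : IsAdmissible E :=
  ⟨h1, h3, h2 ▸ range_nil_le_perp_coordSpan C⟩

theorem IsAdmissible.comp_nil_pow {E : BoxSpace nu →ₗ[ℂ] BoxSpace lam} (hE : IsAdmissible E)
    (k : ℕ) : E ∘ₗ (Spaltenstein.nil nu ^ k) = (Spaltenstein.nil lam ^ k) ∘ₗ E := by
  refine LinearMap.ext fun y => ?_
  induction k with
  | zero => simp
  | succ k ih =>
    simp only [LinearMap.comp_apply] at ih ⊢
    rw [pow_succ', pow_succ', Module.End.mul_apply, Module.End.mul_apply, ← ih, hE.nil]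

theorem IsAdmissible.finrank_map {E : BoxSpace nu →ₗ[ℂ] BoxSpace lam} (hE : IsAdmissible E)
    (k : ℕ) (W : Submodule ℂ (BoxSpace nu)) :
    Module.finrank ℂ ((W.map E).map (Spaltenstein.nil lam ^ k)) =
      Module.finrank ℂ (W.map (Spaltenstein.nil nu ^ k)) := by
  rw [← Submodule.map_comp, ← hE.comp_nil_pow, Submodule.map_comp,
    finrank_map_of_injective hE.injective]

theorem IsAdmissible.hasJordanType_iff {E : BoxSpace nu →ₗ[ℂ] BoxSpace lam} (hE : IsAdmissible E)
    (W : Submodule ℂ (BoxSpace nu)) (ka : YoungDiagram) :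
    HasJordanTypeTranspose (Spaltenstein.nil lam) (W.map E) ka ↔
      HasJordanTypeTranspose (Spaltenstein.nil nu) W ka := by
  let f := W.equivMapOfInjective E hE.injective
  have hf : ∀ w, (f w : BoxSpace lam) = E w := fun w => rfl
  constructor
  · rintro ⟨e, he⟩
    refine ⟨e.trans f.symm, fun v => hE.injective ?_⟩
    rw [hE.nil, ← hf, ← hf]
    simp [he]
  · rintro ⟨e, he⟩
    refine ⟨e.trans f, fun v => ?_⟩
    rw [LinearEquiv.trans_apply, LinearEquiv.trans_apply, hf, hf, he, hE.nil]

theorem hasJordanType_top : HasJordanTypeTranspose (nil lam) ⊤ lam :=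
  ⟨(LinearEquiv.ofTop ⊤ rfl).symm, fun _ => rfl⟩

theorem HasJordanTypeTranspose.finrank_map {W : Submodule ℂ (BoxSpace lam)} {ka : YoungDiagram}
    (h : HasJordanTypeTranspose (nil lam) W ka) (k : ℕ) :
    Module.finrank ℂ (W.map (nil lam ^ k)) =
      Module.finrank ℂ (LinearMap.range (nil ka ^ k)) := by
  obtain ⟨e, he⟩ := h
  let f : BoxSpace ka →ₗ[ℂ] BoxSpace lam := W.subtype ∘ₗ e.toLinearMap
  have hf : Function.Injective f := W.subtype_injective.comp e.injective
  have hcomm : f ∘ₗ (nil ka ^ k) = (nil lam ^ k) ∘ₗ f := by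
    refine LinearMap.ext fun y => ?_
    induction k with
    | zero => simp
    | succ k ih =>
      simp only [LinearMap.comp_apply] at ih ⊢
      rw [pow_succ', pow_succ', Module.End.mul_apply, Module.End.mul_apply, ← ih]
      exact he _
  have hrange : LinearMap.range f = W := by
    rw [LinearMap.range_comp, LinearEquiv.range, Submodule.map_subtype_top]
  rw [← hrange, ← LinearMap.range_comp, ← hcomm, LinearMap.range_comp,
    finrank_map_of_injective hf]

variable {n : ℕ}

/-- The points of the Spaltenstein variety where the powers of `x^λ` have the ranks on the spaces of
the flag which the tableau prescribes. -/
def rankFiber (μ : Fin n → ℕ) (S : SemistandardYoungTableau lam) : Set (PartialFlag μ lam.cells) :=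
  {V | V ∈ spaltenstein lam μ ∧ ∀ (j : Fin (n + 1)) (k : ℕ),
    Module.finrank ℂ ((V.space j).map (nil lam ^ k)) =
      Module.finrank ℂ (LinearMap.range (nil (subshape S j) ^ k))}

theorem jordanFiber_subset_rankFiber (μ : Fin n → ℕ) (S : SemistandardYoungTableau lam) :
    jordanFiber μ S ⊆ rankFiber μ S :=
  fun _ hV => ⟨hV.1, fun j k => (hV.2 j).finrank_map k⟩

variable {μ : Fin (n + 1) → ℕ} {S : SemistandardYoungTableau lam}

section
variable {E : BoxSpace nu →ₗ[ℂ] BoxSpace lam} {V : PartialFlag μ lam.cells}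
  {V' : PartialFlag (fun i : Fin n => μ i.castSucc) nu.cells}

theorem IsExt.mem_spaltenstein_iff (hE : IsAdmissible E) (h : IsExt E V' V) :
    V ∈ spaltenstein lam μ ↔ V' ∈ spaltenstein nu fun i : Fin n => μ i.castSucc := by
  have hcomm : nil lam ∘ₗ E = E ∘ₗ nil nu := LinearMap.ext fun y => (hE.nil y).symm
  have hi : ∀ i : Fin n, (V.space i.castSucc.succ).map (nil lam) ≤ V.space i.castSucc.castSucc ↔
      (V'.space i.succ).map (nil nu) ≤ V'.space i.castSucc := by
    intro i
    rw [Fin.succ_castSucc, h, h, ← Submodule.map_comp, hcomm, Submodule.map_comp,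
      Submodule.map_le_map_iff_of_injective hE.injective]
  constructor
  · exact fun hV i => (hi i).1 (hV i.castSucc)
  · intro hV i
    induction i using Fin.lastCases with
    | last =>
      rw [Fin.succ_last, V.space_last, Submodule.map_top, h.range_eq]
      exact hE.range_le
    | cast i => exact (hi i).2 (hV i)

end

section
variable {E : BoxSpace (subshape S n) →ₗ[ℂ] BoxSpace lam} {V : PartialFlag μ lam.cells}
  {V' : PartialFlag (fun i : Fin n => μ i.castSucc) (subshape S n).cells}

theorem IsExt.mem_rankFiber (hE : IsAdmissible E) (h : IsExt E V' V) (hV : V ∈ rankFiber μ S) :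
    V' ∈ rankFiber (fun i : Fin n => μ i.castSucc) (restrict S n) := by
  refine ⟨(h.mem_spaltenstein_iff hE).1 hV.1, fun j k => ?_⟩
  rw [← hE.finrank_map, ← h, hV.2, subshape_restrict S (Nat.lt_succ_iff.1 j.2)]
  rfl

theorem IsExt.mem_jordanFiber_iff (hS : IsStd μ S) (hE : IsAdmissible E) (h : IsExt E V' V) :
    V ∈ jordanFiber μ S ↔
      V' ∈ jordanFiber (fun i : Fin n => μ i.castSucc) (restrict S n) := by
  refine and_congr (h.mem_spaltenstein_iff hE) ?_
  have hj : ∀ j : Fin (n + 1),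
      HasJordanTypeTranspose (nil lam) (V.space j.castSucc) (subshape S j.castSucc) ↔
      HasJordanTypeTranspose (nil (subshape S n)) (V'.space j) (subshape (restrict S n) j) := by
    intro j
    rw [h, hE.hasJordanType_iff, subshape_restrict S (Nat.lt_succ_iff.1 j.2), Fin.val_castSucc]
  constructor
  · exact fun hV j => (hj j).1 (hV j.castSucc)
  · intro hV j
    induction j using Fin.lastCases with
    | last =>
      rw [V.space_last, Fin.val_last, hS.subshape_eq]
      exact hasJordanType_top
    | cast j => exact (hj j).2 (hV j)

end

/-- The ranks on the largest proper space of the flag are those on `⟨f_c : c ∈ C⟩^⊥`. -/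
theorem sameRanks_of_mem_rankFiber (hS : IsStd μ S) {V : PartialFlag μ lam.cells}
    (hV : V ∈ rankFiber μ S) :
    SameRanks (columnsWith S (n + 1)) (V.space (Fin.last n).castSucc) := by
  obtain ⟨e, h1, h2, h3⟩ := hS.isHorizontalStrip.exists_embedding
  have he := isAdmissible_of_range_eq h1 h2 h3
  refine ⟨?_, fun k => ?_⟩
  · have := hV.1 (Fin.last n)
    rwa [Fin.succ_last, V.space_last, Submodule.map_top] at this
  · rw [hV.2, ← h2, ← Submodule.map_top, ← Submodule.map_top, he.finrank_map]
    rfl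

theorem exists_isExt_of_mem_rankFiber (hS : IsStd μ S) {V : PartialFlag μ lam.cells}
    (hV : V ∈ rankFiber μ S) {e : BoxSpace (subshape S n) →ₗ[ℂ] BoxSpace lam}
    (he : IsAdmissible e)
    (hrange : LinearMap.range e = perp (coordSpan lam (columnsWith S (n + 1)))) :
    ∃ (z : BoxSpace lam ≃ₗ[ℂ] BoxSpace lam)
      (V' : PartialFlag (fun i : Fin n => μ i.castSucc) (subshape S n).cells),
      (∀ y, z (nil lam y) = nil lam (z y)) ∧ IsExt (z.toLinearMap ∘ₗ e) V' V := by
  obtain ⟨z, hz, hW⟩ := (sameRanks_of_mem_rankFiber hS hV).exists_equiv hS.isHorizontalStrip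
  have hE := he.comp_equiv hz
  obtain ⟨V', hV'⟩ := exists_isExt hE.injective (V := V)
    (by rw [hW, LinearMap.range_comp, hrange])
  exact ⟨z, V', hz, hV'⟩

/-- The Jordan types along the flag are determined by ranks. By transitivity the space `V_{n-1}` is
conjugate to `⟨f_c : c ∈ C⟩^⊥`, on which `x^λ` has the prescribed type. -/
theorem rankFiber_eq_jordanFiber {n : ℕ} (μ : Fin n → ℕ) {lam : YoungDiagram}
    {S : SemistandardYoungTableau lam} (hS : IsStd μ S) : rankFiber μ S = jordanFiber μ S := by
  refine Set.Subset.antisymm ?_ (jordanFiber_subset_rankFiber μ S)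
  induction n generalizing lam with
  | zero =>
    intro V hV
    refine ⟨hV.1, fun j => ?_⟩
    rw [show j = Fin.last 0 from Fin.ext (by omega), V.space_last, Fin.val_last, hS.subshape_eq]
    exact hasJordanType_top
  | succ n ih =>
    intro V hV
    obtain ⟨e, h1, h2, h3⟩ := hS.isHorizontalStrip.exists_embedding
    have he := isAdmissible_of_range_eq h1 h2 h3
    obtain ⟨z, V', hz, hV'⟩ := exists_isExt_of_mem_rankFiber hS hV he h2
    have hE := he.comp_equiv hz
    exact (hV'.mem_jordanFiber_iff hS hE).2 (ih _ hS.restrict (hV'.mem_rankFiber hE hV))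

end Fibers

end

noncomputable section

/-! ### Paving cells as families of extensions -/

section Paving
variable {lam : YoungDiagram} {n : ℕ}

theorem IsPavingCell.subset_spaltenstein {μ : Fin n → ℕ} {S : SemistandardYoungTableau lam}
    {Y : Set (PartialFlag μ lam.cells)} (h : IsPavingCell μ S Y) : Y ⊆ spaltenstein lam μ := by
  cases n with
  | zero => exact h.subset
  | succ n =>
    obtain ⟨θ, Ybar, -, -, rfl⟩ := h
    exact fun V hV => hV.1

theorem rowOp_rowOp_neg {C : Set ℕ} {a : ℕ → ℕ → ℂ} (ha : IsSchubertCoord C a)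
    (y : BoxSpace lam) : rowOp lam a (rowOp lam (-a) y) = y :=
  (shear lam ha).symm_apply_apply y

theorem rowOp_neg_rowOp_apply {C : Set ℕ} {a : ℕ → ℕ → ℂ} (ha : IsSchubertCoord C a)
    (y : BoxSpace lam) : rowOp lam (-a) (rowOp lam a y) = y :=
  (shear lam ha).apply_symm_apply y

theorem dotProduct_rowOp (a : ℕ → ℕ → ℂ) (x y : BoxSpace lam) :
    x ⬝ᵥ rowOp lam a y = Matrix.toLin' (schubertMatrix lam a) x ⬝ᵥ y := by
  rw [rowOp, Matrix.toLin'_apply, Matrix.toLin'_apply, Matrix.dotProduct_mulVec,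
    Matrix.vecMul_transpose]

theorem schubertMatrix_neg_apply {C : Set ℕ} {a : ℕ → ℕ → ℂ} (ha : IsSchubertCoord C a)
    (y : BoxSpace lam) : Matrix.toLin' (schubertMatrix lam a)
      (Matrix.toLin' (schubertMatrix lam (-a)) y) = y := by
  refine dotProduct_eq _ _ fun x => ?_
  rw [← dotProduct_rowOp, ← dotProduct_rowOp, rowOp_neg_rowOp_apply ha]

variable {μ : Fin (n + 1) → ℕ} {S : SemistandardYoungTableau lam}

/-- The flags that extend a flag in `Y'` by means of `g(U)⁻ᵀ ∘ e`, for some point `U` of the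
Schubert cell of `C`. If `U` has the coordinates `a`, then `g(U)⁻ᵀ` is `rowOp lam (-a)`. -/
def cellOver {nu : YoungDiagram} (C : Set ℕ) (e : BoxSpace nu →ₗ[ℂ] BoxSpace lam)
    (Y' : Set (PartialFlag (fun i : Fin n => μ i.castSucc) nu.cells)) :
    Set (PartialFlag μ lam.cells) :=
  {V | ∃ a : ℕ → ℕ → ℂ, IsSchubertCoord C a ∧ ∃ V' ∈ Y', IsExt (rowOp lam (-a) ∘ₗ e) V' V}

theorem isAdmissible_rowOp {nu : YoungDiagram} {C : Set ℕ} {e : BoxSpace nu →ₗ[ℂ] BoxSpace lam}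
    (he : IsAdmissible e) {a : ℕ → ℕ → ℂ} (ha : IsSchubertCoord C a) :
    IsAdmissible (rowOp lam (-a) ∘ₗ e) :=
  he.comp_equiv (shear_nil ha)

/-- The conditions of the definition of a paving cell on `V_{n-1}^⊥` and on the reduced flag say
that `V` is an extension of the reduced flag by `g(U)⁻ᵀ ∘ θ⁻¹`. -/
theorem paving_condition_iff {nu : YoungDiagram} {C : Set ℕ}
    {e : BoxSpace nu →ₗ[ℂ] BoxSpace lam}
    (θ : perp (coordSpan lam C) ≃ₗ[ℂ] BoxSpace nu)
    (hθ : ∀ y, (θ.symm y : BoxSpace lam) = e y) {a : ℕ → ℕ → ℂ} (ha : IsSchubertCoord C a)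
    (V : PartialFlag μ lam.cells) (V' : PartialFlag (fun i : Fin n => μ i.castSucc) nu.cells) :
    (perp (V.space (Fin.last n).castSucc) =
        (coordSpan lam C).map (Matrix.toLin' (schubertMatrix lam a)) ∧
      ∀ i : Fin (n + 1), V'.space i = (((V.space i.castSucc).map
        (Matrix.toLin' (schubertMatrix lam a).transpose)).comap
          (perp (coordSpan lam C)).subtype).map θ.toLinearMap) ↔
    IsExt (rowOp lam (-a) ∘ₗ e) V' V := by
  have hθe : ∀ W : Submodule ℂ (perp (coordSpan lam C)),
      (W.map θ.toLinearMap).map e = W.map (perp (coordSpan lam C)).subtype := by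
    intro W
    rw [← Submodule.map_comp]
    congr 1
    refine LinearMap.ext fun y => ?_
    rw [LinearMap.comp_apply, ← hθ]
    simp
  have hrange : LinearMap.range e = perp (coordSpan lam C) := by
    have := hθe ⊤
    rwa [Submodule.map_top, LinearEquiv.range, Submodule.map_top, Submodule.map_subtype_top]
      at this
  have hneg : ∀ W : Submodule ℂ (BoxSpace lam), (W.map (rowOp lam a)).map (rowOp lam (-a)) = W := by
    intro W
    rw [← Submodule.map_comp, rowOp_neg_rowOp ha, Submodule.map_id]
  constructor
  · rintro ⟨hperp, hV'⟩ i
    have hle : (V.space i.castSucc).map (rowOp lam a) ≤ perp (coordSpan lam C) := by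
      rintro _ ⟨y, hy, rfl⟩ u hu
      have hy' : y ∈ V.space (Fin.last n).castSucc :=
        V.mono (Fin.castSucc_le_castSucc_iff.2 (Fin.le_last i)) hy
      have hgu : Matrix.toLin' (schubertMatrix lam a) u ∈
          perp (V.space (Fin.last n).castSucc) := by
        rw [hperp]
        exact ⟨u, hu, rfl⟩
      rw [dotProduct_rowOp, dotProduct_comm]
      exact hgu y hy'
    rw [hV' i, Submodule.map_comp, hθe, Submodule.map_comap_subtype]
    change _ = Submodule.map _ (_ ⊓ (V.space i.castSucc).map (rowOp lam a))
    rw [inf_eq_right.2 hle, hneg]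
  · intro h
    refine ⟨?_, fun i => ?_⟩
    · rw [h.range_eq, LinearMap.range_comp, hrange]
      refine Submodule.ext fun y => ?_
      have h1 : y ∈ perp ((perp (coordSpan lam C)).map (rowOp lam (-a))) ↔
          Matrix.toLin' (schubertMatrix lam (-a)) y ∈ perp (perp (coordSpan lam C)) := by
        constructor
        · intro hy u hu
          have := hy _ ⟨u, hu, rfl⟩
          rwa [dotProduct_comm, dotProduct_rowOp, dotProduct_comm] at this
        · rintro hy _ ⟨u, hu, rfl⟩
          rw [dotProduct_comm, dotProduct_rowOp, dotProduct_comm]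
          exact hy u hu
      rw [h1, perp_perp_coordSpan]
      constructor
      · exact fun hy => ⟨_, hy, schubertMatrix_neg_apply ha y⟩
      · rintro ⟨u, hu, rfl⟩
        have := schubertMatrix_neg_apply (lam := lam) ha.neg u
        rw [neg_neg] at this
        rwa [this]
    · rw [h i]
      change _ = ((((V'.space i).map (rowOp lam (-a) ∘ₗ e)).map (rowOp lam a)).comap _).map _
      rw [← Submodule.map_comp, ← LinearMap.comp_assoc]
      have : rowOp lam a ∘ₗ rowOp lam (-a) = LinearMap.id :=
        LinearMap.ext fun y => rowOp_rowOp_neg ha y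
      rw [this, LinearMap.id_comp]
      have he : (V'.space i).map e =
          ((V'.space i).map θ.symm.toLinearMap).map (perp (coordSpan lam C)).subtype := by
        rw [← Submodule.map_comp]
        congr 1
        exact LinearMap.ext fun y => (hθ y).symm
      rw [he, Submodule.comap_map_eq_of_injective (Submodule.subtype_injective _),
        ← Submodule.map_comp]
      simp

theorem paving_set_eq (S : SemistandardYoungTableau lam) {C : Set ℕ}
    {e : BoxSpace (subshape S n) →ₗ[ℂ] BoxSpace lam} (he : IsAdmissible e)
    (θ : perp (coordSpan lam C) ≃ₗ[ℂ] BoxSpace (subshape S n))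
    (hθ : ∀ y, (θ.symm y : BoxSpace lam) = e y)
    {Y' : Set (PartialFlag (fun i : Fin n => μ i.castSucc) (subshape S n).cells)}
    (hY' : IsPavingCell (fun i : Fin n => μ i.castSucc) (restrict S n) Y') :
    {V | V ∈ spaltenstein lam μ ∧ ∃ a : ℕ → ℕ → ℂ,
        IsSchubertCoord C a ∧
        perp (V.space (Fin.last n).castSucc) =
          (coordSpan lam C).map (Matrix.toLin' (schubertMatrix lam a)) ∧
        ∃ Vbar ∈ Y', ∀ i : Fin (n + 1), Vbar.space i =
          (((V.space i.castSucc).map (Matrix.toLin' (schubertMatrix lam a).transpose)).comap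
            (perp (coordSpan lam C)).subtype).map θ.toLinearMap} =
      cellOver C e Y' := by
  ext V
  constructor
  · rintro ⟨-, a, ha, h1, V', hV', h2⟩
    exact ⟨a, ha, V', hV', (paving_condition_iff θ hθ ha V V').1 ⟨h1, h2⟩⟩
  · rintro ⟨a, ha, V', hV', h⟩
    obtain ⟨h1, h2⟩ := (paving_condition_iff θ hθ ha V V').2 h
    exact ⟨(h.mem_spaltenstein_iff (isAdmissible_rowOp he ha)).2 (hY'.subset_spaltenstein hV'),
      a, ha, h1, V', hV', h2⟩

theorem isPavingCell_cellOver {e : BoxSpace (subshape S n) →ₗ[ℂ] BoxSpace lam}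
    (he : IsAdmissible e)
    (hrange : LinearMap.range e = perp (coordSpan lam (columnsWith S (n + 1))))
    {Y' : Set (PartialFlag (fun i : Fin n => μ i.castSucc) (subshape S n).cells)}
    (hY' : IsPavingCell (fun i : Fin n => μ i.castSucc) (restrict S n) Y') :
    IsPavingCell μ S (cellOver (columnsWith S (n + 1)) e Y') := by
  let θ := ((LinearEquiv.ofInjective e he.injective).trans (LinearEquiv.ofEq _ _ hrange)).symm
  have hθ : ∀ y, (θ.symm y : BoxSpace lam) = e y := fun y => rfl
  refine ⟨θ, Y', fun w w' h => ?_, hY', (paving_set_eq S he θ hθ hY').symm⟩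
  refine θ.symm.injective (Subtype.ext ?_)
  rw [LinearEquiv.symm_apply_apply, h, hθ, he.nil, ← hθ, LinearEquiv.symm_apply_apply]

theorem IsPavingCell.exists_eq_cellOver {Y : Set (PartialFlag μ lam.cells)}
    (h : IsPavingCell μ S Y) :
    ∃ (e : BoxSpace (subshape S n) →ₗ[ℂ] BoxSpace lam)
      (Y' : Set (PartialFlag (fun i : Fin n => μ i.castSucc) (subshape S n).cells)),
      IsAdmissible e ∧ LinearMap.range e = perp (coordSpan lam (columnsWith S (n + 1))) ∧
      IsPavingCell (fun i : Fin n => μ i.castSucc) (restrict S n) Y' ∧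
      Y = cellOver (columnsWith S (n + 1)) e Y' := by
  obtain ⟨θ, Y', hθ, hY', rfl⟩ := h
  let e : BoxSpace (subshape S n) →ₗ[ℂ] BoxSpace lam :=
    (perp (coordSpan lam (columnsWith S (n + 1)))).subtype ∘ₗ θ.symm.toLinearMap
  have hrange : LinearMap.range e = perp (coordSpan lam (columnsWith S (n + 1))) := by
    rw [LinearMap.range_comp, LinearEquiv.range, Submodule.map_subtype_top]
  have he : IsAdmissible e := by
    refine isAdmissible_of_range_eq
      ((Submodule.subtype_injective _).comp θ.symm.injective) hrange fun y => ?_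
    let w' : perp (coordSpan lam (columnsWith S (n + 1))) :=
      ⟨nil lam (θ.symm y), range_nil_le_perp_coordSpan _ ⟨_, rfl⟩⟩
    have := hθ (θ.symm y) w' rfl
    rw [LinearEquiv.apply_symm_apply] at this
    change (θ.symm (nil (subshape S n) y) : BoxSpace lam) = nil lam (θ.symm y)
    rw [← this, LinearEquiv.symm_apply_apply]
  exact ⟨e, Y', he, hrange, hY', paving_set_eq S he θ (fun _ => rfl) hY'⟩

theorem exists_isPavingCell {n : ℕ} {μ : Fin n → ℕ} {lam : YoungDiagram}
    {S : SemistandardYoungTableau lam} (hS : IsStd μ S) : ∃ Y, IsPavingCell μ S Y := by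
  induction n generalizing lam with
  | zero => exact ⟨_, rfl⟩
  | succ n ih =>
    obtain ⟨e, h1, h2, h3⟩ := hS.isHorizontalStrip.exists_embedding
    obtain ⟨Y', hY'⟩ := ih hS.restrict
    exact ⟨_, isPavingCell_cellOver (isAdmissible_of_range_eq h1 h2 h3) h2 hY'⟩

end Paving

end

noncomputable section

/-! ### Rational coordinates on the cells -/

section Alg
variable {X : Type} (A : Subalgebra ℂ (X → ℂ))

theorem linear_apply_mem {ι ι' : Type} [Fintype ι'] {L : X → (ι' → ℂ) →ₗ[ℂ] (ι → ℂ)}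
    {y : X → ι' → ℂ} {b : ι} (hL : ∀ y, (fun x => L x y b) ∈ A)
    (hy : ∀ b', (fun x => y x b') ∈ A) : (fun x => L x (y x) b) ∈ A := by
  classical
  have : (fun x => L x (y x) b) =
      ∑ i, (fun x => y x i) * fun x => L x (fun j => if i = j then 1 else 0) b := by
    funext x
    rw [LinearMap.pi_apply_eq_sum_univ]
    simp [Finset.sum_apply]
  rw [this]
  exact sum_mem fun i _ => mul_mem (hy i) (hL _)

theorem rowOp_apply_mem {lam : YoungDiagram} {a : X → ℕ → ℕ → ℂ}
    (ha : ∀ c l, (fun x => a x c l) ∈ A) (y : BoxSpace lam) (b : lam.cells) :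
    (fun x => rowOp lam (a x) y b) ∈ A := by
  have : (fun x => rowOp lam (a x) y b) =
      ∑ b', fun x => schubertMatrix lam (a x) b' b * y b' := by
    funext x
    simp [rowOp, Matrix.mulVec, dotProduct, Finset.sum_apply]
  rw [this]
  refine sum_mem fun b' _ => mul_mem ?_ (const_mem_subalgebra A (y b'))
  simp only [schubertMatrix, Matrix.of_apply]
  split_ifs
  · exact const_mem_subalgebra A 1
  · exact ha _ _
  · exact const_mem_subalgebra A 0

end Alg

section Step
variable {lam nu : YoungDiagram} {n : ℕ} {μ : Fin (n + 1) → ℕ} {C : Set ℕ}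

/-- The index set of the coordinates of the Schubert cell of `C`. -/
abbrev SchubertIndex (C : Set ℕ) : Type := {p : ℕ × ℕ // p.1 ∈ C ∧ p.2 ∉ C ∧ p.2 < p.1}

/-- The coordinates of a point of the Schubert cell, extended by zero to all pairs of columns. -/
def toSchubert (s : SchubertIndex C → ℂ) (c l : ℕ) : ℂ := by
  classical exact if h : c ∈ C ∧ l ∉ C ∧ l < c then s ⟨(c, l), h⟩ else 0

theorem isSchubertCoord_toSchubert (s : SchubertIndex C → ℂ) :
    IsSchubertCoord C (toSchubert s) :=
  fun _ _ h => dif_neg h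

theorem toSchubert_eq {a : ℕ → ℕ → ℂ} (ha : IsSchubertCoord C a) :
    toSchubert (C := C) (fun p => a p.1.1 p.1.2) = a := by
  funext c l
  by_cases h : c ∈ C ∧ l ∉ C ∧ l < c
  · exact dif_pos h
  · rw [ha c l h]
    exact dif_neg h

theorem toSchubert_injective : Function.Injective (toSchubert (C := C)) := by
  intro s s' h
  funext p
  have := congrFun (congrFun h p.1.1) p.1.2
  rwa [toSchubert, toSchubert, dif_pos p.2, dif_pos p.2] at this

variable {e : BoxSpace nu →ₗ[ℂ] BoxSpace lam} {col : Fin (μ (Fin.last n)) → ℕ}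

theorem coordSpan_eq_span_range (hcol : Set.range col = C) :
    coordSpan lam C = Submodule.span ℂ (Set.range fun a => boxVec lam 0 (col a)) := by
  refine le_antisymm (coordSpan_le_iff.2 fun c hc => ?_) (Submodule.span_le.2 ?_)
  · rw [← hcol] at hc
    obtain ⟨a, rfl⟩ := hc
    exact Submodule.subset_span ⟨a, rfl⟩
  · rintro _ ⟨a, rfl⟩
    exact boxVec_mem_coordSpan (hcol.subset ⟨a, rfl⟩)

/-- The frame obtained from a frame of a flag in the space of `nu`: its image under `z ∘ e`,
followed by the vectors `z f_c` for `c ∈ C`. -/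
def stepFrame (hrange : LinearMap.range e = perp (coordSpan lam C)) (hcol : Set.range col = C)
    (hμ : ∑ i, μ i = Fintype.card lam.cells) (z : BoxSpace lam ≃ₗ[ℂ] BoxSpace lam)
    (v : Frame (fun i : Fin n => μ i.castSucc) nu.cells) : Frame μ lam.cells :=
  Frame.ofSpan (extVec (z.toLinearMap ∘ₗ e) (fun a => z (boxVec lam 0 (col a))) v.vec)
    (span_range_extVec v.span_eq_top (by
      have h1 : Submodule.span ℂ (Set.range fun a => z (boxVec lam 0 (col a))) =
          (coordSpan lam C).map z.toLinearMap := by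
        rw [coordSpan_eq_span_range hcol, ← Submodule.span_image, ← Set.range_comp]
        rfl
      rw [h1, LinearMap.range_comp, hrange, ← Submodule.map_sup,
        (isCompl_perp_coordSpan C).sup_eq_top, Submodule.map_top, LinearEquiv.range])) hμ

variable {hrange : LinearMap.range e = perp (coordSpan lam C)} {hcol : Set.range col = C}
  {hμ : ∑ i, μ i = Fintype.card lam.cells}

theorem isExt_stepFrame (z : BoxSpace lam ≃ₗ[ℂ] BoxSpace lam)
    (v : Frame (fun i : Fin n => μ i.castSucc) nu.cells) :
    IsExt (z.toLinearMap ∘ₗ e) v.flag (stepFrame hrange hcol hμ z v).flag :=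
  isExt_flag fun i a => extVec_castSucc _ _ i a

theorem extVec_apply_mem {X : Type} (A : Subalgebra ℂ (X → ℂ))
    {z : X → BoxSpace lam →ₗ[ℂ] BoxSpace lam} (hz : ∀ y b, (fun x => z x y b) ∈ A)
    {v : X → (Σ i : Fin n, Fin (μ i.castSucc)) → BoxSpace nu}
    (hv : ∀ q b, (fun x => v x q b) ∈ A) (p : Σ i : Fin (n + 1), Fin (μ i)) (b : lam.cells) :
    (fun x => extVec (z x ∘ₗ e) (fun a => z x (boxVec lam 0 (col a))) (v x) p b) ∈ A := by
  obtain ⟨i, a⟩ := p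
  induction i using Fin.lastCases with
  | last =>
    simp only [extVec_last]
    exact hz _ b
  | cast i =>
    simp only [extVec_castSucc, LinearMap.comp_apply]
    exact linear_apply_mem (L := fun x => z x ∘ₗ e) A (fun y => hz (e y) b) (hv _)

/-! #### Cramer's rule -/

/-- The vectors of all but the last block of a frame, followed by the vectors `f_c` for `c ∈ C`. -/
def mixedVec (col : Fin (μ (Fin.last n)) → ℕ) (w : Frame μ lam.cells)
    (p : Σ i : Fin (n + 1), Fin (μ i)) : BoxSpace lam :=
  extVec LinearMap.id (fun a => boxVec lam 0 (col a))
    (fun q : Σ i : Fin n, Fin (μ i.castSucc) => w.vec ⟨q.1.castSucc, q.2⟩) p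

theorem mixedVec_castSucc (w : Frame μ lam.cells) (i : Fin n) (a : Fin (μ i.castSucc)) :
    mixedVec col w ⟨i.castSucc, a⟩ = w.vec ⟨i.castSucc, a⟩ :=
  extVec_castSucc _ _ i a

theorem mixedVec_last (w : Frame μ lam.cells) (a : Fin (μ (Fin.last n))) :
    mixedVec col w ⟨Fin.last n, a⟩ = boxVec lam 0 (col a) :=
  extVec_last _ _ a

theorem span_initial (w : Frame μ lam.cells) :
    Submodule.span ℂ (Set.range fun q : Σ i : Fin n, Fin (μ i.castSucc) =>
      w.vec ⟨q.1.castSucc, q.2⟩) = w.flag.space (Fin.last n).castSucc := by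
  refine congrArg _ (Set.ext fun x => ⟨?_, ?_⟩)
  · rintro ⟨⟨i, a⟩, rfl⟩
    exact ⟨⟨i.castSucc, a⟩, Fin.castSucc_lt_castSucc_iff.2 (Fin.castSucc_lt_last i), rfl⟩
  · rintro ⟨⟨i, a⟩, hi, rfl⟩
    induction i using Fin.lastCases with
    | last =>
      exact absurd (show (Fin.last n).castSucc < (Fin.last n).castSucc from hi) (lt_irrefl _)
    | cast i => exact ⟨⟨i, a⟩, rfl⟩

theorem span_mixedVec (hcol : Set.range col = C) (w : Frame μ lam.cells) :
    Submodule.span ℂ (Set.range (mixedVec col w)) =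
      w.flag.space (Fin.last n).castSucc ⊔ coordSpan lam C := by
  rw [← span_initial, coordSpan_eq_span_range hcol, ← Submodule.span_union]
  refine congrArg _ (Set.ext fun x => ⟨?_, ?_⟩)
  · rintro ⟨⟨i, a⟩, rfl⟩
    induction i using Fin.lastCases with
    | last => exact Or.inr ⟨a, (mixedVec_last w a).symm⟩
    | cast i => exact Or.inl ⟨⟨i, a⟩, (mixedVec_castSucc w i a).symm⟩
  · rintro (⟨⟨i, a⟩, rfl⟩ | ⟨a, rfl⟩)
    · exact ⟨⟨i.castSucc, a⟩, mixedVec_castSucc w i a⟩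
    · exact ⟨⟨Fin.last n, a⟩, mixedVec_last w a⟩

/-- The square matrix with rows `mixedVec`, where `ε` identifies the index sets. -/
def mixedMatrix (col : Fin (μ (Fin.last n)) → ℕ) (ε : (Σ i : Fin (n + 1), Fin (μ i)) ≃ lam.cells)
    (w : Frame μ lam.cells) : Matrix lam.cells lam.cells ℂ :=
  Matrix.of fun i => mixedVec col w (ε.symm i)

variable (ε : (Σ i : Fin (n + 1), Fin (μ i)) ≃ lam.cells)

theorem det_mixedMatrix_ne_zero_iff (hcol : Set.range col = C) (w : Frame μ lam.cells) :
    (mixedMatrix col ε w).det ≠ 0 ↔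
      w.flag.space (Fin.last n).castSucc ⊔ coordSpan lam C = ⊤ := by
  rw [← isUnit_iff_ne_zero, ← Matrix.isUnit_iff_isUnit_det,
    ← Matrix.linearIndependent_rows_iff_isUnit, ← span_mixedVec hcol]
  have hrow : Set.range (mixedMatrix col ε w).row = Set.range (mixedVec col w) := by
    rw [show (mixedMatrix col ε w).row = mixedVec col w ∘ ε.symm from rfl,
      ε.symm.surjective.range_comp]
  rw [← hrow]
  have hcard : Fintype.card lam.cells = Module.finrank ℂ (BoxSpace lam) :=
    (Module.finrank_fintype_fun_eq_card ℂ).symm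
  exact ⟨fun h => h.span_eq_top_of_card_eq_finrank' hcard,
    fun h => linearIndependent_of_top_le_span_of_card_eq_finrank h.ge hcard⟩

/-- If the largest proper space `W` of the flag of `w` is a complement of `⟨f_c : c ∈ C⟩`, then for
`l ∉ C` the component of `f_l` in `⟨f_c : c ∈ C⟩` is `∑ c, cramerCoord c l • f_c`. It is read off
from the inverse of `mixedMatrix`, with the value `0` when there is no column `l`. -/
def cramerCoord (C : Set ℕ) (col : Fin (μ (Fin.last n)) → ℕ)
    (ε : (Σ i : Fin (n + 1), Fin (μ i)) ≃ lam.cells) (w : Frame μ lam.cells) (c l : ℕ) : ℂ := by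
  classical exact if h : (0, l) ∈ lam ∧ l ∉ C then
    ∑ a, if col a = c then (mixedMatrix col ε w)⁻¹ ⟨(0, l), h.1⟩ (ε ⟨Fin.last n, a⟩) else 0
  else 0

theorem cramerCoord_eq_zero (hcol : Set.range col = C) (w : Frame μ lam.cells) (c l : ℕ)
    (h : ¬ (c ∈ C ∧ l ∉ C ∧ l < lam.rowLen 0)) : cramerCoord C col ε w c l = 0 := by
  classical
  by_cases hl : (0, l) ∈ lam ∧ l ∉ C
  · rw [cramerCoord, dif_pos hl]
    refine Finset.sum_eq_zero fun a _ => if_neg ?_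
    rintro rfl
    exact h ⟨hcol.subset ⟨a, rfl⟩, hl.2, YoungDiagram.mem_iff_lt_rowLen.1 hl.1⟩
  · exact dif_neg hl

theorem cramerCoord_mem (hcol : Set.range col = C) (hC : ∀ c ∈ C, c < lam.rowLen 0)
    {w : Frame μ lam.cells} (hw : (mixedMatrix col ε w).det ≠ 0) {l : ℕ} (hl : l ∉ C) :
    boxVec lam 0 l - ∑ c ∈ Finset.range (lam.rowLen 0), cramerCoord C col ε w c l • boxVec lam 0 c ∈
      w.flag.space (Fin.last n).castSucc := by
  classical
  by_cases hlt : l < lam.rowLen 0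
  swap
  · rw [boxVec_zero_eq_zero (not_lt.1 hlt), Finset.sum_eq_zero, sub_zero]
    · exact Submodule.zero_mem _
    · intro c _
      rw [cramerCoord_eq_zero ε hcol w c l fun h => hlt h.2.2, zero_smul]
  have hmem : (0, l) ∈ lam := YoungDiagram.mem_iff_lt_rowLen.2 hlt
  set M := mixedMatrix col ε w with hM
  have hinv : M⁻¹ * M = 1 := Matrix.nonsing_inv_mul M (isUnit_iff_ne_zero.2 hw)
  have hrepr : boxVec lam 0 l = ∑ p, M⁻¹ ⟨(0, l), hmem⟩ (ε p) • mixedVec col w p := by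
    rw [← ε.symm.sum_comp]
    funext b
    have h1 := congrFun (congrFun hinv ⟨(0, l), hmem⟩) b
    rw [Matrix.mul_apply, Matrix.one_apply] at h1
    simp only [Finset.sum_apply, Pi.smul_apply, Equiv.apply_symm_apply, smul_eq_mul]
    rw [show (∑ x, M⁻¹ ⟨(0, l), hmem⟩ x * mixedVec col w (ε.symm x) b) =
      ∑ x, M⁻¹ ⟨(0, l), hmem⟩ x * M x b from rfl, h1, boxVec]
    exact if_congr ⟨fun h => Subtype.ext h.symm, fun h => (congrArg Subtype.val h).symm⟩ rfl rfl
  have hsum : ∑ c ∈ Finset.range (lam.rowLen 0), cramerCoord C col ε w c l • boxVec lam 0 c =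
      ∑ a, M⁻¹ ⟨(0, l), hmem⟩ (ε ⟨Fin.last n, a⟩) • boxVec lam 0 (col a) := by
    simp only [cramerCoord, dif_pos (And.intro hmem hl), Finset.sum_smul, ite_smul, zero_smul]
    rw [Finset.sum_comm]
    refine Finset.sum_congr rfl fun a _ => ?_
    rw [Finset.sum_ite_eq, if_pos (Finset.mem_range.2 (hC _ (hcol.subset ⟨a, rfl⟩)))]
  rw [hsum, hrepr, Fintype.sum_sigma, Fin.sum_univ_castSucc]
  simp only [mixedVec_last, mixedVec_castSucc, add_sub_cancel_right]
  refine Submodule.sum_mem _ fun i _ => Submodule.sum_mem _ fun a _ => Submodule.smul_mem _ _ ?_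
  exact w.vec_mem_flag (Fin.castSucc_lt_castSucc_iff.2 (Fin.castSucc_lt_last i))

theorem mixedMatrix_mem_ratAt {D : Set (Frame μ lam.cells)} {v : Frame μ lam.cells}
    (i j : lam.cells) : (fun w => mixedMatrix col ε w i j) ∈ ratAt D v := by
  simp only [mixedMatrix, Matrix.of_apply]
  obtain ⟨k, a⟩ := ε.symm i
  induction k using Fin.lastCases with
  | last =>
    simp only [mixedVec_last]
    exact const_mem_subalgebra _ _
  | cast k =>
    simp only [mixedVec_castSucc]
    exact coord_mem_ratAt (D := D) (v := v) (⟨k.castSucc, a⟩, j)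

theorem cramerCoord_mem_ratAt {D : Set (Frame μ lam.cells)} {v : Frame μ lam.cells} (hv : v ∈ D)
    (hdet : (mixedMatrix col ε v).det ≠ 0) (c l : ℕ) :
    (fun w => cramerCoord C col ε w c l) ∈ ratAt D v := by
  classical
  by_cases hl : (0, l) ∈ lam ∧ l ∉ C
  · simp only [cramerCoord, dif_pos hl]
    have : (fun w => ∑ a, if col a = c then (mixedMatrix col ε w)⁻¹ ⟨(0, l), hl.1⟩
        (ε ⟨Fin.last n, a⟩) else 0) = ∑ a, fun w => if col a = c then
          (mixedMatrix col ε w)⁻¹ ⟨(0, l), hl.1⟩ (ε ⟨Fin.last n, a⟩) else 0 := by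
      funext w
      simp [Finset.sum_apply]
    rw [this]
    refine sum_mem fun a _ => ?_
    split_ifs
    · exact inv_entry_mem_ratAt hv (fun i j => mixedMatrix_mem_ratAt ε i j) hdet _ _
    · exact const_mem_subalgebra _ _
  · simp only [cramerCoord, dif_neg hl]
    exact const_mem_subalgebra _ _

end Step

end

noncomputable section

/-! ### The chart of a cell from a chart of the smaller cell -/

section ChartStep
variable {lam : YoungDiagram} {n : ℕ} {μ : Fin (n + 1) → ℕ} {S : SemistandardYoungTableau lam}
  {e : BoxSpace (subshape S n) →ₗ[ℂ] BoxSpace lam} {col : Fin (μ (Fin.last n)) → ℕ}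

theorem range_rowOp_comp {C : Set ℕ} (hrange : LinearMap.range e = perp (coordSpan lam C))
    {a : ℕ → ℕ → ℂ} (ha : IsSchubertCoord C a) : LinearMap.range (rowOp lam (-a) ∘ₗ e) =
      (perp (coordSpan lam C)).map (shear lam ha).toLinearMap := by
  rw [LinearMap.range_comp, hrange]
  rfl

theorem map_shear_sup_coordSpan {C : Set ℕ} {a : ℕ → ℕ → ℂ} (ha : IsSchubertCoord C a) :
    (perp (coordSpan lam C)).map (shear lam ha).toLinearMap ⊔ coordSpan lam C = ⊤ := by
  have h : (coordSpan lam C).map (shear lam ha).toLinearMap ≤ coordSpan lam C := by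
    rw [Submodule.map_le_iff_le_comap, coordSpan_le_iff]
    intro c hc
    change shear lam ha (boxVec lam 0 c) ∈ coordSpan lam C
    rw [shear_boxVec_of_mem ha 0 hc]
    exact boxVec_mem_coordSpan hc
  rw [eq_top_iff]
  refine le_trans ?_ (sup_le_sup_left h _)
  rw [← Submodule.map_sup, (isCompl_perp_coordSpan C).sup_eq_top, Submodule.map_top,
    LinearEquiv.range]

/-- Near the cell, a frame `w` of a flag in the fiber determines its Schubert coordinates and a
frame of the flag which it extends. -/
theorem exists_reduced_frame (hS : IsStd μ S)
    (hrange : LinearMap.range e = perp (coordSpan lam (columnsWith S (n + 1))))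
    (hcol : Set.range col = columnsWith S (n + 1))
    {L : BoxSpace lam →ₗ[ℂ] BoxSpace (subshape S n)} (hL : L ∘ₗ e = LinearMap.id)
    (ε : (Σ i : Fin (n + 1), Fin (μ i)) ≃ lam.cells) {w : Frame μ lam.cells}
    (hw : w.flag ∈ jordanFiber μ S) (hdet : (mixedMatrix col ε w).det ≠ 0) :
    IsSchubertCoord (columnsWith S (n + 1)) (cramerCoord (columnsWith S (n + 1)) col ε w) ∧
    ∃ m : Frame (fun i : Fin n => μ i.castSucc) (subshape S n).cells,
      (∀ q, m.vec q = L (rowOp lam (cramerCoord (columnsWith S (n + 1)) col ε w)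
        (w.vec ⟨q.1.castSucc, q.2⟩))) ∧
      IsExt (rowOp lam (-cramerCoord (columnsWith S (n + 1)) col ε w) ∘ₗ e) m.flag w.flag := by
  have hs := hS.isHorizontalStrip
  have hC : ∀ c ∈ columnsWith S (n + 1), c < lam.rowLen 0 := fun c hc => hs.lt_rowLen hc
  have hr := sameRanks_of_mem_rankFiber hS (jordanFiber_subset_rankFiber μ S hw)
  have ha := hr.isSchubertCoord hs
    (hr.disjoint ((det_mixedMatrix_ne_zero_iff ε hcol w).1 hdet))
    (cramerCoord_eq_zero ε hcol w) fun l hl => cramerCoord_mem ε hcol hC hdet hl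
  have hW := eq_map_shear hr.range_le hr.finrank_eq_self ha
    fun l hl => cramerCoord_mem ε hcol hC hdet hl
  rw [← range_rowOp_comp hrange ha] at hW
  refine ⟨ha, ?_⟩
  set a := cramerCoord (columnsWith S (n + 1)) col ε w
  have hLa : ∀ y, L (rowOp lam a (rowOp lam (-a) (e y))) = y := fun y => by
    rw [rowOp_rowOp_neg ha]
    exact LinearMap.congr_fun hL y
  have hspan : Submodule.span ℂ (Set.range fun q : Σ i : Fin n, Fin (μ i.castSucc) =>
      L (rowOp lam a (w.vec ⟨q.1.castSucc, q.2⟩))) = ⊤ := by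
    rw [show (fun q : Σ i : Fin n, Fin (μ i.castSucc) =>
      L (rowOp lam a (w.vec ⟨q.1.castSucc, q.2⟩))) = (L ∘ₗ rowOp lam a) ∘
        fun q : Σ i : Fin n, Fin (μ i.castSucc) => w.vec ⟨q.1.castSucc, q.2⟩ from rfl,
      Set.range_comp, Submodule.span_image, span_initial, hW, eq_top_iff]
    exact fun y _ => ⟨_, ⟨y, rfl⟩, hLa y⟩
  refine ⟨Frame.ofSpan _ hspan hS.restrict.sum_eq, fun q => rfl, isExt_flag fun i b => ?_⟩
  obtain ⟨y, hy⟩ : w.vec ⟨i.castSucc, b⟩ ∈ LinearMap.range (rowOp lam (-a) ∘ₗ e) :=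
    hW ▸ w.vec_mem_flag (Fin.castSucc_lt_castSucc_iff.2 (Fin.castSucc_lt_last i))
  change w.vec ⟨i.castSucc, b⟩ =
    rowOp lam (-a) (e (L (rowOp lam a (w.vec ⟨i.castSucc, b⟩))))
  rw [← hy, LinearMap.comp_apply, hLa]

/-- The frame of the flag in `cellOver C e Y'` with given coordinates. -/
def cellFrame {C : Set ℕ} (hrange : LinearMap.range e = perp (coordSpan lam C))
    (hcol : Set.range col = C) (hμ : ∑ i, μ i = Fintype.card lam.cells) {σ : Type}
    (v : (σ → ℂ) → Frame (fun i : Fin n => μ i.castSucc) (subshape S n).cells)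
    (s : SchubertIndex C ⊕ σ → ℂ) : Frame μ lam.cells :=
  stepFrame hrange hcol hμ (shear lam (isSchubertCoord_toSchubert (s ∘ Sum.inl)))
    (v (s ∘ Sum.inr))

theorem isExt_cellFrame {C : Set ℕ} (hrange : LinearMap.range e = perp (coordSpan lam C))
    (hcol : Set.range col = C) (hμ : ∑ i, μ i = Fintype.card lam.cells) {σ : Type}
    (v : (σ → ℂ) → Frame (fun i : Fin n => μ i.castSucc) (subshape S n).cells)
    (s : SchubertIndex C ⊕ σ → ℂ) :
    IsExt (rowOp lam (-toSchubert (s ∘ Sum.inl)) ∘ₗ e) (v (s ∘ Sum.inr)).flag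
      (cellFrame hrange hcol hμ v s).flag :=
  isExt_stepFrame _ _

/-- A chart of the cell over `Y'`, from a chart of `Y'`. -/
def Chart.cellOver (hS : IsStd μ S) (he : IsAdmissible e)
    (hrange : LinearMap.range e = perp (coordSpan lam (columnsWith S (n + 1))))
    (hcol : Set.range col = columnsWith S (n + 1))
    {Y' : Set (PartialFlag (fun i : Fin n => μ i.castSucc) (subshape S n).cells)} {σ : Type}
    (φ : Chart (jordanFiber (fun i : Fin n => μ i.castSucc) (restrict S n)) Y' σ) :
    Chart (jordanFiber μ S) (Spaltenstein.cellOver (columnsWith S (n + 1)) e Y')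
      (SchubertIndex (columnsWith S (n + 1)) ⊕ σ) :=
  have hext := isExt_cellFrame hrange hcol hS.sum_eq φ.frame
  { frame := cellFrame hrange hcol hS.sum_eq φ.frame
    coord_mem := by
      rintro ⟨p, b⟩
      refine extVec_apply_mem
        (z := fun s : SchubertIndex (columnsWith S (n + 1)) ⊕ σ → ℂ =>
          rowOp lam (-toSchubert (s ∘ Sum.inl)))
        (v := fun s => (φ.frame (s ∘ Sum.inr)).vec) (polyFun _)
        (fun y b => rowOp_apply_mem _ (fun c l => ?_) y b) (fun q b => ?_) p b
      · by_cases h : c ∈ columnsWith S (n + 1) ∧ l ∉ columnsWith S (n + 1) ∧ l < c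
        · simp only [Pi.neg_apply, toSchubert, dif_pos h]
          exact neg_mem (apply_mem_polyFun _)
        · simp only [Pi.neg_apply, toSchubert, dif_neg h]
          exact neg_mem (const_mem_subalgebra _ _)
      · obtain ⟨P, hP⟩ := mem_polyFun_iff.1 (φ.coord_mem (q, b))
        have h := eval_mem_subalgebra
          (F := fun s : SchubertIndex (columnsWith S (n + 1)) ⊕ σ → ℂ => s ∘ Sum.inr) (polyFun _)
          (fun i => apply_mem_polyFun (Sum.inr i)) P
        simp only [← hP] at h
        exact h
    range_flag := by
      ext V
      constructor
      · rintro ⟨s, rfl⟩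
        exact ⟨_, isSchubertCoord_toSchubert _, _, φ.flag_frame_mem _, hext s⟩
      · rintro ⟨a, ha, V', hV', h⟩
        refine ⟨Sum.elim (fun p => a p.1.1 p.1.2) (φ.coord V'), ?_⟩
        have h' := hext (Sum.elim (fun p => a p.1.1 p.1.2) (φ.coord V'))
        rw [Sum.elim_comp_inl, Sum.elim_comp_inr, toSchubert_eq ha, φ.flag_frame_coord hV'] at h'
        exact h'.right_unique h
    injective := by
      intro s s' h
      have h1 := hext s
      have h2 := hext s'
      simp only at h
      rw [h] at h1
      have h3 := schubertCoord_unique hS.isHorizontalStrip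
        (isSchubertCoord_toSchubert (s ∘ Sum.inl)) (isSchubertCoord_toSchubert (s' ∘ Sum.inl)) (by
          rw [← range_rowOp_comp hrange, ← range_rowOp_comp hrange, ← h1.range_eq, ← h2.range_eq])
      rw [h3] at h1
      have h4 := toSchubert_injective h3
      have h5 := φ.injective (h1.left_unique
        (isAdmissible_rowOp he (isSchubertCoord_toSchubert (s' ∘ Sum.inl))).injective h2)
      rw [← Sum.elim_comp_inl_inr s, ← Sum.elim_comp_inl_inr s', h4, h5]
    subset := by
      rintro V ⟨a, ha, V', hV', h⟩
      exact (h.mem_jordanFiber_iff hS (isAdmissible_rowOp he ha)).2 (φ.subset hV')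
    exists_coord := by
      rintro v ⟨a₀, ha₀, V₀, hV₀, h₀⟩
      have hvJ : v ∈ Frame.flag ⁻¹' jordanFiber μ S :=
        (h₀.mem_jordanFiber_iff hS (isAdmissible_rowOp he ha₀)).2 (φ.subset hV₀)
      let ε : (Σ i : Fin (n + 1), Fin (μ i)) ≃ lam.cells :=
        Fintype.equivOfCardEq (by simpa using hS.sum_eq)
      obtain ⟨L, hL⟩ := LinearMap.exists_leftInverse_of_injective e
        (LinearMap.ker_eq_bot.2 he.injective)
      have hdet : (mixedMatrix col ε v).det ≠ 0 := by
        rw [det_mixedMatrix_ne_zero_iff ε hcol, h₀.range_eq, range_rowOp_comp hrange ha₀,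
          map_shear_sup_coordSpan]
      have hdet' : ∀ᶠ w in 𝓝[Frame.flag ⁻¹' jordanFiber μ S] v, (mixedMatrix col ε w).det ≠ 0 :=
        eventually_ne_zero_of_mem_ratAt
          (det_mem_subalgebra _ fun i j => mixedMatrix_mem_ratAt ε i j) hvJ hdet
      -- the reduced frame, with an arbitrary value away from `v`
      have hred : ∀ w : Frame μ lam.cells,
          ∃ m : Frame (fun i : Fin n => μ i.castSucc) (subshape S n).cells,
          w.flag ∈ jordanFiber μ S → (mixedMatrix col ε w).det ≠ 0 →
          (∀ q, m.vec q = L (rowOp lam (cramerCoord (columnsWith S (n + 1)) col ε w)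
            (w.vec ⟨q.1.castSucc, q.2⟩))) ∧
          IsExt (rowOp lam (-cramerCoord (columnsWith S (n + 1)) col ε w) ∘ₗ e)
            m.flag w.flag := by
        intro w
        by_cases hw : w.flag ∈ jordanFiber μ S ∧ (mixedMatrix col ε w).det ≠ 0
        · obtain ⟨-, m, hm⟩ := exists_reduced_frame hS hrange hcol hL ε hw.1 hw.2
          exact ⟨m, fun _ _ => hm⟩
        · exact ⟨φ.frame 0, fun h1 h2 => absurd ⟨h1, h2⟩ hw⟩
      choose m hm using hred
      have ha : ∀ w : Frame μ lam.cells, w.flag ∈ jordanFiber μ S →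
          (mixedMatrix col ε w).det ≠ 0 → IsSchubertCoord (columnsWith S (n + 1))
            (cramerCoord (columnsWith S (n + 1)) col ε w) :=
        fun w h1 h2 => (exists_reduced_frame hS hrange hcol hL ε h1 h2).1
      -- at `v` itself the construction recovers the flag that `v.flag` extends
      have hmv : (m v).flag = V₀ := by
        have h1 := (hm v hvJ hdet).2
        have h2 := schubertCoord_unique hS.isHorizontalStrip (ha v hvJ hdet) ha₀ (by
          rw [← range_rowOp_comp hrange, ← range_rowOp_comp hrange, ← h1.range_eq, ← h₀.range_eq])
        rw [h2] at h1
        exact h1.left_unique (isAdmissible_rowOp he ha₀).injective h₀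
      have hrat : ∀ c l, (fun w => cramerCoord (columnsWith S (n + 1)) col ε w c l) ∈
          ratAt (Frame.flag ⁻¹' jordanFiber μ S) v := cramerCoord_mem_ratAt ε hvJ hdet
      have hmrat : ∀ i, (fun w => (m w).coord i) ∈
          ratAt (Frame.flag ⁻¹' jordanFiber μ S) v := by
        rintro ⟨q, b⟩
        refine ratAt_congr (F := fun w => (L ∘ₗ rowOp lam
          (cramerCoord (columnsWith S (n + 1)) col ε w)) (w.vec ⟨q.1.castSucc, q.2⟩) b)
          (linear_apply_mem _ (fun y => ?_) fun b' =>
            Spaltenstein.coord_mem_ratAt (D := Frame.flag ⁻¹' jordanFiber μ S) (v := v)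
              (⟨q.1.castSucc, q.2⟩, b')) ?_
        · exact linear_apply_mem (L := fun _ => L) _ (fun y => const_mem_subalgebra _ _)
            (rowOp_apply_mem _ hrat y)
        · filter_upwards [hdet', self_mem_nhdsWithin] with w h1 h2
          exact congrFun ((hm w h2 h1).1 q) b
      have hmD : ∀ᶠ w in 𝓝[Frame.flag ⁻¹' jordanFiber μ S] v, m w ∈ Frame.flag ⁻¹'
          jordanFiber (fun i : Fin n => μ i.castSucc) (restrict S n) := by
        filter_upwards [hdet', self_mem_nhdsWithin] with w h1 h2
        exact ((hm w h2 h1).2.mem_jordanFiber_iff hS (isAdmissible_rowOp he (ha w h2 h1))).1 h2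
      obtain ⟨κ, hκ, hκ'⟩ := φ.exists_coord (m v) (hmv ▸ hV₀)
      refine ⟨fun w => Sum.elim (fun p => cramerCoord (columnsWith S (n + 1)) col ε w p.1.1 p.1.2)
        (κ (m w)), ?_, ?_⟩
      · rintro (p | i)
        · exact hrat _ _
        · exact comp_mem_ratAt hvJ hmrat hmD (hκ i)
      · filter_upwards [hdet', self_mem_nhdsWithin,
          (tendsto_of_coord_mem_ratAt hvJ hmrat hmD).eventually hκ'] with w h1 h2 h3
        have h' := hext (Sum.elim
          (fun p => cramerCoord (columnsWith S (n + 1)) col ε w p.1.1 p.1.2) (κ (m w)))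
        rw [Sum.elim_comp_inl, Sum.elim_comp_inr, toSchubert_eq (ha w h2 h1), h3] at h'
        exact h'.right_unique (hm w h2 h1).2 }

end ChartStep

end

noncomputable section

/-! ### Translating cells by the centralizer -/

section Map
variable {n : ℕ} {μ : Fin n → ℕ} {ι : Type} [Fintype ι]

/-- The image of a flag under a linear automorphism. -/
def PartialFlag.map (T : (ι → ℂ) ≃ₗ[ℂ] (ι → ℂ)) (V : PartialFlag μ ι) : PartialFlag μ ι where
  space j := (V.space j).map T.toLinearMap
  space_zero := by rw [V.space_zero, Submodule.map_bot]
  space_last := by rw [V.space_last, Submodule.map_top, LinearEquiv.range]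
  mono _ _ h := Submodule.map_mono (V.mono h)
  finrank_succ i := by
    rw [finrank_map_of_injective T.injective, finrank_map_of_injective T.injective,
      V.finrank_succ]

theorem PartialFlag.map_symm_map (T : (ι → ℂ) ≃ₗ[ℂ] (ι → ℂ)) (V : PartialFlag μ ι) :
    (V.map T.symm).map T = V := by
  refine PartialFlag.ext (funext fun j => ?_)
  change ((V.space j).map T.symm.toLinearMap).map T.toLinearMap = V.space j
  rw [← Submodule.map_comp]
  simp

theorem PartialFlag.map_map_symm (T : (ι → ℂ) ≃ₗ[ℂ] (ι → ℂ)) (V : PartialFlag μ ι) :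
    (V.map T).map T.symm = V :=
  V.map_symm_map T.symm

theorem Frame.flag_map (T : (ι → ℂ) ≃ₗ[ℂ] (ι → ℂ)) (v : Frame μ ι) :
    (v.map T).flag = v.flag.map T :=
  PartialFlag.ext (funext fun j => v.map_flag_space T j)

theorem linear_apply_coord_mem {X : Type} (A : Subalgebra ℂ (X → ℂ)) {v : X → Frame μ ι}
    (hv : ∀ i, (fun x => (v x).coord i) ∈ A) (T : (ι → ℂ) ≃ₗ[ℂ] (ι → ℂ))
    (i : (Σ i : Fin n, Fin (μ i)) × ι) : (fun x => ((v x).map T).coord i) ∈ A :=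
  linear_apply_mem (L := fun _ => T.toLinearMap) A (fun _ => const_mem_subalgebra A _)
    fun b => hv (i.1, b)

/-- The translate of a chart by an automorphism that preserves the ambient subvariety. -/
def Chart.map {J Y : Set (PartialFlag μ ι)} {σ : Type} (φ : Chart J Y σ)
    (T : (ι → ℂ) ≃ₗ[ℂ] (ι → ℂ)) (hJ : ∀ V : PartialFlag μ ι, V.map T ∈ J ↔ V ∈ J) :
    Chart J (PartialFlag.map T '' Y) σ where
  frame s := (φ.frame s).map T
  coord_mem := linear_apply_coord_mem _ φ.coord_mem T
  range_flag := by
    simp only [Frame.flag_map]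
    rw [← congrArg (Set.image (PartialFlag.map T)) φ.range_flag, ← Set.range_comp]
    rfl
  injective s s' h := by
    simp only [Frame.flag_map] at h
    refine φ.injective ?_
    have := congrArg (PartialFlag.map T.symm) h
    rwa [PartialFlag.map_map_symm, PartialFlag.map_map_symm] at this
  subset := by
    rintro _ ⟨V, hV, rfl⟩
    exact (hJ V).2 (φ.subset hV)
  exists_coord := by
    rintro v ⟨V, hV, hv⟩
    have hJ' : ∀ w : Frame μ ι, w.flag ∈ J → (w.map T.symm).flag ∈ J := by
      intro w hw
      rw [← hJ, Frame.flag_map, PartialFlag.map_symm_map]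
      exact hw
    have hvV : (v.map T.symm).flag = V := by
      rw [Frame.flag_map, ← hv, PartialFlag.map_map_symm]
    have hvJ : v ∈ Frame.flag ⁻¹' J := by
      change v.flag ∈ J
      rw [← hv]
      exact (hJ V).2 (φ.subset hV)
    have hm : ∀ i, (fun w : Frame μ ι => (w.map T.symm).coord i) ∈ ratAt (Frame.flag ⁻¹' J) v :=
      linear_apply_coord_mem _ (v := fun w : Frame μ ι => w)
        (Spaltenstein.coord_mem_ratAt (D := Frame.flag ⁻¹' J) (v := v)) T.symm
    have hD : ∀ᶠ w in 𝓝[Frame.flag ⁻¹' J] v, w.map T.symm ∈ Frame.flag ⁻¹' J := by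
      filter_upwards [self_mem_nhdsWithin] with w hw using hJ' w hw
    obtain ⟨κ, hκ, hκ'⟩ := φ.exists_coord (v.map T.symm) (hvV ▸ hV)
    refine ⟨fun w => κ (w.map T.symm), fun i => comp_mem_ratAt hvJ hm hD (hκ i), ?_⟩
    filter_upwards [(tendsto_of_coord_mem_ratAt hvJ hm hD).eventually hκ'] with w hw
    rw [Frame.flag_map, hw, Frame.flag_map, PartialFlag.map_symm_map]

end Map

section Cover
variable {lam : YoungDiagram}

theorem map_mem_jordanFiber_iff {n : ℕ} {μ : Fin n → ℕ} (S : SemistandardYoungTableau lam)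
    {z : BoxSpace lam ≃ₗ[ℂ] BoxSpace lam} (hz : ∀ y, z (nil lam y) = nil lam (z y))
    (V : PartialFlag μ lam.cells) : V.map z ∈ jordanFiber μ S ↔ V ∈ jordanFiber μ S := by
  have hE : IsAdmissible z.toLinearMap := by
    refine ⟨z.injective, hz, ?_⟩
    rw [LinearEquiv.range]
    exact le_top
  have hcomm : nil lam ∘ₗ z.toLinearMap = z.toLinearMap ∘ₗ nil lam :=
    LinearMap.ext fun y => (hz y).symm
  refine and_congr (forall_congr' fun i => ?_) (forall_congr' fun j => hE.hasJordanType_iff _ _)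
  change ((V.space i.succ).map z.toLinearMap).map (nil lam) ≤ (V.space i.castSucc).map _ ↔ _
  rw [← Submodule.map_comp, hcomm, Submodule.map_comp,
    Submodule.map_le_map_iff_of_injective z.injective]

theorem rowOp_zero : rowOp lam 0 = LinearMap.id := by
  have h0 : IsSchubertCoord (∅ : Set ℕ) (0 : ℕ → ℕ → ℂ) := fun _ _ _ => rfl
  exact boxSpace_hom_ext fun i c _ => by simp [rowOp_boxVec h0]

/-- The fiber is covered by the translates of the paving cells. Here the choice of `θ` is free: a
translation of the smaller cell by `z'` is absorbed by replacing `e` with `e ∘ z'`. -/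
theorem exists_isPavingCell_map {n : ℕ} {μ : Fin n → ℕ} {S : SemistandardYoungTableau lam}
    (hS : IsStd μ S) {V : PartialFlag μ lam.cells} (hV : V ∈ jordanFiber μ S) :
    ∃ (z : BoxSpace lam ≃ₗ[ℂ] BoxSpace lam) (Y : Set (PartialFlag μ lam.cells)),
      (∀ y, z (nil lam y) = nil lam (z y)) ∧ IsPavingCell μ S Y ∧ V ∈ PartialFlag.map z '' Y := by
  induction n generalizing lam with
  | zero =>
    refine ⟨LinearEquiv.refl ℂ _, _, fun _ => rfl, rfl, V, hV.1, ?_⟩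
    exact PartialFlag.ext (funext fun j => Submodule.map_id _)
  | succ n ih =>
    obtain ⟨e, h1, h2, h3⟩ := hS.isHorizontalStrip.exists_embedding
    have he := isAdmissible_of_range_eq h1 h2 h3
    obtain ⟨z, V', hz, hext⟩ :=
      exists_isExt_of_mem_rankFiber hS (jordanFiber_subset_rankFiber μ S hV) he h2
    obtain ⟨z', Y', hz', hY', V₀, hV₀, rfl⟩ :=
      ih hS.restrict ((hext.mem_jordanFiber_iff hS (he.comp_equiv hz)).1 hV)
    have hrange : LinearMap.range (e ∘ₗ z'.toLinearMap) =
        perp (coordSpan lam (columnsWith S (n + 1))) := by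
      rw [LinearMap.range_comp, LinearEquiv.range, Submodule.map_top, h2]
    have he' : IsAdmissible (e ∘ₗ z'.toLinearMap) :=
      isAdmissible_of_range_eq (h1.comp z'.injective) hrange fun y => by simp [hz', h3]
    refine ⟨z, _, hz, isPavingCell_cellOver he' hrange hY', V.map z.symm,
      ⟨0, fun _ _ _ => rfl, V₀, hV₀, fun i => ?_⟩, V.map_symm_map z⟩
    change (V.space i.castSucc).map z.symm.toLinearMap = _
    rw [hext i, neg_zero, rowOp_zero, LinearMap.id_comp]
    change (((V₀.space i).map z'.toLinearMap).map (z.toLinearMap ∘ₗ e)).map _ = _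
    rw [← Submodule.map_comp, ← Submodule.map_comp]
    congr 1
    exact LinearMap.ext fun y => by simp

end Cover

end

noncomputable section

/-! ### The number of coordinates -/

section Count

theorem sum_card_filter_lt (C : Finset ℕ) :
    ∑ c ∈ C, (C.filter (· < c)).card = C.card.choose 2 := by
  induction C using Finset.induction_on_max with
  | empty => simp
  | insert m s hm ih =>
    have hms : m ∉ s := fun h => lt_irrefl _ (hm m h)
    rw [Finset.sum_insert hms, Finset.card_insert_of_notMem hms, Nat.choose_succ_succ' s.card 1,
      Nat.choose_one_right, ← ih]
    congr 1
    · rw [Finset.filter_insert, if_neg (lt_irrefl m), Finset.filter_true_of_mem hm]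
    · refine Finset.sum_congr rfl fun c hc => ?_
      rw [Finset.filter_insert, if_neg (hm c hc).le.not_gt]

instance finite_schubertIndex (C : Finset ℕ) : Finite (SchubertIndex (C : Set ℕ)) := by
  refine Finite.of_injective (β := C.sigma fun c => (Finset.range c).filter (· ∉ C))
    (fun p => ⟨⟨p.1.1, p.1.2⟩, by simpa using ⟨p.2.1, p.2.2.2, p.2.2.1⟩⟩) ?_
  rintro ⟨⟨c, l⟩, hp⟩ ⟨⟨c', l'⟩, hp'⟩ h
  simpa using h

/-- The dimension of the Schubert cell: each `c ∈ C` has `c` columns to its left (columns are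
numbered from zero), of which those in `C` do not count. -/
theorem card_schubertIndex (C : Finset ℕ) :
    Nat.card (SchubertIndex (C : Set ℕ)) + C.card.choose 2 = ∑ c ∈ C, c := by
  have h1 : Nat.card (SchubertIndex (C : Set ℕ)) =
      (C.sigma fun c => (Finset.range c).filter (· ∉ C)).card := by
    rw [← Fintype.card_coe, ← Nat.card_eq_fintype_card]
    refine Nat.card_congr ⟨fun p => ⟨⟨p.1.1, p.1.2⟩, by simpa using ⟨p.2.1, p.2.2.2, p.2.2.1⟩⟩,
      fun p => ⟨(p.1.1, p.1.2), ?_⟩, fun _ => rfl, fun _ => rfl⟩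
    have := p.2
    simp only [Finset.mem_sigma, Finset.mem_filter, Finset.mem_range] at this
    exact ⟨this.1, this.2.2, this.2.1⟩
  rw [h1, Finset.card_sigma, ← sum_card_filter_lt, ← Finset.sum_add_distrib]
  refine Finset.sum_congr rfl fun c _ => ?_
  have h2 : C.filter (· < c) = (Finset.range c).filter (· ∈ C) := by
    ext l
    simp [and_comm]
  rw [h2, add_comm, Finset.card_filter_add_card_filter_not, Finset.card_range]

/-- Summing the column indices over the boxes gives `½ λ_i (λ_i - 1)` for each row. -/
theorem dNum_rowLen {lam : YoungDiagram} {n : ℕ} (h : lam.colLen 0 ≤ n) :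
    dNum (fun i : Fin n => lam.rowLen i) = ∑ b ∈ lam.cells, b.2 := by
  have hmaps : ∀ b ∈ lam.cells, b.1 ∈ Finset.range n := by
    rintro ⟨i, c⟩ hb
    have h0 : (i, 0) ∈ lam := lam.up_left_mem le_rfl (Nat.zero_le c) hb
    exact Finset.mem_range.2 ((YoungDiagram.mem_iff_lt_colLen.1 h0).trans_le h)
  rw [← Finset.sum_fiberwise_of_maps_to hmaps, dNum, ← Fin.sum_univ_eq_sum_range
    (fun i => ∑ b ∈ lam.cells.filter (fun b => b.1 = i), b.2)]
  refine Finset.sum_congr rfl fun i _ => ?_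
  change _ = ∑ b ∈ lam.row i, b.2
  rw [YoungDiagram.row_eq_prod, Finset.sum_product, Finset.sum_singleton, Finset.sum_range_id,
    Nat.choose_two_right]

variable {lam : YoungDiagram} {n : ℕ} {μ : Fin (n + 1) → ℕ} {S : SemistandardYoungTableau lam}

theorem IsStd.exists_finset_columns (hS : IsStd μ S) : ∃ C : Finset ℕ,
    columnsWith S (n + 1) = C ∧ C.card = μ (Fin.last n) ∧
      ∑ b ∈ lam.cells, b.2 = ∑ c ∈ C, c + ∑ b ∈ (subshape S n).cells, b.2 := by
  have hinj : Set.InjOn Prod.snd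
      ((lam.cells.filter fun b => S b.1 b.2 = n + 1 : Finset (ℕ × ℕ)) : Set (ℕ × ℕ)) := by
    rintro ⟨i, c⟩ hb ⟨i', c'⟩ hb' (rfl : c = c')
    simp only [Finset.coe_filter, Set.mem_ofPred_eq, YoungDiagram.mem_cells] at hb hb'
    rcases lt_trichotomy i i' with h | rfl | h
    · have := S.col_strict h hb'.1
      omega
    · rfl
    · have := S.col_strict h hb.1
      omega
  refine ⟨(lam.cells.filter fun b => S b.1 b.2 = n + 1).image Prod.snd, ?_, ?_, ?_⟩
  · ext c
    simp [columnsWith]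
  · rw [Finset.card_image_of_injOn hinj]
    exact hS.mem (Fin.last n)
  · rw [Finset.sum_image hinj, ← Finset.sum_filter_add_sum_filter_not lam.cells
      (fun b => S b.1 b.2 = n + 1)]
    congr 1
    refine Finset.sum_congr (Finset.filter_congr fun b hb => ?_) fun _ _ => rfl
    have := (hS.entry b hb).2
    omega

end Count

/-! ### Charts of the paving cells -/

section PavingChart
variable {lam : YoungDiagram}

theorem jordanFiber_eq_univ {μ : Fin 0 → ℕ} {S : SemistandardYoungTableau lam} (hS : IsStd μ S) :
    jordanFiber μ S = Set.univ := by
  refine Set.eq_univ_of_forall fun V => ⟨fun i => i.elim0, fun j => ?_⟩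
  rw [show j = Fin.last 0 from Fin.ext (by omega), V.space_last, Fin.val_last, hS.subshape_eq]
  exact hasJordanType_top

instance {μ : Fin 0 → ℕ} {ι : Type} [Fintype ι] : Subsingleton (PartialFlag μ ι) := by
  refine ⟨fun V V' => PartialFlag.ext (funext fun j => ?_)⟩
  rw [show j = 0 from Fin.ext (by omega), V.space_zero, V'.space_zero]

/-- The unique frame of the zero space. -/
def emptyFrame {μ : Fin 0 → ℕ} {ι : Type} [Fintype ι] (h : ∑ i, μ i = Fintype.card ι) :
    Frame μ ι :=
  Frame.ofSpan (fun p => p.1.elim0) (by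
    have : IsEmpty ι := Fintype.card_eq_zero_iff.1 (by simpa using h.symm)
    exact Subsingleton.elim _ _) h

/-- A paving cell is an affine space, of dimension `d_λ - d_μ`. -/
theorem IsPavingCell.exists_chart {n : ℕ} {μ : Fin n → ℕ} {S : SemistandardYoungTableau lam}
    (hS : IsStd μ S) {Y : Set (PartialFlag μ lam.cells)} (hY : IsPavingCell μ S Y) :
    ∃ (σ : Type) (_ : Finite σ) (_ : Chart (jordanFiber μ S) Y σ),
      Nat.card σ + dNum μ = ∑ b ∈ lam.cells, b.2 := by
  induction n generalizing lam with
  | zero =>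
    have hempty : IsEmpty lam.cells :=
      Fintype.card_eq_zero_iff.1 (by simpa using hS.sum_eq.symm)
    have hYuniv : Y = Set.univ :=
      Eq.trans hY (Set.eq_univ_of_forall fun V i => i.elim0)
    refine ⟨Empty, inferInstance, ⟨fun _ => emptyFrame hS.sum_eq, fun i => i.1.1.elim0, ?_,
      Function.injective_of_subsingleton _, ?_, fun v _ => ⟨fun _ => 0, fun i => i.elim,
      Filter.Eventually.of_forall fun w => Subsingleton.elim _ _⟩⟩, ?_⟩
    · rw [hYuniv]
      exact Set.eq_univ_of_forall fun V => ⟨0, Subsingleton.elim _ _⟩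
    · rw [jordanFiber_eq_univ hS]
      exact Set.subset_univ _
    · rw [Finset.isEmpty_coe_sort.1 hempty]
      simp [dNum]
  | succ n ih =>
    obtain ⟨e, Y', he, hrange, hY', rfl⟩ := hY.exists_eq_cellOver
    obtain ⟨σ, _, φ, hσ⟩ := ih hS.restrict hY'
    obtain ⟨col, hcol⟩ := hS.exists_columns
    obtain ⟨C, hC, hcard, hsum⟩ := hS.exists_finset_columns
    have hfin : Finite (SchubertIndex (columnsWith S (n + 1))) := by
      rw [hC]
      infer_instance
    refine ⟨_, inferInstance, φ.cellOver hS he hrange hcol, ?_⟩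
    have hindex : Nat.card (SchubertIndex (columnsWith S (n + 1))) + (μ (Fin.last n)).choose 2 =
        ∑ c ∈ C, c := by
      rw [hC, ← hcard, card_schubertIndex]
    have hd : dNum μ = dNum (fun i : Fin n => μ i.castSucc) + (μ (Fin.last n)).choose 2 :=
      Fin.sum_univ_castSucc _
    rw [Nat.card_sum, hsum, ← hσ, hd, ← hindex]
    omega

end PavingChart

end

noncomputable section

/-! ### Joining points of the fiber by curves -/

section Curves
variable {lam : YoungDiagram}

theorem lineMap_apply_mem (z z' : BoxSpace lam →ₗ[ℂ] BoxSpace lam) (y : BoxSpace lam)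
    (b : lam.cells) :
    (fun t : Unit → ℂ => AffineMap.lineMap (k := ℂ) z z' (t ()) y b) ∈ polyFun Unit := by
  have h : (fun t : Unit → ℂ => AffineMap.lineMap (k := ℂ) z z' (t ()) y b) =
      (fun t : Unit → ℂ => t ()) * (fun _ => z' y b - z y b) + fun _ => z y b := by
    funext t
    simp [AffineMap.lineMap_apply]
  rw [h]
  exact add_mem (mul_mem (apply_mem_polyFun ()) (const_mem_subalgebra _ _))
    (const_mem_subalgebra _ _)

/-- The centralizer of `x^λ` in `GL_d` is open in a linear space, so that the line through two of
its elements joins them outside the zeros of the determinant. The curves in the fiber of the smaller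
tableau are moved along such lines. -/
theorem joinedByCurve_jordanFiber {n : ℕ} {μ : Fin n → ℕ} {S : SemistandardYoungTableau lam}
    (hS : IsStd μ S) {V V' : PartialFlag μ lam.cells} (hV : V ∈ jordanFiber μ S)
    (hV' : V' ∈ jordanFiber μ S) : JoinedByCurve (jordanFiber μ S) V V' := by
  induction n generalizing lam with
  | zero =>
    refine ⟨fun _ => emptyFrame hS.sum_eq, fun _ => (emptyFrame hS.sum_eq).coord, 1,
      fun i => i.1.1.elim0, one_mem _, fun t _ => ⟨rfl, ?_⟩, ⟨one_ne_zero, Subsingleton.elim _ _⟩,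
      one_ne_zero, Subsingleton.elim _ _⟩
    rw [jordanFiber_eq_univ hS]
    trivial
  | succ n ih =>
    obtain ⟨e, h1, h2, h3⟩ := hS.isHorizontalStrip.exists_embedding
    obtain ⟨col, hcol⟩ := hS.exists_columns
    have he := isAdmissible_of_range_eq h1 h2 h3
    obtain ⟨z, U, hz, hU⟩ :=
      exists_isExt_of_mem_rankFiber hS (jordanFiber_subset_rankFiber μ S hV) he h2
    obtain ⟨z', U', hz', hU'⟩ :=
      exists_isExt_of_mem_rankFiber hS (jordanFiber_subset_rankFiber μ S hV') he h2
    obtain ⟨γ, c, Q, hc, hQ, hγ, ⟨hQ0, hγ0⟩, hQ1, hγ1⟩ := ih hS.restrict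
      ((hU.mem_jordanFiber_iff hS (he.comp_equiv hz)).1 hV)
      ((hU'.mem_jordanFiber_iff hS (he.comp_equiv hz')).1 hV')
    let Z : (Unit → ℂ) → BoxSpace lam →ₗ[ℂ] BoxSpace lam :=
      fun t => AffineMap.lineMap (k := ℂ) z.toLinearMap z'.toLinearMap (t ())
    have hZ0 : Z (fun _ => 0) = z.toLinearMap := AffineMap.lineMap_apply_zero _ _
    have hZ1 : Z (fun _ => 1) = z'.toLinearMap := AffineMap.lineMap_apply_one _ _
    have hZnil : ∀ t y, Z t (nil lam y) = nil lam (Z t y) := by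
      intro t y
      simp [Z, AffineMap.lineMap_apply, hz, hz']
    have hdet : (fun t => LinearMap.det (Z t)) ∈ polyFun Unit := by
      simp only [← LinearMap.det_toMatrix']
      refine det_mem_subalgebra _ fun i j => ?_
      simp only [LinearMap.toMatrix'_apply]
      exact lineMap_apply_mem _ _ _ _
    have hframe : ∀ t, ∃ f : Frame μ lam.cells, LinearMap.det (Z t) ≠ 0 →
        ∃ T : BoxSpace lam ≃ₗ[ℂ] BoxSpace lam, T.toLinearMap = Z t ∧
          f = stepFrame h2 hcol hS.sum_eq T (γ t) := by
      intro t
      by_cases ht : LinearMap.det (Z t) = 0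
      · exact ⟨stepFrame h2 hcol hS.sum_eq z (γ t), fun h => absurd ht h⟩
      · exact ⟨stepFrame h2 hcol hS.sum_eq ((Z t).equivOfDetNeZero ht) (γ t),
          fun _ => ⟨(Z t).equivOfDetNeZero ht, LinearMap.ext fun _ => rfl, rfl⟩⟩
    choose f hf using hframe
    have hext : ∀ t, LinearMap.det (Z t) ≠ 0 → IsExt (Z t ∘ₗ e) (γ t).flag (f t).flag := by
      intro t ht
      obtain ⟨T, hT, h⟩ := hf t ht
      rw [h, ← hT]
      exact isExt_stepFrame T (γ t)
    have hdet0 : LinearMap.det (Z fun _ => 0) ≠ 0 := by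
      rw [hZ0]
      exact (LinearEquiv.isUnit_det' z).ne_zero
    have hdet1 : LinearMap.det (Z fun _ => 1) ≠ 0 := by
      rw [hZ1]
      exact (LinearEquiv.isUnit_det' z').ne_zero
    refine ⟨f, fun t p => extVec (Z t ∘ₗ e) (fun a => Z t (boxVec lam 0 (col a)))
      (fun q b => c t (q, b)) p.1 p.2, fun t => Q t * LinearMap.det (Z t), fun p => ?_,
      mul_mem hQ hdet, fun t ht => ⟨?_, ?_⟩, ⟨mul_ne_zero hQ0 hdet0, ?_⟩,
      mul_ne_zero hQ1 hdet1, ?_⟩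
    · exact extVec_apply_mem _ (fun y b => lineMap_apply_mem _ _ y b) (fun q b => hc (q, b))
        p.1 p.2
    · obtain ⟨T, hT, h⟩ := hf t (right_ne_zero_of_mul ht)
      have hcoord : (fun q b => c t (q, b)) = (γ t).vec := by
        rw [← (hγ t (left_ne_zero_of_mul ht)).1]
        rfl
      beta_reduce
      rw [h, hcoord, ← hT]
      rfl
    · obtain ⟨T, hT, -⟩ := hf t (right_ne_zero_of_mul ht)
      have hTnil : ∀ y, T (nil lam y) = nil lam (T y) := by
        intro y
        have := hZnil t y
        rwa [← hT] at this
      refine (IsExt.mem_jordanFiber_iff hS (he.comp_equiv hTnil) ?_).2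
        (hγ t (left_ne_zero_of_mul ht)).2
      rw [hT]
      exact hext t (right_ne_zero_of_mul ht)
    · have := hext (fun _ => 0) hdet0
      rw [hZ0, hγ0] at this
      exact this.right_unique hU
    · have := hext (fun _ => 1) hdet1
      rw [hZ1, hγ1] at this
      exact this.right_unique hU'

end Curves

/-! ### Rank conditions -/

section Rank

/-- Ranks are lower semicontinuous: a non-zero minor remains non-zero nearby. -/
theorem isOpen_le_finrank_map {n : ℕ} {μ : Fin n → ℕ} {ι : Type} [Fintype ι]
    (J : Set (PartialFlag μ ι)) (N : (ι → ℂ) →ₗ[ℂ] (ι → ℂ)) (j : Fin (n + 1)) (r : ℕ) :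
    IsOpen (((↑) : J → PartialFlag μ ι) ⁻¹'
      {V | r ≤ Module.finrank ℂ ((V.space j).map N)}) := by
  rw [isOpen_preimage_coe_iff]
  intro v hvJ hr
  have hflag : ∀ w : Frame μ ι, w.flag.space j =
      Submodule.span ℂ (Set.range fun p : {p : Σ i : Fin n, Fin (μ i) // p.1.castSucc < j} =>
        w.vec p) := by
    intro w
    change Submodule.span ℂ (w.vec '' _) = _
    rw [Set.image_eq_range]
    rfl
  obtain ⟨u, hu⟩ := exists_linearIndependent_of_le_finrank hr
  have hu' : ∀ i, ∃ g : {p : Σ i : Fin n, Fin (μ i) // p.1.castSucc < j} → ℂ,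
      N (∑ p, g p • v.vec p) = u i := by
    intro i
    obtain ⟨y, hy, hyu⟩ := (u i).2
    rw [SetLike.mem_coe, hflag, Submodule.mem_span_range_iff_exists_fun] at hy
    obtain ⟨g, rfl⟩ := hy
    exact ⟨g, hyu⟩
  choose g hg using hu'
  have hui : LinearIndependent ℂ fun i => (u i : ι → ℂ) :=
    hu.map' (Submodule.subtype _) (Submodule.ker_subtype _)
  obtain ⟨P, hP⟩ := LinearMap.exists_leftInverse_of_injective _ (linearIndependent_iff_ker.1 hui)
  -- the same combinations of the vectors of `w`, in the coordinates given by the images for `v`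
  let M : Frame μ ι → Matrix (Fin r) (Fin r) ℂ := fun w =>
    Matrix.of fun i k => P (N (∑ p, g i p • w.vec p)) k
  have hM : ∀ i k, (fun w => M w i k) ∈ ratAt (Frame.flag ⁻¹' J) v := by
    intro i k
    refine linear_apply_mem (X := Frame μ ι) (ι := Fin r)
      (L := fun _ => (Finsupp.linearEquivFunOnFinite ℂ ℂ (Fin r)).toLinearMap ∘ₗ P ∘ₗ N)
      (y := fun w => ∑ p, g i p • w.vec p) _ (fun _ => const_mem_subalgebra _ _) fun b => ?_
    have h : (fun w : Frame μ ι => (∑ p, g i p • w.vec p) b) =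
        ∑ p : {p : Σ i : Fin n, Fin (μ i) // p.1.castSucc < j},
          g i p • fun w : Frame μ ι => w.vec p b := by
      funext w
      simp [Finset.sum_apply]
    rw [h]
    exact sum_mem fun p _ => Subalgebra.smul_mem _
      (coord_mem_ratAt (D := Frame.flag ⁻¹' J) (v := v) (p.1, b)) _
  have hMv : M v = 1 := by
    ext i k
    have h := LinearMap.congr_fun hP (Finsupp.single i 1)
    rw [LinearMap.comp_apply, Finsupp.linearCombination_single, one_smul] at h
    change P (N (∑ p, g i p • v.vec p)) k = _
    rw [hg, h, LinearMap.id_apply, Finsupp.single_apply, Matrix.one_apply]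
  have hdet : ∀ᶠ w in 𝓝[Frame.flag ⁻¹' J] v, (M w).det ≠ 0 :=
    eventually_ne_zero_of_mem_ratAt (det_mem_subalgebra _ hM) hvJ (by simp [hMv])
  filter_upwards [hdet] with w hw
  have hmem : ∀ i, N (∑ p, g i p • w.vec p) ∈ (w.flag.space j).map N := fun i =>
    Submodule.mem_map_of_mem (Submodule.sum_mem _ fun p _ =>
      Submodule.smul_mem _ _ (w.vec_mem_flag p.2))
  have hind : LinearIndependent ℂ fun i =>
      (⟨N (∑ p, g i p • w.vec p), hmem i⟩ : (w.flag.space j).map N) := by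
    refine LinearIndependent.of_comp ((Finsupp.linearEquivFunOnFinite ℂ ℂ (Fin r)).toLinearMap ∘ₗ
      P ∘ₗ Submodule.subtype _) ?_
    exact Matrix.linearIndependent_rows_iff_isUnit.2
      ((Matrix.isUnit_iff_isUnit_det _).2 (isUnit_iff_ne_zero.2 hw))
  simpa using hind.fintype_card_le_finrank

theorem nil_pow_eq_zero {nu : YoungDiagram} {k : ℕ} (h : (k, 0) ∉ nu) : nil nu ^ k = 0 :=
  boxSpace_hom_ext fun i c _ => by
    rw [nil_pow_boxVec, boxVec_eq_zero, LinearMap.zero_apply]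
    exact fun h' => h (nu.up_left_mem (Nat.le_add_left k i) (Nat.zero_le c) h')

theorem isLocallyClosed_jordanFiber {n : ℕ} {μ : Fin n → ℕ} {lam : YoungDiagram}
    {S : SemistandardYoungTableau lam} (hS : IsStd μ S) :
    IsLocallyClosed (((↑) : spaltenstein lam μ → PartialFlag μ lam.cells) ⁻¹' jordanFiber μ S) := by
  rw [← rankFiber_eq_jordanFiber μ hS]
  let R : Fin (n + 1) → ℕ → ℕ → Set (spaltenstein lam μ) := fun j k r =>
    (↑) ⁻¹' {V : PartialFlag μ lam.cells | r ≤ Module.finrank ℂ ((V.space j).map (nil lam ^ k))}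
  have hR : ∀ j k r, IsOpen (R j k r) := fun j k r => isOpen_le_finrank_map _ _ _ _
  let r : Fin (n + 1) → ℕ → ℕ := fun j k =>
    Module.finrank ℂ (LinearMap.range (nil (subshape S j) ^ k))
  -- the powers of exponent at least the height of `lam` impose no lower bounds
  have hr : ∀ j k, lam.colLen 0 ≤ k → r j k = 0 := by
    intro j k hk
    have h0 : nil (subshape S j) ^ k = 0 := nil_pow_eq_zero fun h =>
      (YoungDiagram.mem_iff_lt_colLen.1 (mem_subshape.1 h).1).not_ge hk
    simp [r, h0]
  have heq : ((↑) : spaltenstein lam μ → PartialFlag μ lam.cells) ⁻¹' rankFiber μ S =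
      (⋂ j, ⋂ k ∈ Finset.range (lam.colLen 0), R j k (r j k)) ∩ ⋂ j, ⋂ k, (R j k (r j k + 1))ᶜ := by
    ext V
    simp only [Set.mem_preimage, rankFiber, Set.mem_ofPred_eq, Set.mem_inter_iff, Set.mem_iInter,
      Finset.mem_range, Set.mem_compl_iff, R]
    constructor
    · rintro ⟨-, h⟩
      exact ⟨fun j k _ => (h j k).ge, fun j k => by rw [h j k]; simp [r]⟩
    · rintro ⟨h, h'⟩
      refine ⟨V.2, fun j k => le_antisymm (not_lt.1 (h' j k)) ?_⟩
      rcases lt_or_ge k (lam.colLen 0) with hk | hk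
      · exact h j k hk
      · exact (hr j k hk).le.trans (Nat.zero_le _)
  rw [heq]
  refine ⟨_, _, ?_, ?_, rfl⟩
  · exact isOpen_iInter_of_finite fun j => isOpen_biInter_finset fun k _ => hR _ _ _
  · exact isClosed_iInter fun j => isClosed_iInter fun k => (hR _ _ _).isClosed_compl

end Rank

end

end Spaltenstein

theorem theorem2p6 (n d : ℕ) (lam : YoungDiagram) (hlam : lam.card = d)
    (hheight : lam.colLen 0 ≤ n) (μ : Fin n → ℕ) (hμ : ∑ i, μ i = d)
    (S : SemistandardYoungTableau lam) (hS : S ∈ Spaltenstein.Std lam μ) :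
    (IsLocallyClosed (((↑) : Spaltenstein.spaltenstein lam μ →
          Spaltenstein.PartialFlag μ lam.cells) ⁻¹' Spaltenstein.jordanFiber μ S) ∧
      Spaltenstein.IsSmooth (Spaltenstein.jordanFiber μ S) ∧
      IsIrreducible (Spaltenstein.jordanFiber μ S) ∧
      topologicalKrullDim (Spaltenstein.jordanFiber μ S) + (Spaltenstein.dNum μ : WithBot ℕ∞) =
        (Spaltenstein.dNum (fun i : Fin n => lam.rowLen i) : WithBot ℕ∞)) ∧
    (∃ Y, Spaltenstein.IsPavingCell μ S Y) ∧
    ∀ Y, Spaltenstein.IsPavingCell μ S Y →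
      Y ⊆ Spaltenstein.jordanFiber μ S ∧
      IsOpen (((↑) : Spaltenstein.jordanFiber μ S →
        Spaltenstein.PartialFlag μ lam.cells) ⁻¹' Y) ∧
      Dense (((↑) : Spaltenstein.jordanFiber μ S →
        Spaltenstein.PartialFlag μ lam.cells) ⁻¹' Y) := by
  open Spaltenstein in
  have hstd : IsStd μ S := isStd_of_mem_std hS (hμ.trans hlam.symm)
  obtain ⟨Y₀, hY₀⟩ := exists_isPavingCell hstd
  have hne : ∀ Y, IsPavingCell μ S Y → Y.Nonempty ∧ Y ⊆ jordanFiber μ S := by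
    intro Y hY
    obtain ⟨σ, _, φ, -⟩ := hY.exists_chart hstd
    exact ⟨⟨_, φ.flag_frame_mem 0⟩, φ.subset⟩
  have hirr : IsIrreducible (jordanFiber μ S) :=
    isIrreducible_of_joinedByCurve ((hne Y₀ hY₀).1.mono (hne Y₀ hY₀).2)
      fun V hV V' hV' => joinedByCurve_jordanFiber hstd hV hV'
  have hcharts : ∀ V ∈ jordanFiber μ S, ∃ (Y : Set (PartialFlag μ lam.cells)) (σ : Type)
      (_ : Finite σ) (_ : Chart (jordanFiber μ S) Y σ),
      V ∈ Y ∧ Nat.card σ = dNum (fun i : Fin n => lam.rowLen i) - dNum μ := by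
    intro V hV
    obtain ⟨z, Y, hz, hY, hVY⟩ := exists_isPavingCell_map hstd hV
    obtain ⟨σ, hσ, φ, hcard⟩ := hY.exists_chart hstd
    refine ⟨_, σ, hσ, φ.map z (map_mem_jordanFiber_iff S hz), hVY, ?_⟩
    rw [dNum_rowLen hheight, ← hcard, Nat.add_sub_cancel]
  have hle : dNum μ ≤ dNum (fun i : Fin n => lam.rowLen i) := by
    obtain ⟨σ, _, -, hcard⟩ := hY₀.exists_chart hstd
    rw [dNum_rowLen hheight, ← hcard]
    exact Nat.le_add_left _ _
  refine ⟨⟨isLocallyClosed_jordanFiber hstd, isSmooth_of_charts fun V hV => ?_, hirr, ?_⟩,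
    ⟨Y₀, hY₀⟩, fun Y hY => ?_⟩
  · obtain ⟨Y, σ, hσ, φ, hVY, -⟩ := hcharts V hV
    exact ⟨Y, σ, hσ, φ, hVY⟩
  · rw [topologicalKrullDim_of_charts hirr.nonempty hcharts]
    exact_mod_cast Nat.sub_add_cancel hle
  · have hopen : IsOpen (((↑) : jordanFiber μ S → PartialFlag μ lam.cells) ⁻¹' Y) := by
      obtain ⟨σ, _, φ, -⟩ := hY.exists_chart hstd
      exact isOpen_preimage_coe_iff.2 fun v _ hv => φ.eventually_mem hv
    have : PreirreducibleSpace (jordanFiber μ S) := Subtype.preirreducibleSpace hirr.2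
    obtain ⟨V, hV⟩ := (hne Y hY).1
    exact ⟨(hne Y hY).2, hopen, hopen.dense ⟨⟨V, (hne Y hY).2 hV⟩, hV⟩⟩
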